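/- Let $k$ be a field, $n\ge 1$, and let $\mathbf m=(m_0,\dots,m_n)$ be an arithmetic sequence with common difference $d\ge 1$, that is, $m_i=m_0+id$ for $0\le i\le n$, where $m_0,\dots,m_n$ are relatively prime and minimally generate the numerical semigroup $\sum_i m_i\mathbb N$. Write $m_0=an+b$ with positive integers $a,b$ and $b\in[1,n]$. Let $R=k[X_0,\dots,X_n]$ be graded by $\deg X_i=m_i$, and let $\mathcal P\subset R$ be the defining ideal of the monomial curve, i.e. the kernel of the $k$-algebra homomorphism $R\to k[t]$, $X_i\mapsto t^{m_i}$. For $0\le t\le n$ let $\sigma(n,t)$ denote the collection, with repetitions, of all sums of $t$ distinct integers in $[0,n-1]$ (so $\sigma(n,0)=\{0\}$). Then $R/\mathcal P$ is Cohen–Macaulay of codimension $n$ (i.e. $\mathcal P$ has height $n$), and its minimal graded free resolution is $$0\to F_n\to E_{n-1}\oplus F_{n-1}\to\cdots\to E_1\oplus F_1\to R\to R/\mathcal P\to 0,$$ where, for $1\le s\le n-1$, $$E_s=\bigoplus_{\kappa=1}^{s}\ \bigoplus_{r\in\sigma(n,s+1)}R\bigl(-[(s+1)m_0+\kappa d+rd]\bigr)$$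 and, for $1\le s\le n$, $$F_s=\begin{cases}\displaystyle\bigoplus_{\kappa=s-1}^{n-b}\ \bigoplus_{r\in\sigma(n,s-1)}R\bigl(-[m_0(a+d+s)+\kappa d+rd]\bigr)&\text{if } 1\le s\le n-b+1,\\[3mm]\displaystyle\bigoplus_{\kappa=n-b+1}^{s-1}\ \bigoplus_{r\in\sigma(n,s)}R\bigl(-[m_0(a+d+s+1)+\kappa d+rd]\bigr)&\text{if } n-b+2\le s\le n.\end{cases}$$ Here $\mathbf E$ (with $E_0=R$) is the Eagon–Northcott complex of the matrix $\begin{pmatrix}X_0&\cdots&X_{n-1}\\X_1&\cdots&X_n\end{pmatrix}$; it is a minimal graded free resolution of $R/J$, where $J$ is the ideal of $2\times2$ minors of this matrix (the ideal of the rational normal curve), and it is a subcomplex of the resolution above. -/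

import Mathlib

open MvPolynomial

/-- A local ring is Cohen–Macaulay if it is Noetherian and its maximal ideal contains a regular
sequence whose length is the Krull dimension. -/
def IsCohenMacaulayLocal (A : Type*) [CommRing A] [IsLocalRing A] : Prop :=
  IsNoetherianRing A ∧ ∃ rs : List A,
    (∀ r ∈ rs, r ∈ IsLocalRing.maximalIdeal A) ∧
    RingTheory.Sequence.IsRegular A rs ∧
    (rs.length : WithBot ℕ∞) = ringKrullDim A

/-- A ring is Cohen–Macaulay if it is Noetherian and all its localizations at prime ideals are
Cohen–Macaulay local rings. -/
def IsCohenMacaulay (A : Type*) [CommRing A] : Prop :=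
  IsNoetherianRing A ∧ ∀ (p : Ideal A) [p.IsPrime], IsCohenMacaulayLocal (Localization.AtPrime p)

/-- `m = (m₀, …, mₙ)` is an arithmetic sequence with common difference `d ≥ 1`: the `mᵢ` are
relatively prime and minimally generate the numerical semigroup `∑ mᵢ ℕ`. -/
structure IsArithmeticSequence {n : ℕ} (m : Fin (n + 1) → ℕ) (d : ℕ) : Prop where
  one_le : 1 ≤ d
  eq_add : ∀ i, m i = m 0 + (i : ℕ) * d
  gcd_eq_one : Finset.univ.gcd m = 1
  minimal : ∀ i, m i ∉ AddSubmonoid.closure (m '' {j | j ≠ i})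

section Curve

variable (k : Type*) [Field k]

/-- The defining ideal of the monomial curve `Xᵢ = t ^ mᵢ`. -/
noncomputable def monomialCurveIdeal {n : ℕ} (m : Fin (n + 1) → ℕ) :
    Ideal (MvPolynomial (Fin (n + 1)) k) :=
  RingHom.ker (aeval (R := k) fun i => (Polynomial.X : Polynomial k) ^ m i)

/-- The `2 × n` matrix with rows `X₀, …, Xₙ₋₁` and `X₁, …, Xₙ`. -/
noncomputable def curveMatrix (n : ℕ) : Matrix (Fin 2) (Fin n) (MvPolynomial (Fin (n + 1)) k) :=
  Matrix.of ![fun j => X j.castSucc, fun j => X j.succ]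

/-- The ideal of the rational normal curve: the `2 × 2` minors of `curveMatrix`. -/
noncomputable def rationalNormalCurveIdeal (n : ℕ) : Ideal (MvPolynomial (Fin (n + 1)) k) :=
  Ideal.span {f | ∃ i j : Fin n, i < j ∧ f = ((curveMatrix k n).submatrix id ![i, j]).det}

end Curve

section Resolution

variable {σ k : Type*} [Field k]

/-- Let `R = k[X_σ]` be graded by the weights `w`. The data `ι`, `deg`, `D` describe the sequence
`⋯ → ⨁_{j : ι 1} R(-deg 1 j) → ⨁_{i : ι 0} R(-deg 0 i)` of graded free modules of finite rank
(the basis element `i` of the `s`-th module has degree `deg s i`), where `D s` is the matrix of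
the `s`-th map, from the module in position `s + 1` to the one in position `s`. Together with the
augmentation to `R ⧸ I` that sends the basis element `i` to the class of `g i`, it is a minimal
graded free resolution of `R ⧸ I`. -/
structure IsMinimalGradedFreeResolution (w : σ → ℤ) (I : Ideal (MvPolynomial σ k))
    {ι : ℕ → Type*} [∀ s, Fintype (ι s)] (deg : ∀ s, ι s → ℤ)
    (D : ∀ s, Matrix (ι s) (ι (s + 1)) (MvPolynomial σ k))
    (g : ι 0 → MvPolynomial σ k) : Prop where
  /-- The augmentation and all maps are homogeneous of degree zero. -/
  homogeneous_aug : ∀ i, IsWeightedHomogeneous w (g i) (deg 0 i)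
  homogeneous : ∀ s i j, IsWeightedHomogeneous w (D s i j) (deg (s + 1) j - deg s i)
  surjective : Function.Surjective
    (Fintype.linearCombination (MvPolynomial σ k) fun i => Ideal.Quotient.mk I (g i))
  exact_aug : Function.Exact (D 0).mulVecLin
    (Fintype.linearCombination (MvPolynomial σ k) fun i => Ideal.Quotient.mk I (g i))
  exact : ∀ s, Function.Exact (D (s + 1)).mulVecLin (D s).mulVecLin
  /-- Each map sends its source into `(X)` times its target. -/
  minimal : ∀ s i j, D s i j ∈ Ideal.span (Set.range (X : σ → MvPolynomial σ k))

end Resolution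

section EagonNorthcott

/-- Basis of the module `E_s` of the Eagon–Northcott complex. For `s ≥ 1`, the pair `(S, κ)` with
`S = {r₁ < ⋯ < r_{s+1}} ⊆ {0, …, n-1}` and `1 ≤ κ ≤ s` stands for
`e_S ⊗ g₁^{(s-κ)} g₂^{(κ-1)} ∈ ⋀^{s+1} F ⊗ D_{s-1} G`. -/
def enBasis (n s : ℕ) : Finset (Finset (Fin n) × ℕ) :=
  if s = 0 then {(∅, 0)}
  else Finset.powersetCard (s + 1) Finset.univ ×ˢ Finset.Icc 1 s

/-- Degrees of the generators of `E_s`: `0` for `s = 0`, and `(s+1) m₀ + κ d + (∑_{r ∈ S} r) d`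
for `s ≥ 1`. -/
def enDegree (n m₀ d s : ℕ) (x : enBasis n s) : ℤ :=
  if s = 0 then 0
  else (s + 1) * m₀ + x.1.2 * d + (∑ r ∈ x.1.1, (r : ℤ)) * d

/-- The Eagon–Northcott differential `E_{s+1} → E_s` of `A = curveMatrix k n`. For `s = 0` it sends
`e_i ∧ e_j`, `i < j`, to the minor of `A` on the columns `i, j`; for `s ≥ 1` it sends
`e_S ⊗ g₁^{(p)} g₂^{(q)}` to
`∑_{j ∈ S} ± e_{S ∖ j} ⊗ (A₀ⱼ g₁^{(p-1)} g₂^{(q)} + A₁ⱼ g₁^{(p)} g₂^{(q-1)})`,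
the sign being given by the position of `j` in `S`. -/
noncomputable def enDifferential (k : Type*) [Field k] (n s : ℕ) :
    Matrix (enBasis n s) (enBasis n (s + 1)) (MvPolynomial (Fin (n + 1)) k) :=
  Matrix.of fun y x =>
    if s = 0 then
      ∑ i ∈ x.1.1, ∑ j ∈ x.1.1,
        if i < j then ((curveMatrix k n).submatrix id ![i, j]).det else 0
    else
      ∑ j ∈ x.1.1,
        if y.1.1 = x.1.1.erase j then
          (-1) ^ (x.1.1.filter (· < j)).card *
            (if y.1.2 = x.1.2 then curveMatrix k n 0 j
              else if y.1.2 + 1 = x.1.2 then curveMatrix k n 1 j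
              else 0)
        else 0

end EagonNorthcott

section Complement

/-- Indices of the summands of `F_s`: pairs `(S, κ)` with `S ⊆ {0, …, n-1}`, where
* `|S| = s - 1` and `s - 1 ≤ κ ≤ n - b` if `1 ≤ s ≤ n - b + 1`,
* `|S| = s` and `n - b + 1 ≤ κ ≤ s - 1` if `n - b + 2 ≤ s`
  (which is empty for `s > n`). -/
def fBasis (n b s : ℕ) : Finset (Finset (Fin n) × ℕ) :=
  if s = 0 then ∅
  else if s ≤ n - b + 1 then
    Finset.powersetCard (s - 1) Finset.univ ×ˢ Finset.Icc (s - 1) (n - b)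
  else Finset.powersetCard s Finset.univ ×ˢ Finset.Icc (n - b + 1) (s - 1)

/-- Degrees of the generators of `F_s`: `m₀ (a+d+s) + κ d + (∑_{r ∈ S} r) d` for
`1 ≤ s ≤ n - b + 1`, and `m₀ (a+d+s+1) + κ d + (∑_{r ∈ S} r) d` for `n - b + 2 ≤ s`. -/
def fDegree (n m₀ a b d s : ℕ) (x : fBasis n b s) : ℤ :=
  if s ≤ n - b + 1 then
    m₀ * (a + d + s) + x.1.2 * d + (∑ r ∈ x.1.1, (r : ℤ)) * d
  else
    m₀ * (a + d + s + 1) + x.1.2 * d + (∑ r ∈ x.1.1, (r : ℤ)) * d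

end Complement

/-! ### Koszul complexes of commuting endomorphisms -/

section Koszul

variable {R M M' : Type*} [CommRing R] [AddCommGroup M] [Module R M] [AddCommGroup M'] [Module R M']
  {n : ℕ}

/-! Both complexes come from one construction. The forms `Xⱼ + x Xⱼ₊₁` are `n` sections of `O(1)` on
the projective line over `R`. Twist their Koszul complex by `O(l)`. The term at `e_S` is then `O(l -
|S|)`, and the Laurent monomial `x ^ (-κ)` is regular on one chart when `κ ≤ l` and on the other
when `|S| ≤ κ`. Thus `H⁰` has basis `|S| ≤ κ ≤ l` and `H¹` has basis `l < κ < |S|`. For `|S| = l +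
1` both vanish. The strand of `H⁰`s (`|S| ≤ l`) and the strand of `H¹`s (`|S| ≥ l + 2`) are joined
by a connecting map, which gives a complex of free `R`-modules. For `l = 0` it is the
Eagon–Northcott complex `E`; for `l = n - b`, shifted by one position and by `m₀ (a + d + 1)` in
degree, it is `F`.

Exactness is a Čech argument. On each chart the forms are a regular sequence in `R[x]`: modulo the
first `m` of them the ring is again polynomial, by `mk_leSubst` and `mk_geSubst`. So the Koszul
complex is exact there (`koszul_exact`). Comparing preimages on the two charts, and truncating the
Laurent chain that bounds their difference, gives `splice_exact`. In position zero,
`splice_exact_zero` shows that the image of the first differential is the common kernel of two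
evaluations, one per chart; for `l = 0` this says that `J` is the common kernel of two
substitutions.

The ideal of the curve is `J` plus the binomials `topTerm - botTerm` for `κ ≤ n - b`
(`monomialCurveIdeal_eq`): modulo these, a monomial is determined by its exponent of `t`. On each
chart the map from `F₁` to `R ⧸ J` given by the binomials is the evaluation of `F₁` times one fixed
nonzero polynomial. Hence its kernel is exactly the image of `F₂`
(`exists_enDifferential_eq_sub_iff`), so the cokernel of `F₂ → F₁` embeds in `R ⧸ J` with quotient
the curve ring. The mapping cone of a comparison map `F → E` therefore resolves the curve ring.

For minimality, the top and bottom monomials are lifted separately. Each lift is homogeneous for the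
finer bigrading `deg Xᵢ = (1, i)`, and counting standard degrees shows that no entry has a constant
term. Both shifts have the same weight, so the difference of the lifts is homogeneous for the
weights `mᵢ`.

Cohen–Macaulayness and height are independent of this: the curve ring is a Noetherian domain
integral over `k[X₀]`, and an explicit chain of primes bounds the height from below. -/

/-- The sign of the position of `j` relative to `S`. -/
def posSign (R : Type*) [CommRing R] {n : ℕ} (j : Fin n) (S : Finset (Fin n)) : R :=
  (-1) ^ (S.filter (· < j)).card

/-- The Koszul differential of a family of endomorphisms of `M`; a chain assigns to `S` the
coefficient of `e_S`. -/
def koszul (f : Fin n → M →ₗ[R] M) : (Finset (Fin n) → M) →ₗ[R] (Finset (Fin n) → M) where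
  toFun z S := ∑ j ∈ Sᶜ, posSign R j S • f j (z (insert j S))
  map_add' z w := by
    funext S
    simp [Finset.sum_add_distrib]
  map_smul' r z := by
    funext S
    simp [Finset.smul_sum, smul_comm r]

theorem koszul_apply (f : Fin n → M →ₗ[R] M) (z : Finset (Fin n) → M) (S : Finset (Fin n)) :
    koszul f z S = ∑ j ∈ Sᶜ, posSign R j S • f j (z (insert j S)) := rfl

theorem posSign_insert_of_lt {i j : Fin n} {S : Finset (Fin n)} (hj : j ∉ S) (h : j < i) :
    posSign R i (insert j S) = - posSign R i S := by
  unfold posSign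
  rw [Finset.filter_insert, if_pos h, Finset.card_insert_of_notMem (by simp [hj]), pow_succ]
  simp

theorem posSign_insert_of_le {i j : Fin n} {S : Finset (Fin n)} (h : i ≤ j) :
    posSign R i (insert j S) = posSign R i S := by
  unfold posSign
  rw [Finset.filter_insert, if_neg (not_lt.2 h)]

theorem posSign_empty (j : Fin n) : posSign R j ∅ = 1 := by simp [posSign]

theorem posSign_mul_antisymm {i j : Fin n} {S : Finset (Fin n)} (hi : i ∉ S) (hj : j ∉ S)
    (hij : i ≠ j) :
    posSign R j S * posSign R i (insert j S) + posSign R i S * posSign R j (insert i S) = 0 := by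
  rcases lt_or_gt_of_ne hij with h | h
  · rw [posSign_insert_of_le h.le, posSign_insert_of_lt hi h]; ring
  · rw [posSign_insert_of_lt hj h, posSign_insert_of_le h.le]; ring

/-- Removing `i` then `j` and removing `j` then `i` give the same term with opposite signs, because
the endomorphisms commute. -/
theorem koszul_koszul {f : Fin n → M →ₗ[R] M} (hf : ∀ i j x, f i (f j x) = f j (f i x))
    (z : Finset (Fin n) → M) : koszul f (koszul f z) = 0 := by
  -- The double sum is extended by zero to all ordered pairs, so that swapping the two indices is an
  -- involution that cancels terms.
  funext S
  set F : Fin n × Fin n → M := fun p =>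
    if p.1 ∉ S ∧ p.2 ∉ S ∧ p.1 ≠ p.2 then
      (posSign R p.1 S * posSign R p.2 (insert p.1 S)) •
        f p.1 (f p.2 (z (insert p.2 (insert p.1 S)))) else 0 with hF
  have h : koszul f (koszul f z) S = ∑ p, F p := by
    rw [Fintype.sum_prod_type]
    simp only [koszul_apply, map_sum, Finset.smul_sum, LinearMap.map_smul, smul_smul]
    rw [← Finset.sum_subset (Finset.subset_univ (Sᶜ))]
    · refine Finset.sum_congr rfl fun i hi => ?_
      rw [← Finset.sum_subset (Finset.subset_univ ((insert i S)ᶜ))]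
      · refine Finset.sum_congr rfl fun j hj => ?_
        simp only [Finset.mem_compl, Finset.mem_insert, not_or] at hi hj
        rw [hF]
        simp only
        rw [if_pos ⟨hi, hj.2, fun h => hj.1 h.symm⟩]
      · intro j _ hj
        rw [hF]
        refine if_neg fun h => hj ?_
        simp only [Finset.mem_compl, Finset.mem_insert, not_or]
        exact ⟨fun e => h.2.2 e.symm, h.2.1⟩
    · intro i _ hi
      refine Finset.sum_eq_zero fun j _ => if_neg fun h => hi (by simpa using h.1)
  rw [h]
  refine Finset.sum_involution (fun p _ => p.swap) ?_ ?_ (by simp) (by simp)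
  · rintro ⟨i, j⟩ -
    simp only [hF, Prod.swap]
    by_cases hc : i ∉ S ∧ j ∉ S ∧ i ≠ j
    · rw [if_pos hc, if_pos ⟨hc.2.1, hc.1, hc.2.2.symm⟩, hf j i, Finset.insert_comm j i, ← add_smul,
        posSign_mul_antisymm hc.2.1 hc.1 hc.2.2.symm, zero_smul]
    · rw [if_neg hc, if_neg (fun h => hc ⟨h.2.1, h.1, h.2.2.symm⟩), add_zero]
  · rintro ⟨i, j⟩ - hne heq
    simp only [hF] at hne
    have : i = j := (congrArg Prod.snd heq : _)
    simp [this] at hne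

/-- Koszul differentials are compatible with maps that intertwine the endomorphisms. -/
theorem koszul_comp {f : Fin n → M →ₗ[R] M} {f' : Fin n → M' →ₗ[R] M'} {g h : M' →ₗ[R] M}
    (hgh : ∀ j x, f j (g x) = h (f' j x)) (z : Finset (Fin n) → M') :
    koszul f (fun S => g (z S)) = fun S => h (koszul f' z S) := by
  funext S
  simp [koszul_apply, hgh, map_sum]

/-- Projection of a chain to the part supported on sets of cardinality `j`. -/
def cardProj (R : Type*) [CommRing R] {M : Type*} [AddCommGroup M] [Module R M] {n : ℕ} (j : ℕ) :
    (Finset (Fin n) → M) →ₗ[R] (Finset (Fin n) → M) where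
  toFun z S := if S.card = j then z S else 0
  map_add' z w := by
    funext S
    by_cases h : S.card = j <;> simp [h]
  map_smul' r z := by
    funext S
    by_cases h : S.card = j <;> simp [h]

theorem cardProj_apply (j : ℕ) (z : Finset (Fin n) → M) (S : Finset (Fin n)) :
    cardProj R j z S = if S.card = j then z S else 0 := rfl

theorem koszul_cardProj (f : Fin n → M →ₗ[R] M) (j : ℕ) (z : Finset (Fin n) → M) :
    koszul f (cardProj R (j + 1) z) = cardProj R j (koszul f z) := by
  funext S
  rw [cardProj_apply, koszul_apply]
  have h : ∀ i ∈ Sᶜ, (cardProj R (j + 1) z) (insert i S) =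
      if S.card = j then z (insert i S) else 0 := by
    intro i hi
    rw [cardProj_apply, Finset.card_insert_of_notMem (by simpa using hi)]
    simp
  rw [Finset.sum_congr rfl fun i hi => by rw [h i hi]]
  split_ifs with hc
  · rfl
  · simp

end Koszul

/-! ### Exactness of the Koszul complex of a weakly regular sequence -/

section KoszulExact

variable {R A : Type*} [CommRing R] [CommRing A] [Algebra R A] {n : ℕ}

/-- With `z` split into the part without `e` and `e` times the rest, this is the part of the
differential without `e`; `koszul_apply_insert` is the part containing `e`. For `e` the largest
index in use, no sign appears in the latter. -/
theorem koszul_apply_of_notMem (f : Fin n → A →ₗ[R] A) (z : Finset (Fin n) → A) (e : Fin n)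
    {S : Finset (Fin n)} (he : e ∉ S) :
    koszul f z S = koszul f (fun S => if e ∈ S then 0 else z S) S +
      posSign R e S • f e (z (insert e S)) := by
  have heS : e ∈ Sᶜ := by simpa using he
  rw [koszul_apply, koszul_apply, ← Finset.add_sum_erase _ _ heS, ← Finset.add_sum_erase _ _ heS,
    add_comm]
  congr 1
  simp only [Finset.mem_insert_self, if_true, map_zero, smul_zero, zero_add]
  refine Finset.sum_congr rfl fun j hj => ?_
  have : e ∉ insert j S := by
    simp only [Finset.mem_erase] at hj
    simp [he, hj.1.symm]
  rw [if_neg this]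

theorem koszul_apply_insert (f : Fin n → A →ₗ[R] A) (z : Finset (Fin n) → A) (e : Fin n)
    (hz : ∀ S, z S ≠ 0 → ∀ i ∈ S, i ≤ e) {S : Finset (Fin n)} (he : e ∉ S) :
    koszul f z (insert e S) = koszul f (fun S => if e ∈ S then 0 else z (insert e S)) S := by
  have heS : e ∈ Sᶜ := by simpa using he
  rw [koszul_apply, koszul_apply, ← Finset.add_sum_erase _ _ heS]
  simp only [Finset.mem_insert_self, if_true, map_zero, smul_zero, zero_add]
  rw [Finset.compl_insert]
  refine Finset.sum_congr rfl fun j hj => ?_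
  simp only [Finset.mem_erase] at hj
  have h1 : e ∉ insert j S := by simp [he, hj.1.symm]
  rw [if_neg h1, Finset.insert_comm]
  by_cases h0 : z (insert e (insert j S)) = 0
  · simp [h0]
  · have := hz _ h0 j (by simp)
    rw [posSign_insert_of_le this]

/-- The Koszul complex of a weakly regular sequence is exact, for chains supported on the first
`m` indices. -/
theorem koszul_exact_of_subset (ℓ : Fin n → A)
    (hreg : ∀ m : Fin n, ∀ a, ℓ m * a ∈ Ideal.span (ℓ '' {j | j < m}) →
      a ∈ Ideal.span (ℓ '' {j | j < m})) (m : ℕ) (hm : m ≤ n) :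
    ∀ z : Finset (Fin n) → A, (∀ S, z S ≠ 0 → ∀ i ∈ S, (i : ℕ) < m) →
      koszul (fun j => LinearMap.mulLeft R (ℓ j)) z = 0 →
      z ∅ ∈ Ideal.span (ℓ '' {j | (j : ℕ) < m}) →
      ∃ w : Finset (Fin n) → A, (∀ S, w S ≠ 0 → ∀ i ∈ S, (i : ℕ) < m) ∧
        koszul (fun j => LinearMap.mulLeft R (ℓ j)) w = z := by
  induction m with
  | zero =>
    intro z hz _ h0
    refine ⟨0, by simp, ?_⟩
    rw [map_zero]
    funext S
    by_contra hne
    rcases S.eq_empty_or_nonempty with rfl | ⟨i, hi⟩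
    · simp at h0
      exact hne h0.symm
    · exact absurd (hz S (fun h => hne h.symm) i hi) (by simp)
  | succ m ih =>
    intro z hz hdz h0
    set f : Fin n → A →ₗ[R] A := fun j => LinearMap.mulLeft R (ℓ j) with hf
    have hf' : ∀ j a, f j a = ℓ j * a := fun j a => rfl
    set e : Fin n := ⟨m, hm⟩ with he
    have hlt : ∀ S : Finset (Fin n), (∀ i ∈ S, (i : ℕ) < m) → e ∉ S := fun S h h' =>
      lt_irrefl _ (h e h')
    have hspan : Ideal.span (ℓ '' {j | (j : ℕ) < m + 1}) =
        Ideal.span (ℓ '' {j | (j : ℕ) < m}) ⊔ Ideal.span {ℓ e} := by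
      rw [← Ideal.span_union]
      congr 1
      ext a
      simp only [Set.mem_image, Set.mem_ofPred_eq, Set.union_singleton, Set.mem_insert_iff]
      constructor
      · rintro ⟨j, hj, rfl⟩
        rcases Nat.lt_succ_iff_lt_or_eq.1 hj with h | h
        · exact Or.inr ⟨j, h, rfl⟩
        · left; congr 1; exact Fin.ext h
      · rintro (rfl | ⟨j, hj, rfl⟩)
        · exact ⟨e, by simp [he], rfl⟩
        · exact ⟨j, by omega, rfl⟩
    set z₁ : Finset (Fin n) → A := fun S => if e ∈ S then 0 else z S with hz₁
    set z₂ : Finset (Fin n) → A := fun S => if e ∈ S then 0 else z (insert e S) with hz₂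
    have hzle : ∀ S, z S ≠ 0 → ∀ i ∈ S, i ≤ e := fun S h i hi =>
      Fin.le_def.2 (Nat.lt_succ_iff.1 (hz S h i hi))
    have hlt' : ∀ (i : Fin n), i ≤ e → i ≠ e → (i : ℕ) < m := fun i h1 h2 => by
      have : (i : ℕ) ≠ m := fun h => h2 (Fin.ext h)
      have : (i : ℕ) ≤ m := h1
      omega
    have hs₁ : ∀ S, z₁ S ≠ 0 → ∀ i ∈ S, (i : ℕ) < m := by
      intro S h i hi
      simp only [hz₁, ne_eq, ite_eq_left_iff, not_forall] at h
      obtain ⟨h1, h2⟩ := h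
      exact hlt' i (hzle S h2 i hi) (fun h => h1 (h ▸ hi))
    have hs₂ : ∀ S, z₂ S ≠ 0 → ∀ i ∈ S, (i : ℕ) < m := by
      intro S h i hi
      simp only [hz₂, ne_eq, ite_eq_left_iff, not_forall] at h
      obtain ⟨h1, h2⟩ := h
      exact hlt' i (hzle _ h2 i (Finset.mem_insert_of_mem hi)) (fun h => h1 (h ▸ hi))
    have hmem0 : ∀ v : Finset (Fin n) → A, (∀ S, v S ≠ 0 → ∀ i ∈ S, (i : ℕ) < m) →
        ∀ S, e ∈ S → koszul f v S = 0 := by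
      intro v hv S heS
      rw [koszul_apply]
      refine Finset.sum_eq_zero fun j _ => ?_
      have : v (insert j S) = 0 := by
        by_contra h
        exact hlt _ (hv _ h) (by simp [heS])
      simp [this]
    have hd₂ : koszul f z₂ = 0 := by
      funext S
      by_cases heS : e ∈ S
      · exact hmem0 _ hs₂ S heS
      · rw [hz₂, ← koszul_apply_insert f z e hzle heS, hdz]; rfl
    have hd₁ : ∀ S, e ∉ S → koszul f z₁ S = - (posSign R e S • (ℓ e * z₂ S)) := by
      intro S heS
      have h := koszul_apply_of_notMem f z e heS
      rw [hdz] at h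
      simp only [hz₂, if_neg heS]
      exact eq_neg_of_add_eq_zero_left h.symm
    -- In degree zero the cycle condition puts `ℓ e * z₂ ∅` in the ideal of the earlier forms, and
    -- regularity cancels `ℓ e`.
    have hz20 : z₂ ∅ ∈ Ideal.span (ℓ '' {j | (j : ℕ) < m}) := by
      refine hreg e _ ?_
      have h := hd₁ ∅ (by simp)
      rw [posSign_empty, one_smul, eq_neg_iff_add_eq_zero, add_comm, ← eq_neg_iff_add_eq_zero] at h
      rw [h, koszul_apply]
      refine neg_mem (Ideal.sum_mem _ fun j _ => ?_)
      by_cases hj : z₁ (insert j ∅) = 0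
      · rw [hj, map_zero, smul_zero]
        exact zero_mem _
      · rw [posSign_empty, one_smul, hf']
        exact Ideal.mul_mem_right _ _ (Ideal.subset_span ⟨j, hs₁ _ hj j (by simp), rfl⟩)
    obtain ⟨w₂', hw₂', hdw₂'⟩ := ih (by omega) z₂ hs₂ hd₂ hz20
    rw [hspan, Submodule.mem_sup] at h0
    obtain ⟨s, hs, s', hs', hss⟩ := h0
    obtain ⟨r, rfl⟩ := Ideal.mem_span_singleton'.1 hs'
    -- The differential never reads the value at `∅`, so it is free. Taking `r` there moves the
    -- remaining degree-zero coefficient into the ideal of the earlier forms.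
    set w₂ := Function.update w₂' ∅ r with hw₂def
    have hw₂ : ∀ S, w₂ S ≠ 0 → ∀ i ∈ S, (i : ℕ) < m := by
      intro S h i hi
      have hS : S ≠ ∅ := fun h => by simp [h] at hi
      rw [hw₂def, Function.update_of_ne hS] at h
      exact hw₂' S h i hi
    have hdw₂ : koszul f w₂ = z₂ := by
      rw [← hdw₂']
      funext S
      simp only [koszul_apply]
      refine Finset.sum_congr rfl fun j _ => ?_
      rw [hw₂def, Function.update_of_ne (Finset.insert_ne_empty _ _)]
    -- Subtracting the contribution of the `e` part of the intended preimage leaves a cycle on the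
    -- first `m` indices, to which induction applies.
    set y : Finset (Fin n) → A := fun S => z₁ S - posSign R e S • (ℓ e * w₂ S) with hy
    have hsy : ∀ S, y S ≠ 0 → ∀ i ∈ S, (i : ℕ) < m := by
      intro S h
      by_cases h1 : z₁ S = 0
      · by_cases h2 : w₂ S = 0
        · simp [hy, h1, h2] at h
        · exact hw₂ S h2
      · exact hs₁ S h1
    have hdy : koszul f y = 0 := by
      funext S
      by_cases heS : e ∈ S
      · exact hmem0 _ hsy S heS
      · have e1 : y = z₁ - fun S => posSign R e S • (ℓ e * w₂ S) := rfl
        rw [e1, map_sub, Pi.sub_apply, hd₁ S heS, ← hdw₂, koszul_apply, koszul_apply,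
          Finset.mul_sum, Finset.smul_sum, ← Finset.sum_neg_distrib, ← Finset.sum_sub_distrib]
        refine Finset.sum_eq_zero fun j hj => ?_
        by_cases h2 : w₂ (insert j S) = 0
        · simp [h2]
        · have hjm : j < e := hw₂ _ h2 j (by simp)
          rw [posSign_insert_of_lt (by simpa using hj) hjm, hf', hf']
          simp only [Algebra.smul_def, map_neg]
          ring
    have hy0 : y ∅ ∈ Ideal.span (ℓ '' {j | (j : ℕ) < m}) := by
      have : y ∅ = s := by
        simp only [hy, hz₁, hw₂def, posSign_empty, Function.update_self, one_smul,
          Finset.notMem_empty, if_false]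
        rw [← hss]
        ring
      rwa [this]
    obtain ⟨w₁, hw₁, hdw₁⟩ := ih (by omega) y hsy hdy hy0
    set w : Finset (Fin n) → A := fun S => if e ∈ S then w₂ (S.erase e) else w₁ S with hw
    have hsw : ∀ S, w S ≠ 0 → ∀ i ∈ S, (i : ℕ) < m + 1 := by
      intro S h i hi
      by_cases heS : e ∈ S
      · simp only [hw, if_pos heS] at h
        by_cases hie : i = e
        · simp [hie, he]
        · have := hw₂ _ h i (Finset.mem_erase.2 ⟨hie, hi⟩)
          omega
      · simp only [hw, if_neg heS] at h
        have := hw₁ _ h i hi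
        omega
    have hwins : ∀ S, e ∉ S → w (insert e S) = w₂ S := by
      intro S h
      simp only [hw, Finset.mem_insert_self, if_true, Finset.erase_insert h]
    refine ⟨w, hsw, ?_⟩
    have hwe1 : (fun S => if e ∈ S then 0 else w S) = w₁ := by
      funext S
      by_cases heS : e ∈ S
      · rw [if_pos heS]
        by_contra h
        exact hlt _ (hw₁ S (fun h' => h h'.symm)) heS
      · simp only [hw, if_neg heS]
    have hwe2 : (fun S => if e ∈ S then 0 else w (insert e S)) = w₂ := by
      funext S
      by_cases heS : e ∈ S
      · rw [if_pos heS]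
        by_contra h
        exact hlt _ (hw₂ S (fun h' => h h'.symm)) heS
      · rw [if_neg heS, hwins S heS]
    funext S
    by_cases heS : e ∈ S
    · have h := koszul_apply_insert f w e
        (fun S h i hi => Fin.le_def.2 (Nat.lt_succ_iff.1 (hsw S h i hi))) (Finset.notMem_erase e S)
      rw [Finset.insert_erase heS, hwe2, hdw₂] at h
      rw [h]
      simp only [hz₂, if_neg (Finset.notMem_erase e S), Finset.insert_erase heS]
    · rw [koszul_apply_of_notMem f w e heS, hwe1, hdw₁, hwins S heS, hf']
      simp only [hy, hz₁, if_neg heS, sub_add_cancel]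

/-- The Koszul complex of a weakly regular sequence is exact. -/
theorem koszul_exact (ℓ : Fin n → A)
    (hreg : ∀ m : Fin n, ∀ a, ℓ m * a ∈ Ideal.span (ℓ '' {j | j < m}) →
      a ∈ Ideal.span (ℓ '' {j | j < m}))
    (z : Finset (Fin n) → A) (hz : koszul (fun j => LinearMap.mulLeft R (ℓ j)) z = 0)
    (h0 : z ∅ ∈ Ideal.span (Set.range ℓ)) :
    ∃ w : Finset (Fin n) → A, koszul (fun j => LinearMap.mulLeft R (ℓ j)) w = z := by
  obtain ⟨w, -, hw⟩ := koszul_exact_of_subset (R := R) ℓ hreg n le_rfl z (fun _ _ i _ => i.2) hz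
    (by simpa using h0)
  exact ⟨w, hw⟩

end KoszulExact

/-! ### The linear forms on the two charts and their regularity -/

section CurveOperators

variable {k : Type*} [Field k] {n : ℕ}

/-- Multiplication by `Xⱼ + Xⱼ₊₁ x` on Laurent polynomials, where the coefficient of index `κ` is
the one of `x ^ (-κ)`. -/
noncomputable def curveOp (k : Type*) [Field k] {n : ℕ} (j : Fin n) :
    (ℤ →₀ MvPolynomial (Fin (n + 1)) k) →ₗ[MvPolynomial (Fin (n + 1)) k]
      (ℤ →₀ MvPolynomial (Fin (n + 1)) k) :=
  (X j.castSucc : MvPolynomial (Fin (n + 1)) k) • LinearMap.id +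
    (X j.succ : MvPolynomial (Fin (n + 1)) k) •
      (Finsupp.domLCongr (Equiv.subRight (1 : ℤ))).toLinearMap

theorem curveOp_apply (j : Fin n) (z : ℤ →₀ MvPolynomial (Fin (n + 1)) k) (κ : ℤ) :
    curveOp k j z κ = X j.castSucc * z κ + X j.succ * z (κ + 1) := by
  simp [curveOp, Finsupp.domLCongr_apply]

theorem curveOp_comm (i j : Fin n) (z : ℤ →₀ MvPolynomial (Fin (n + 1)) k) :
    curveOp k i (curveOp k j z) = curveOp k j (curveOp k i z) := by
  ext1 κ
  simp only [curveOp_apply]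
  ring

/-- The linear form `Xⱼ + x Xⱼ₊₁`. -/
noncomputable def leForm (k : Type*) [Field k] {n : ℕ} (j : Fin n) :
    Polynomial (MvPolynomial (Fin (n + 1)) k) :=
  Polynomial.C (X j.castSucc) + Polynomial.X * Polynomial.C (X j.succ)

/-- The linear form `Xⱼ₊₁ + x Xⱼ`. -/
noncomputable def geForm (k : Type*) [Field k] {n : ℕ} (j : Fin n) :
    Polynomial (MvPolynomial (Fin (n + 1)) k) :=
  Polynomial.C (X j.succ) + Polynomial.X * Polynomial.C (X j.castSucc)

/-- Place the coefficient of `x ^ q` at `c - q`. -/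
noncomputable def ofPolyLE (k : Type*) [Field k] (n : ℕ) (c : ℤ) :
    Polynomial (MvPolynomial (Fin (n + 1)) k) →ₗ[MvPolynomial (Fin (n + 1)) k]
      (ℤ →₀ MvPolynomial (Fin (n + 1)) k) :=
  Finsupp.lmapDomain _ _ (fun q : ℕ => c - q) ∘ₗ (Polynomial.basisMonomials _).repr.toLinearMap

/-- Place the coefficient of `x ^ q` at `c + q`. -/
noncomputable def ofPolyGE (k : Type*) [Field k] (n : ℕ) (c : ℤ) :
    Polynomial (MvPolynomial (Fin (n + 1)) k) →ₗ[MvPolynomial (Fin (n + 1)) k]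
      (ℤ →₀ MvPolynomial (Fin (n + 1)) k) :=
  Finsupp.lmapDomain _ _ (fun q : ℕ => c + q) ∘ₗ (Polynomial.basisMonomials _).repr.toLinearMap

theorem sub_natCast_injective (c : ℤ) : Function.Injective (fun q : ℕ => c - q) := by
  intro p q h
  simpa using h

theorem add_natCast_injective (c : ℤ) : Function.Injective (fun q : ℕ => c + q) := by
  intro p q h
  simpa using h

theorem ofPolyLE_sub (c : ℤ) (p : Polynomial (MvPolynomial (Fin (n + 1)) k)) (q : ℕ) :
    ofPolyLE k n c p (c - q) = p.coeff q := by
  change Finsupp.mapDomain (fun q : ℕ => c - q) _ _ = _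
  exact Finsupp.mapDomain_apply (sub_natCast_injective c) _ q

theorem ofPolyLE_eq_zero (c : ℤ) (p : Polynomial (MvPolynomial (Fin (n + 1)) k)) {κ : ℤ}
    (h : c < κ) : ofPolyLE k n c p κ = 0 := by
  refine Finsupp.mapDomain_of_notMem_range _ _ ?_
  rintro ⟨q, hq⟩
  simp only at hq
  omega

theorem ofPolyGE_add (c : ℤ) (p : Polynomial (MvPolynomial (Fin (n + 1)) k)) (q : ℕ) :
    ofPolyGE k n c p (c + q) = p.coeff q := by
  change Finsupp.mapDomain (fun q : ℕ => c + q) _ _ = _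
  exact Finsupp.mapDomain_apply (add_natCast_injective c) _ q

theorem ofPolyGE_eq_zero (c : ℤ) (p : Polynomial (MvPolynomial (Fin (n + 1)) k)) {κ : ℤ}
    (h : κ < c) : ofPolyGE k n c p κ = 0 := by
  refine Finsupp.mapDomain_of_notMem_range _ _ ?_
  rintro ⟨q, hq⟩
  simp only at hq
  omega

theorem ofPolyLE_injective (c : ℤ) : Function.Injective (ofPolyLE k n c) :=
  (Finsupp.mapDomain_injective (sub_natCast_injective c)).comp
    (Polynomial.basisMonomials _).repr.injective

theorem ofPolyGE_injective (c : ℤ) : Function.Injective (ofPolyGE k n c) :=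
  (Finsupp.mapDomain_injective (add_natCast_injective c)).comp
    (Polynomial.basisMonomials _).repr.injective

theorem exists_ofPolyLE_eq (c : ℤ) (z : ℤ →₀ MvPolynomial (Fin (n + 1)) k)
    (hz : ∀ κ, c < κ → z κ = 0) : ∃ p, ofPolyLE k n c p = z := by
  refine ⟨(Polynomial.basisMonomials _).repr.symm
    (Finsupp.comapDomain (fun q : ℕ => c - q) z (sub_natCast_injective c).injOn), ?_⟩
  simp only [ofPolyLE, LinearMap.comp_apply, LinearEquiv.coe_coe, LinearEquiv.apply_symm_apply]
  refine Finsupp.mapDomain_comapDomain _ (sub_natCast_injective c) _ fun κ hκ => ?_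
  have : κ ≤ c := not_lt.1 fun h => (Finsupp.mem_support_iff.1 hκ) (hz κ h)
  exact ⟨(c - κ).toNat, by simp only; omega⟩

theorem exists_ofPolyGE_eq (c : ℤ) (z : ℤ →₀ MvPolynomial (Fin (n + 1)) k)
    (hz : ∀ κ, κ < c → z κ = 0) : ∃ p, ofPolyGE k n c p = z := by
  refine ⟨(Polynomial.basisMonomials _).repr.symm
    (Finsupp.comapDomain (fun q : ℕ => c + q) z (add_natCast_injective c).injOn), ?_⟩
  simp only [ofPolyGE, LinearMap.comp_apply, LinearEquiv.coe_coe, LinearEquiv.apply_symm_apply]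
  refine Finsupp.mapDomain_comapDomain _ (add_natCast_injective c) _ fun κ hκ => ?_
  have : c ≤ κ := not_lt.1 fun h => (Finsupp.mem_support_iff.1 hκ) (hz κ h)
  exact ⟨(κ - c).toNat, by simp only; omega⟩

/-- Indices at most `c` are `x ^ (-c)` times polynomials in `x`, and the operator is multiplication
by a form in `x`; this range is preserved. -/
theorem curveOp_ofPolyLE (c : ℤ) (j : Fin n) (p : Polynomial (MvPolynomial (Fin (n + 1)) k)) :
    curveOp k j (ofPolyLE k n c p) =
      ofPolyLE k n c (LinearMap.mulLeft (MvPolynomial (Fin (n + 1)) k) (leForm k j) p) := by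
  ext1 κ
  rw [curveOp_apply, LinearMap.mulLeft_apply, leForm, add_mul, mul_assoc]
  rcases lt_or_ge c κ with h | h
  · rw [ofPolyLE_eq_zero _ _ h, ofPolyLE_eq_zero _ _ h, ofPolyLE_eq_zero _ _ (by omega)]
    simp
  · obtain ⟨q, rfl⟩ : ∃ q : ℕ, κ = c - q := ⟨(c - κ).toNat, by omega⟩
    rw [ofPolyLE_sub, ofPolyLE_sub]
    cases q with
    | zero => rw [ofPolyLE_eq_zero _ _ (by omega)]; simp
    | succ q =>
      rw [show c - ((q + 1 : ℕ) : ℤ) + 1 = c - q by push_cast; ring, ofPolyLE_sub]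
      simp [Polynomial.coeff_X_mul]

/-- With `y = x⁻¹`, the form `Xⱼ + x Xⱼ₊₁` is `y⁻¹ (Xⱼ₊₁ + y Xⱼ)`. The factor `y⁻¹` is the shift of
the base from `c + 1` to `c`, which reappears at every passage on this chart. -/
theorem curveOp_ofPolyGE (c : ℤ) (j : Fin n) (p : Polynomial (MvPolynomial (Fin (n + 1)) k)) :
    curveOp k j (ofPolyGE k n (c + 1) p) =
      ofPolyGE k n c (LinearMap.mulLeft (MvPolynomial (Fin (n + 1)) k) (geForm k j) p) := by
  ext1 κ
  rw [curveOp_apply, LinearMap.mulLeft_apply, geForm, add_mul, mul_assoc]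
  rcases lt_or_ge κ c with h | h
  · rw [ofPolyGE_eq_zero _ _ h, ofPolyGE_eq_zero _ _ (by omega), ofPolyGE_eq_zero _ _ (by omega)]
    simp
  · obtain ⟨q, rfl⟩ : ∃ q : ℕ, κ = c + q := ⟨(κ - c).toNat, by omega⟩
    rw [show c + q + 1 = (c + 1) + (q : ℤ) by ring, ofPolyGE_add, ofPolyGE_add]
    cases q with
    | zero => rw [ofPolyGE_eq_zero _ _ (by simp)]; simp
    | succ q =>
      rw [show c + ((q + 1 : ℕ) : ℤ) = c + 1 + q by push_cast; ring, ofPolyGE_add]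
      simp [Polynomial.coeff_X_mul]
      ring

/-- The substitution `Xᵢ ↦ Xₘ (-x) ^ (m - i)` for `i ≤ m`, fixing the other variables. -/
noncomputable def leSubst (k : Type*) [Field k] {n : ℕ} (m : Fin (n + 1)) :
    MvPolynomial (Fin (n + 1)) k →ₐ[k] Polynomial (MvPolynomial (Fin (n + 1)) k) :=
  aeval fun i => if i ≤ m then Polynomial.C (X m) * (-Polynomial.X) ^ ((m : ℕ) - i)
    else Polynomial.C (X i)

/-- The substitution `Xᵢ ↦ X₀ (-x) ^ i` for `i ≤ m`, fixing the other variables. -/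
noncomputable def geSubst (k : Type*) [Field k] {n : ℕ} (m : Fin (n + 1)) :
    MvPolynomial (Fin (n + 1)) k →ₐ[k] Polynomial (MvPolynomial (Fin (n + 1)) k) :=
  aeval fun i => if i ≤ m then Polynomial.C (X 0) * (-Polynomial.X) ^ (i : ℕ)
    else Polynomial.C (X i)

/-- Extend a substitution of the coefficients to polynomials. -/
noncomputable def substPoly
    (φ : MvPolynomial (Fin (n + 1)) k →ₐ[k] Polynomial (MvPolynomial (Fin (n + 1)) k)) :
    Polynomial (MvPolynomial (Fin (n + 1)) k) →+* Polynomial (MvPolynomial (Fin (n + 1)) k) :=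
  Polynomial.eval₂RingHom φ.toRingHom Polynomial.X

@[simp] theorem substPoly_C
    (φ : MvPolynomial (Fin (n + 1)) k →ₐ[k] Polynomial (MvPolynomial (Fin (n + 1)) k)) (a) :
    substPoly φ (Polynomial.C a) = φ a := by simp [substPoly]

@[simp] theorem substPoly_X
    (φ : MvPolynomial (Fin (n + 1)) k →ₐ[k] Polynomial (MvPolynomial (Fin (n + 1)) k)) :
    substPoly φ Polynomial.X = Polynomial.X := by simp [substPoly]

theorem mk_substPoly
    (φ : MvPolynomial (Fin (n + 1)) k →ₐ[k] Polynomial (MvPolynomial (Fin (n + 1)) k))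
    (I : Ideal (Polynomial (MvPolynomial (Fin (n + 1)) k)))
    (h : ∀ i, Ideal.Quotient.mk I (φ (X i)) = Ideal.Quotient.mk I (Polynomial.C (X i)))
    (p : Polynomial (MvPolynomial (Fin (n + 1)) k)) :
    Ideal.Quotient.mk I (substPoly φ p) = Ideal.Quotient.mk I p := by
  have : (Ideal.Quotient.mk I).comp (substPoly φ) = Ideal.Quotient.mk I := by
    refine Polynomial.ringHom_ext' (MvPolynomial.ringHom_ext (fun a => ?_) fun i => ?_) ?_
    · simp only [RingHom.comp_apply, substPoly_C]
      rw [← MvPolynomial.algebraMap_eq, AlgHom.commutes]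
      rfl
    · simpa using h i
    · simp
  exact congrArg (fun f => f p) this

/-- Modulo the forms, `Xᵢ` equals `-x Xᵢ₊₁` for `i < m`; iterating up to `m` eliminates all earlier
variables in favour of `Xₘ`. The other chart eliminates them in favour of `X₀`. -/
theorem mk_leSubst (m : Fin (n + 1)) (p : Polynomial (MvPolynomial (Fin (n + 1)) k)) :
    Ideal.Quotient.mk (Ideal.span (leForm k '' {j : Fin n | j.castSucc < m}))
        (substPoly (leSubst k m) p) = Ideal.Quotient.mk _ p := by
  refine mk_substPoly _ _ (fun i => ?_) p
  rw [leSubst, aeval_X]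
  split_ifs with him
  · obtain ⟨t, ht⟩ : ∃ t : ℕ, (i : ℕ) + t = m := ⟨m - i, by have : (i : ℕ) ≤ m := him; omega⟩
    rw [show (m : ℕ) - i = t by omega]
    clear him
    induction t generalizing i with
    | zero => rw [show i = m from Fin.ext (by simpa using ht)]; simp
    | succ t ih =>
      have hi : (i : ℕ) < n := by have := m.2; omega
      set j : Fin n := ⟨i, hi⟩ with hj
      have h1 := ih j.succ (by simp [hj]; omega)
      have h2 : Ideal.Quotient.mk (Ideal.span (leForm k '' {j : Fin n | j.castSucc < m}))
          (leForm k j) = 0 := by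
        refine Ideal.Quotient.eq_zero_iff_mem.2 (Ideal.subset_span ⟨j, ?_, rfl⟩)
        change (i : ℕ) < m
        omega
      have h3 : j.castSucc = i := rfl
      rw [leForm, h3, map_add, map_mul, ← h1, ← map_mul, ← map_add] at h2
      rw [← sub_eq_zero, ← map_sub, ← neg_eq_zero, ← map_neg, ← h2]
      congr 1
      ring
  · rfl

theorem mk_geSubst (m : Fin (n + 1)) (p : Polynomial (MvPolynomial (Fin (n + 1)) k)) :
    Ideal.Quotient.mk (Ideal.span (geForm k '' {j : Fin n | j.castSucc < m}))
        (substPoly (geSubst k m) p) = Ideal.Quotient.mk _ p := by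
  refine mk_substPoly _ _ (fun i => ?_) p
  rw [geSubst, aeval_X]
  split_ifs with him
  · obtain ⟨t, ht⟩ : ∃ t : ℕ, t = (i : ℕ) := ⟨_, rfl⟩
    rw [← ht]
    induction t generalizing i with
    | zero => rw [show i = 0 from Fin.ext (by simpa using ht.symm)]; simp
    | succ t ih =>
      have hi : t < n := by have := i.2; omega
      set j : Fin n := ⟨t, hi⟩ with hj
      have him' : (i : ℕ) ≤ m := him
      have h1 := ih j.castSucc (by change t ≤ (m : ℕ); omega) rfl
      have h2 : Ideal.Quotient.mk (Ideal.span (geForm k '' {j : Fin n | j.castSucc < m}))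
          (geForm k j) = 0 := by
        refine Ideal.Quotient.eq_zero_iff_mem.2 (Ideal.subset_span ⟨j, ?_, rfl⟩)
        change t < (m : ℕ)
        omega
      have h3 : j.succ = i := Fin.ext (by simp [hj, ht])
      rw [geForm, h3, map_add, map_mul, ← h1, ← map_mul, ← map_add] at h2
      rw [← sub_eq_zero, ← map_sub, ← neg_eq_zero, ← map_neg, ← h2]
      congr 1
      ring
  · rfl

theorem substPoly_leSubst_leForm_of_lt {m : Fin (n + 1)} {j : Fin n} (h : j.castSucc < m) :
    substPoly (leSubst k m) (leForm k j) = 0 := by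
  have h1 : j.castSucc ≤ m := h.le
  have h2 : j.succ ≤ m := Fin.castSucc_lt_iff_succ_le.1 h
  have h3 : (m : ℕ) - (j.castSucc : ℕ) = (m : ℕ) - (j.succ : ℕ) + 1 := by
    have : ((j.succ : Fin (n + 1)) : ℕ) ≤ m := h2
    simp at this ⊢
    omega
  rw [leForm, map_add, map_mul, substPoly_C, substPoly_C, substPoly_X, leSubst, aeval_X, aeval_X,
    if_pos h1, if_pos h2, h3, pow_succ]
  ring

theorem substPoly_geSubst_geForm_of_lt {m : Fin (n + 1)} {j : Fin n} (h : j.castSucc < m) :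
    substPoly (geSubst k m) (geForm k j) = 0 := by
  have h1 : j.castSucc ≤ m := h.le
  have h2 : j.succ ≤ m := Fin.castSucc_lt_iff_succ_le.1 h
  rw [geForm, map_add, map_mul, substPoly_C, substPoly_C, substPoly_X, geSubst, aeval_X, aeval_X,
    if_pos h1, if_pos h2, Fin.val_succ, Fin.val_castSucc, pow_succ]
  ring

theorem substPoly_leSubst_leForm_self (j : Fin n) :
    substPoly (leSubst k j.castSucc) (leForm k j) ≠ 0 := by
  have h2 : ¬ j.succ ≤ j.castSucc := not_le.2 (Fin.castSucc_lt_succ)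
  rw [leForm, map_add, map_mul, substPoly_C, substPoly_C, substPoly_X, leSubst, aeval_X, aeval_X,
    if_pos le_rfl, if_neg h2]
  intro h
  have := congrArg (fun p => Polynomial.coeff p 1) h
  simp at this

theorem substPoly_geSubst_geForm_self (j : Fin n) :
    substPoly (geSubst k j.castSucc) (geForm k j) ≠ 0 := by
  have h2 : ¬ j.succ ≤ j.castSucc := not_le.2 (Fin.castSucc_lt_succ)
  rw [geForm, map_add, map_mul, substPoly_C, substPoly_C, substPoly_X, geSubst, aeval_X, aeval_X,
    if_pos le_rfl, if_neg h2]
  intro h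
  have := congrArg (fun p => Polynomial.coeff p 0) h
  simp at this

/-- An endomorphism that kills `s` and is the identity modulo `s` has kernel exactly the ideal of
`s`. The quotient thus embeds in the domain `A`, and an element with nonzero image is cancellable.
-/
theorem mem_span_of_mul_mem_span {A : Type*} [CommRing A] [IsDomain A] {s : Set A} (ev : A →+* A)
    (hev : ∀ a, Ideal.Quotient.mk (Ideal.span s) (ev a) = Ideal.Quotient.mk (Ideal.span s) a)
    (hs : ∀ b ∈ s, ev b = 0) {b : A} (hb : ev b ≠ 0) (a : A) (h : b * a ∈ Ideal.span s) :
    a ∈ Ideal.span s := by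
  have h1 : Ideal.span s ≤ RingHom.ker ev := Ideal.span_le.2 hs
  have h2 : ev b * ev a = 0 := by rw [← map_mul]; exact h1 h
  have h3 := (mul_eq_zero.1 h2).resolve_left hb
  rw [← Ideal.Quotient.eq_zero_iff_mem, ← hev, h3, map_zero]

theorem leForm_regular (m : Fin n) (a : Polynomial (MvPolynomial (Fin (n + 1)) k))
    (h : leForm k m * a ∈ Ideal.span (leForm k '' {j | j < m})) :
    a ∈ Ideal.span (leForm k '' {j | j < m}) := by
  refine mem_span_of_mul_mem_span (substPoly (leSubst k m.castSucc)) (mk_leSubst m.castSucc) ?_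
    (substPoly_leSubst_leForm_self m) a h
  rintro _ ⟨j, hj, rfl⟩
  exact substPoly_leSubst_leForm_of_lt hj

theorem geForm_regular (m : Fin n) (a : Polynomial (MvPolynomial (Fin (n + 1)) k))
    (h : geForm k m * a ∈ Ideal.span (geForm k '' {j | j < m})) :
    a ∈ Ideal.span (geForm k '' {j | j < m}) := by
  refine mem_span_of_mul_mem_span (substPoly (geSubst k m.castSucc)) (mk_geSubst m.castSucc) ?_
    (substPoly_geSubst_geForm_self m) a h
  rintro _ ⟨j, hj, rfl⟩
  exact substPoly_geSubst_geForm_of_lt hj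

/-- The case of all the forms: membership in their ideal is tested by one substitution, which later
becomes the augmentation on this chart. -/
theorem mem_span_leForm_iff (p : Polynomial (MvPolynomial (Fin (n + 1)) k)) :
    p ∈ Ideal.span (Set.range (leForm k (n := n))) ↔
      substPoly (leSubst k (Fin.last n)) p = 0 := by
  have hI : Set.range (leForm k (n := n)) = leForm k '' {j : Fin n | j.castSucc < Fin.last n} := by
    simp [Fin.castSucc_lt_last]
  rw [hI]
  constructor
  · intro h
    have h1 : Ideal.span (leForm k '' {j : Fin n | j.castSucc < Fin.last n}) ≤
        RingHom.ker (substPoly (leSubst k (Fin.last n))) := Ideal.span_le.2 (by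
      rintro _ ⟨j, hj, rfl⟩
      exact substPoly_leSubst_leForm_of_lt hj)
    exact h1 h
  · intro h
    rw [← Ideal.Quotient.eq_zero_iff_mem, ← mk_leSubst, h, map_zero]

theorem mem_span_geForm_iff (p : Polynomial (MvPolynomial (Fin (n + 1)) k)) :
    p ∈ Ideal.span (Set.range (geForm k (n := n))) ↔
      substPoly (geSubst k (Fin.last n)) p = 0 := by
  have hI : Set.range (geForm k (n := n)) = geForm k '' {j : Fin n | j.castSucc < Fin.last n} := by
    simp [Fin.castSucc_lt_last]
  rw [hI]
  constructor
  · intro h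
    have h1 : Ideal.span (geForm k '' {j : Fin n | j.castSucc < Fin.last n}) ≤
        RingHom.ker (substPoly (geSubst k (Fin.last n))) := Ideal.span_le.2 (by
      rintro _ ⟨j, hj, rfl⟩
      exact substPoly_geSubst_geForm_of_lt hj)
    exact h1 h
  · intro h
    rw [← Ideal.Quotient.eq_zero_iff_mem, ← mk_geSubst, h, map_zero]

end CurveOperators

/-! ### Laurent chains and the Čech argument -/

section CurveChains

variable {k : Type*} [Field k] {n : ℕ}

/-- Chains of the Koszul complex of `curveOp`. -/
abbrev CurveChain (k : Type*) [Field k] (n : ℕ) : Type _ :=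
  Finset (Fin n) → (ℤ →₀ MvPolynomial (Fin (n + 1)) k)

/-- The Koszul differential of `curveOp`. -/
noncomputable abbrev curveKoszul (k : Type*) [Field k] (n : ℕ) :
    CurveChain k n →ₗ[MvPolynomial (Fin (n + 1)) k] CurveChain k n :=
  koszul (curveOp k)

theorem curveKoszul_apply (z : CurveChain k n) (S : Finset (Fin n)) (κ : ℤ) :
    curveKoszul k n z S κ = ∑ j ∈ Sᶜ, posSign (MvPolynomial (Fin (n + 1)) k) j S *
      (X j.castSucc * z (insert j S) κ + X j.succ * z (insert j S) (κ + 1)) := by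
  rw [koszul_apply, Finsupp.finsetSum_apply]
  refine Finset.sum_congr rfl fun j _ => ?_
  rw [Finsupp.smul_apply, curveOp_apply, smul_eq_mul]

theorem curveKoszul_curveKoszul (z : CurveChain k n) :
    curveKoszul k n (curveKoszul k n z) = 0 :=
  koszul_koszul curveOp_comm z

/-- The coefficients of the chain vanish outside of `P`. -/
def SuppOn (P : ℤ → Prop) (z : CurveChain k n) : Prop := ∀ S κ, ¬ P κ → z S κ = 0

/-- The chain is supported on sets of cardinality `j`. -/
def HasCard (j : ℕ) (z : CurveChain k n) : Prop := ∀ S, S.card ≠ j → z S = 0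

theorem SuppOn.mono {P Q : ℤ → Prop} {z : CurveChain k n} (h : SuppOn P z) (hPQ : ∀ κ, P κ → Q κ) :
    SuppOn Q z := fun S κ hκ => h S κ fun h' => hκ (hPQ κ h')

theorem SuppOn.add {P : ℤ → Prop} {z w : CurveChain k n} (hz : SuppOn P z) (hw : SuppOn P w) :
    SuppOn P (z + w) := fun S κ h => by simp [hz S κ h, hw S κ h]

theorem SuppOn.neg {P : ℤ → Prop} {z : CurveChain k n} (hz : SuppOn P z) : SuppOn P (-z) :=
  fun S κ h => by simp [hz S κ h]

theorem SuppOn.sub {P : ℤ → Prop} {z w : CurveChain k n} (hz : SuppOn P z) (hw : SuppOn P w) :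
    SuppOn P (z - w) := fun S κ h => by simp [hz S κ h, hw S κ h]

theorem HasCard.neg {j : ℕ} {z : CurveChain k n} (hz : HasCard j z) : HasCard j (-z) :=
  fun S h => by simp [hz S h]

theorem HasCard.sub {j : ℕ} {z w : CurveChain k n} (hz : HasCard j z) (hw : HasCard j w) :
    HasCard j (z - w) := fun S h => by simp [hz S h, hw S h]

open Classical in
/-- The part of a chain with coefficient indices in `P`. -/
noncomputable def rangeProj (P : ℤ → Prop) (z : CurveChain k n) : CurveChain k n :=
  fun S => (z S).filter P

theorem rangeProj_apply_pos {P : ℤ → Prop} (z : CurveChain k n) (S : Finset (Fin n)) {κ : ℤ}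
    (h : P κ) : rangeProj P z S κ = z S κ := by
  simp [rangeProj, h]

theorem rangeProj_apply_neg {P : ℤ → Prop} (z : CurveChain k n) (S : Finset (Fin n)) {κ : ℤ}
    (h : ¬ P κ) : rangeProj P z S κ = 0 := by
  simp [rangeProj, h]

theorem rangeProj_add (P : ℤ → Prop) (z w : CurveChain k n) :
    rangeProj P (z + w) = rangeProj P z + rangeProj P w := by
  funext S; simp [rangeProj, Finsupp.filter_add]

theorem rangeProj_smul (P : ℤ → Prop) (r : MvPolynomial (Fin (n + 1)) k) (z : CurveChain k n) :
    rangeProj P (r • z) = r • rangeProj P z := by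
  funext S; simp [rangeProj, Finsupp.filter_smul]

theorem suppOn_rangeProj (P : ℤ → Prop) (z : CurveChain k n) : SuppOn P (rangeProj P z) :=
  fun S _ h => rangeProj_apply_neg z S h

theorem suppOn_sub_rangeProj (P : ℤ → Prop) (z : CurveChain k n) :
    SuppOn (fun κ => ¬ P κ) (z - rangeProj P z) := fun S κ h => by
  simp [rangeProj_apply_pos z S (not_not.1 h)]

theorem HasCard.rangeProj {j : ℕ} {z : CurveChain k n} (hz : HasCard j z) (P : ℤ → Prop) :
    HasCard j (rangeProj P z) := fun S h => by
  classical simp only [_root_.rangeProj, hz S h, Finsupp.filter_zero]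

theorem suppOn_curveKoszul_le {c : ℤ} {z : CurveChain k n} (hz : SuppOn (· ≤ c) z) :
    SuppOn (· ≤ c) (curveKoszul k n z) := fun S κ h => by
  rw [curveKoszul_apply]
  refine Finset.sum_eq_zero fun j _ => ?_
  rw [hz _ κ h, hz _ (κ + 1) (by omega)]
  simp

theorem suppOn_curveKoszul_ge {c : ℤ} {z : CurveChain k n} (hz : SuppOn (c + 1 ≤ ·) z) :
    SuppOn (c ≤ ·) (curveKoszul k n z) := fun S κ h => by
  rw [curveKoszul_apply]
  refine Finset.sum_eq_zero fun j _ => ?_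
  rw [hz _ κ (by omega), hz _ (κ + 1) (by omega)]
  simp

theorem hasCard_curveKoszul {j : ℕ} {z : CurveChain k n} (hz : HasCard (j + 1) z) :
    HasCard j (curveKoszul k n z) := fun S h => by
  rw [koszul_apply]
  refine Finset.sum_eq_zero fun i hi => ?_
  rw [hz _ (by rw [Finset.card_insert_of_notMem (by simpa using hi)]; omega)]
  simp

theorem hasCard_cardProj (j : ℕ) (z : CurveChain k n) :
    HasCard j (cardProj (MvPolynomial (Fin (n + 1)) k) j z) := fun S h => by
  rw [cardProj_apply, if_neg h]

theorem SuppOn.cardProj {P : ℤ → Prop} {z : CurveChain k n} (hz : SuppOn P z) (j : ℕ) :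
    SuppOn P (cardProj (MvPolynomial (Fin (n + 1)) k) j z) := fun S κ h => by
  rw [cardProj_apply]
  split_ifs
  · exact hz S κ h
  · rfl

theorem HasCard.cardProj_eq {j : ℕ} {z : CurveChain k n} (hz : HasCard j z) :
    cardProj (MvPolynomial (Fin (n + 1)) k) j z = z := by
  funext S
  rw [cardProj_apply]
  split_ifs with h
  · rfl
  · exact (hz S h).symm

theorem exists_hasCard_of_curveKoszul_eq {j : ℕ} {P : ℤ → Prop} {z w : CurveChain k n}
    (hz : HasCard j z) (hw : SuppOn P w) (h : curveKoszul k n w = z) :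
    ∃ w', HasCard (j + 1) w' ∧ SuppOn P w' ∧ curveKoszul k n w' = z :=
  ⟨_, hasCard_cardProj (j + 1) w, hw.cardProj _, by rw [koszul_cardProj, h, hz.cardProj_eq]⟩

theorem curveKoszul_ofPolyLE (c : ℤ) (p : Finset (Fin n) → Polynomial (MvPolynomial (Fin (n + 1)) k)) :
    curveKoszul k n (fun S => ofPolyLE k n c (p S)) = fun S => ofPolyLE k n c
      (koszul (fun j => LinearMap.mulLeft (MvPolynomial (Fin (n + 1)) k) (leForm k j)) p S) :=
  koszul_comp (curveOp_ofPolyLE c) p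

theorem curveKoszul_ofPolyGE (c : ℤ) (p : Finset (Fin n) → Polynomial (MvPolynomial (Fin (n + 1)) k)) :
    curveKoszul k n (fun S => ofPolyGE k n (c + 1) (p S)) = fun S => ofPolyGE k n c
      (koszul (fun j => LinearMap.mulLeft (MvPolynomial (Fin (n + 1)) k) (geForm k j)) p S) :=
  koszul_comp (curveOp_ofPolyGE c) p

theorem exists_curveKoszul_eq_le {c : ℤ} {j : ℕ} {z : CurveChain k n} (hs : SuppOn (· ≤ c) z)
    (hc : HasCard j z) (hz : curveKoszul k n z = 0)
    -- This condition has content only for chains of cardinality zero; in positive cardinality the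
    -- coefficient at `∅` vanishes.
    (h0 : ∀ p, ofPolyLE k n c p = z ∅ → p ∈ Ideal.span (Set.range (leForm k (n := n)))) :
    ∃ w, HasCard (j + 1) w ∧ SuppOn (· ≤ c) w ∧ curveKoszul k n w = z := by
  choose p hp using fun S => exists_ofPolyLE_eq c (z S) fun κ h => hs S κ (not_le.2 h)
  have hz' : z = fun S => ofPolyLE k n c (p S) := funext fun S => (hp S).symm
  rw [hz', curveKoszul_ofPolyLE] at hz
  obtain ⟨w, hw⟩ := koszul_exact (R := MvPolynomial (Fin (n + 1)) k) (leForm k) leForm_regular p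
    (funext fun S => ofPolyLE_injective c (by rw [congrFun hz S]; simp)) (h0 _ (hp ∅))
  refine exists_hasCard_of_curveKoszul_eq (w := fun S => ofPolyLE k n c (w S)) hc
    (fun S κ h => ofPolyLE_eq_zero c _ (not_le.1 h)) ?_
  rw [curveKoszul_ofPolyLE, hw, hz']

theorem exists_curveKoszul_eq_ge {c : ℤ} {j : ℕ} {z : CurveChain k n} (hs : SuppOn (c ≤ ·) z)
    (hc : HasCard j z) (hz : curveKoszul k n z = 0)
    (h0 : ∀ p, ofPolyGE k n c p = z ∅ → p ∈ Ideal.span (Set.range (geForm k (n := n)))) :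
    ∃ w, HasCard (j + 1) w ∧ SuppOn (c + 1 ≤ ·) w ∧ curveKoszul k n w = z := by
  choose p hp using fun S => exists_ofPolyGE_eq c (z S) fun κ h => hs S κ (not_le.2 h)
  have hz' : z = fun S => ofPolyGE k n c (p S) := funext fun S => (hp S).symm
  have hz'' : z = fun S => ofPolyGE k n (c - 1 + 1) (p S) := by simpa using hz'
  rw [hz'', curveKoszul_ofPolyGE] at hz
  obtain ⟨w, hw⟩ := koszul_exact (R := MvPolynomial (Fin (n + 1)) k) (geForm k) geForm_regular p
    (funext fun S => ofPolyGE_injective (c - 1) (by rw [congrFun hz S]; simp)) (h0 _ (hp ∅))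
  refine exists_hasCard_of_curveKoszul_eq (w := fun S => ofPolyGE k n (c + 1) (w S)) hc
    (fun S κ h => ofPolyGE_eq_zero (c + 1) _ (not_le.1 h)) ?_
  rw [curveKoszul_ofPolyGE, hw, hz']

theorem exists_curveKoszul_eq_le_of_pos {c : ℤ} {j : ℕ} (hj : 0 < j) {z : CurveChain k n}
    (hs : SuppOn (· ≤ c) z) (hc : HasCard j z) (hz : curveKoszul k n z = 0) :
    ∃ w, HasCard (j + 1) w ∧ SuppOn (· ≤ c) w ∧ curveKoszul k n w = z := by
  refine exists_curveKoszul_eq_le hs hc hz fun p hp => ?_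
  rw [hc ∅ (by simp; omega)] at hp
  rw [ofPolyLE_injective c (hp.trans (map_zero _).symm)]
  exact zero_mem _

theorem exists_curveKoszul_eq_ge_of_pos {c : ℤ} {j : ℕ} (hj : 0 < j) {z : CurveChain k n}
    (hs : SuppOn (c ≤ ·) z) (hc : HasCard j z) (hz : curveKoszul k n z = 0) :
    ∃ w, HasCard (j + 1) w ∧ SuppOn (c + 1 ≤ ·) w ∧ curveKoszul k n w = z := by
  refine exists_curveKoszul_eq_ge hs hc hz fun p hp => ?_
  rw [hc ∅ (by simp; omega)] at hp
  rw [ofPolyGE_injective c (hp.trans (map_zero _).symm)]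
  exact zero_mem _

/-- A Laurent chain has finitely many coefficients, so it lies in `κ ≤ c` for some `c`, where the
polynomial chart gives exactness. -/
theorem exists_curveKoszul_eq_of_pos {j : ℕ} (hj : 0 < j) {z : CurveChain k n}
    (hc : HasCard j z) (hz : curveKoszul k n z = 0) :
    ∃ w, HasCard (j + 1) w ∧ curveKoszul k n w = z := by
  obtain ⟨c, hcb⟩ : ∃ c : ℤ, ∀ κ ∈ Finset.univ.biUnion fun S => (z S).support, κ ≤ c :=
    Finset.exists_le _
  obtain ⟨w, h1, -, h2⟩ := exists_curveKoszul_eq_le_of_pos (c := c) hj (fun S κ h => by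
    by_contra hne
    exact h (hcb κ (by simpa using ⟨S, hne⟩))) hc hz
  exact ⟨w, h1, h2⟩

/-- If a chain is a boundary of a chain with `κ ≤ l` and of a chain with `j < κ`, then it is a
boundary of a chain with `j < κ ≤ l`. -/
theorem exists_curveKoszul_eq_between {l j : ℕ} (hjl : j < l) {z ws wt : CurveChain k n}
    (hcs : HasCard (j + 1) ws) (hss : SuppOn (· ≤ (l : ℤ)) ws) (hs : curveKoszul k n ws = z)
    (hct : HasCard (j + 1) wt) (hst : SuppOn ((j : ℤ) + 1 ≤ ·) wt) (ht : curveKoszul k n wt = z) :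
    ∃ w, HasCard (j + 1) w ∧ SuppOn (fun κ => (j : ℤ) + 1 ≤ κ ∧ κ ≤ l) w ∧
      curveKoszul k n w = z := by
  obtain ⟨v, hv, hdv⟩ := exists_curveKoszul_eq_of_pos (Nat.succ_pos j) (hcs.sub hct)
    (by rw [map_sub, hs, ht, sub_self])
  obtain ⟨v₁, hv₁⟩ : ∃ x, x = rangeProj (· ≤ (l : ℤ)) v := ⟨_, rfl⟩
  -- The left side lives in `κ ≤ l`. On the right, `v - v₁` lives in `κ > l` and the differential
  -- lowers indices by at most one, so the sum stays in `κ > j` because `j < l`.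
  have h1 : ws - curveKoszul k n v₁ = wt + curveKoszul k n (v - v₁) := by
    rw [map_sub, hdv]; abel
  refine ⟨ws - curveKoszul k n v₁, hcs.sub (hasCard_curveKoszul (hv₁ ▸ hv.rangeProj _)), ?_, ?_⟩
  · have h2 : SuppOn (· ≤ (l : ℤ)) (ws - curveKoszul k n v₁) :=
      hss.sub (suppOn_curveKoszul_le (hv₁ ▸ suppOn_rangeProj _ _))
    have h3 : SuppOn ((j : ℤ) + 1 ≤ ·) (ws - curveKoszul k n v₁) := by
      rw [h1]
      exact hst.add (suppOn_curveKoszul_ge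
        ((hv₁ ▸ suppOn_sub_rangeProj (· ≤ (l : ℤ)) v).mono fun κ h => by omega))
    intro S κ h
    by_cases h' : κ ≤ l
    · exact h3 S κ fun h'' => h ⟨h'', h'⟩
    · exact h2 S κ h'
  · rw [map_sub, hs, curveKoszul_curveKoszul, sub_zero]

/-- If a chain is a boundary of a chain with `κ ≤ l` and of a chain with `l < κ`, then it is
in the image of the splicing map. -/
theorem exists_splice_eq {l : ℕ} {z ws wt : CurveChain k n}
    (hcs : HasCard (l + 1) ws) (hss : SuppOn (· ≤ (l : ℤ)) ws) (hs : curveKoszul k n ws = z)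
    (hct : HasCard (l + 1) wt) (hst : SuppOn ((l : ℤ) + 1 ≤ ·) wt) (ht : curveKoszul k n wt = z) :
    ∃ w, HasCard (l + 2) w ∧ SuppOn (fun κ => κ = l + 1) w ∧
      curveKoszul k n (rangeProj (· ≤ (l : ℤ)) (curveKoszul k n w)) = z := by
  obtain ⟨v, hv, hdv⟩ := exists_curveKoszul_eq_of_pos (Nat.succ_pos l) (hcs.sub hct)
    (by rw [map_sub, hs, ht, sub_self])
  obtain ⟨v₁, hv₁⟩ : ∃ x, x = rangeProj (· ≤ (l : ℤ)) v := ⟨_, rfl⟩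
  -- Here the two ranges are disjoint, and the coefficients of `v` at `l + 1` obstruct the
  -- truncation: their boundary reaches index `l`. They are set aside and form the preimage under
  -- the connecting map.
  obtain ⟨v₂, hv₂⟩ : ∃ x, x = rangeProj (· = (l : ℤ) + 1) v := ⟨_, rfl⟩
  have h3 : SuppOn ((l : ℤ) + 1 + 1 ≤ ·) (v - v₁ - v₂) := fun S κ h => by
    rcases lt_trichotomy κ ((l : ℤ) + 1) with h' | h' | h'
    · simp [hv₁, hv₂, rangeProj_apply_pos v S (P := (· ≤ (l : ℤ))) (κ := κ) (by omega),
        rangeProj_apply_neg v S (P := (· = (l : ℤ) + 1)) (κ := κ) (by omega)]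
    · simp [hv₁, hv₂, rangeProj_apply_neg v S (P := (· ≤ (l : ℤ))) (κ := κ) (by omega),
        rangeProj_apply_pos v S (P := (· = (l : ℤ) + 1)) (κ := κ) (by omega)]
    · omega
  have h1 : ws - curveKoszul k n v₁ - curveKoszul k n v₂ =
      wt + curveKoszul k n (v - v₁ - v₂) := by
    rw [map_sub, map_sub, hdv]; abel
  have h4 : SuppOn ((l : ℤ) + 1 ≤ ·) (wt + curveKoszul k n (v - v₁ - v₂)) :=
    hst.add (suppOn_curveKoszul_ge h3)
  have h5 : SuppOn (· ≤ (l : ℤ)) (ws - curveKoszul k n v₁) :=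
    hss.sub (suppOn_curveKoszul_le (hv₁ ▸ suppOn_rangeProj _ _))
  have h6 : rangeProj (· ≤ (l : ℤ)) (curveKoszul k n v₂) = ws - curveKoszul k n v₁ := by
    funext S
    ext1 κ
    by_cases h : κ ≤ l
    · rw [rangeProj_apply_pos _ S (P := (· ≤ (l : ℤ))) h]
      have h7 := h4 S κ (by omega)
      rw [← h1, Pi.sub_apply, Finsupp.sub_apply, sub_eq_zero] at h7
      exact h7.symm
    · rw [rangeProj_apply_neg _ S (P := (· ≤ (l : ℤ))) h, h5 S κ h]
  refine ⟨v₂, hv₂ ▸ hv.rangeProj _, hv₂ ▸ suppOn_rangeProj _ _, ?_⟩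
  rw [h6, map_sub, hs, curveKoszul_curveKoszul, sub_zero]

/-- Exactness in the part of the complex beyond the splicing map. -/
theorem exists_eqOn_curveKoszul {l j : ℕ} (hj : l + 2 ≤ j) {z : CurveChain k n}
    (hc : HasCard j z) (hs : SuppOn (fun κ => (l : ℤ) < κ ∧ κ < j) z)
    (hz : ∀ S (κ : ℤ), l < κ → κ < j - 1 → curveKoszul k n z S κ = 0)
    (hz' : j = l + 2 → curveKoszul k n (rangeProj (· ≤ (l : ℤ)) (curveKoszul k n z)) = 0) :
    ∃ w, HasCard (j + 1) w ∧ SuppOn (fun κ => (l : ℤ) < κ ∧ κ ≤ j) w ∧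
      ∀ S (κ : ℤ), l < κ → κ < j → curveKoszul k n w S κ = z S κ := by
  obtain ⟨i, rfl⟩ : ∃ i, j = i + 1 := ⟨j - 1, by omega⟩
  obtain ⟨α, hα⟩ : ∃ x, x = rangeProj (· ≤ (l : ℤ)) (curveKoszul k n z) := ⟨_, rfl⟩
  -- The boundary of `z` vanishes in the middle range, so it is the sum of `α` on the low side and
  -- `β` on the high side.
  obtain ⟨β, hβ⟩ : ∃ x, x = curveKoszul k n z - α := ⟨_, rfl⟩
  have hαc : HasCard i α := hα ▸ (hasCard_curveKoszul hc).rangeProj _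
  have hβc : HasCard i β := hβ ▸ (hasCard_curveKoszul hc).sub hαc
  have hαs : SuppOn (· ≤ (l : ℤ)) α := hα ▸ suppOn_rangeProj _ _
  have hβs : SuppOn ((i : ℤ) ≤ ·) β := fun S κ h => by
    by_cases h' : κ ≤ l
    · simp [hβ, hα, rangeProj_apply_pos _ S (P := (· ≤ (l : ℤ))) h']
    · simp only [hβ, Pi.sub_apply, Finsupp.sub_apply, hαs S κ h', sub_zero]
      exact hz S κ (by omega) (by push_cast; omega)
  have hsum : curveKoszul k n α + curveKoszul k n β = 0 := by
    rw [hβ, ← map_add, add_sub_cancel, curveKoszul_curveKoszul]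
  -- The boundaries of `α` and `β` are opposite and have disjoint ranges of indices, except when `j
  -- = l + 2`; there the vanishing of the connecting map is needed.
  have hdα : curveKoszul k n α = 0 := by
    by_cases hjl : i + 1 = l + 2
    · exact hα ▸ hz' hjl
    · funext S
      ext1 κ
      by_cases h' : κ ≤ l
      · have h2 : SuppOn ((i : ℤ) - 1 ≤ ·) (curveKoszul k n β) :=
          suppOn_curveKoszul_ge (hβs.mono fun κ h => by omega)
        rw [eq_neg_of_add_eq_zero_left hsum]
        simp [h2 S κ (by omega)]
      · simp [suppOn_curveKoszul_le hαs S κ h']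
  have hdβ : curveKoszul k n β = 0 := by
    rw [eq_neg_of_add_eq_zero_right hsum, hdα, neg_zero]
  obtain ⟨a, hac, has, hda⟩ := exists_curveKoszul_eq_le_of_pos (by omega) hαs hαc hdα
  obtain ⟨b, hbc, hbs, hdb⟩ := exists_curveKoszul_eq_ge_of_pos (by omega) hβs hβc hdβ
  -- Removing the one-sided preimages of `α` and `β` makes `z` a Laurent cycle. Its preimage is cut
  -- to the window; the parts cut off do not affect the coefficients with `l < κ < j`.
  obtain ⟨g, hgc, hdg⟩ := exists_curveKoszul_eq_of_pos (Nat.succ_pos i) ((hc.sub hac).sub hbc)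
    (by rw [map_sub, map_sub, hda, hdb, hβ]; abel)
  obtain ⟨w, hw⟩ : ∃ x, x = rangeProj (fun κ => (l : ℤ) < κ ∧ κ ≤ (i : ℤ) + 1) g := ⟨_, rfl⟩
  obtain ⟨g₁, hg₁⟩ : ∃ x, x = rangeProj (· ≤ (l : ℤ)) g := ⟨_, rfl⟩
  have hg₂ : SuppOn ((i : ℤ) + 1 + 1 ≤ ·) (g - w - g₁) := fun S κ h => by
    by_cases h' : κ ≤ l
    · simp [hw, hg₁, rangeProj_apply_pos g S (P := (· ≤ (l : ℤ))) h',
        rangeProj_apply_neg g S (P := fun κ => (l : ℤ) < κ ∧ κ ≤ (i : ℤ) + 1) (κ := κ) (by omega)]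
    · simp [hw, hg₁, rangeProj_apply_neg g S (P := (· ≤ (l : ℤ))) h',
        rangeProj_apply_pos g S (P := fun κ => (l : ℤ) < κ ∧ κ ≤ (i : ℤ) + 1) (κ := κ)
          (by omega)]
  refine ⟨w, hw ▸ hgc.rangeProj _, by push_cast; exact hw ▸ suppOn_rangeProj _ _, fun S κ h1 h2 => ?_⟩
  have e1 : w = g - g₁ - (g - w - g₁) := by abel
  rw [e1, map_sub, map_sub, hdg]
  have e2 := suppOn_curveKoszul_le (hg₁ ▸ suppOn_rangeProj (· ≤ (l : ℤ)) g) S κ (by omega)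
  have e3 := suppOn_curveKoszul_ge hg₂ S κ (by push_cast at h2; omega)
  simp only [Pi.sub_apply, Finsupp.sub_apply]
  rw [e3, e2, has S κ (by omega), hbs S κ (by push_cast at h2; omega)]
  simp

/-- The composites of consecutive maps beyond the splicing map vanish. -/
theorem curveKoszul_eq_zero_of_eqOn {l j : ℕ} (hj : l + 2 ≤ j) {z w : CurveChain k n}
    (hs : SuppOn (fun κ => (l : ℤ) < κ ∧ κ < j) z)
    (hzw : ∀ S (κ : ℤ), l < κ → κ < j → curveKoszul k n w S κ = z S κ) :
    (∀ S (κ : ℤ), l < κ → κ < j - 1 → curveKoszul k n z S κ = 0) ∧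
      curveKoszul k n (rangeProj (· ≤ (l : ℤ)) (curveKoszul k n z)) = 0 := by
  obtain ⟨α, hα⟩ : ∃ x, x = rangeProj (· ≤ (l : ℤ)) (curveKoszul k n w) := ⟨_, rfl⟩
  obtain ⟨β, hβ⟩ : ∃ x, x = curveKoszul k n w - α - z := ⟨_, rfl⟩
  have hαs : SuppOn (· ≤ (l : ℤ)) α := hα ▸ suppOn_rangeProj _ _
  have hβs : SuppOn ((j : ℤ) - 1 + 1 ≤ ·) β := fun S κ h => by
    by_cases h' : κ ≤ l
    · simp [hβ, hα, rangeProj_apply_pos _ S (P := (· ≤ (l : ℤ))) h', hs S κ (by omega)]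
    · simp [hβ, hα, rangeProj_apply_neg _ S (P := (· ≤ (l : ℤ))) h', hzw S κ (by omega) (by omega)]
  have hz : curveKoszul k n z = -curveKoszul k n α - curveKoszul k n β := by
    have : z = curveKoszul k n w - α - β := by rw [hβ]; abel
    rw [this, map_sub, map_sub, curveKoszul_curveKoszul, zero_sub]
  have hdα := suppOn_curveKoszul_le hαs
  have hdβ := suppOn_curveKoszul_ge hβs
  constructor
  · intro S κ h1 h2
    rw [hz]
    simp [hdα S κ (by omega), hdβ S κ (by omega)]
  · have : rangeProj (· ≤ (l : ℤ)) (curveKoszul k n z) = -curveKoszul k n α := by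
      funext S
      ext1 κ
      by_cases h' : κ ≤ l
      · rw [rangeProj_apply_pos _ S (P := (· ≤ (l : ℤ))) h', hz]
        simp [hdβ S κ (by omega)]
      · rw [rangeProj_apply_neg _ S (P := (· ≤ (l : ℤ))) h']
        simp [hdα S κ h']
    rw [this, map_neg, curveKoszul_curveKoszul, neg_zero]

end CurveChains

/-! ### The spliced complex and its exactness -/

section SpliceComplex

variable {k : Type*} [Field k] {n : ℕ}

/-- Basis of the module in position `s` of the complex spliced at `l`. -/
def spliceBasis (n l s : ℕ) : Finset (Finset (Fin n) × ℕ) :=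
  if s ≤ l then Finset.powersetCard s Finset.univ ×ˢ Finset.Icc s l
  else Finset.powersetCard (s + 1) Finset.univ ×ˢ Finset.Icc (l + 1) s

theorem mem_spliceBasis_of_le {l s : ℕ} (h : s ≤ l) (x : Finset (Fin n) × ℕ) :
    x ∈ spliceBasis n l s ↔ x.1.card = s ∧ s ≤ x.2 ∧ x.2 ≤ l := by
  simp [spliceBasis, h, Finset.mem_product, Finset.mem_powersetCard]

theorem mem_spliceBasis_of_lt {l s : ℕ} (h : l < s) (x : Finset (Fin n) × ℕ) :
    x ∈ spliceBasis n l s ↔ x.1.card = s + 1 ∧ l < x.2 ∧ x.2 ≤ s := by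
  simp [spliceBasis, not_le.2 h, Finset.mem_product, Finset.mem_powersetCard]

/-- The basic chain of a pair `(S, κ)`. -/
noncomputable def basicChain (k : Type*) [Field k] {n : ℕ} (x : Finset (Fin n) × ℕ) :
    CurveChain k n :=
  Pi.single x.1 (Finsupp.single (x.2 : ℤ) 1)

theorem basicChain_apply (x : Finset (Fin n) × ℕ) (S : Finset (Fin n)) (κ : ℤ) :
    basicChain k x S κ = if S = x.1 ∧ κ = x.2 then 1 else 0 := by
  unfold basicChain
  by_cases h : S = x.1
  · subst h
    simp [Finsupp.single_apply, eq_comm]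
  · simp [h]

/-- The differential of the complex spliced at `l`, from position `s + 1` to position `s`, up to
projection to the basis. -/
noncomputable def spliceMap (k : Type*) [Field k] (n l s : ℕ) :
    CurveChain k n →ₗ[MvPolynomial (Fin (n + 1)) k] CurveChain k n where
  toFun z := if s = l then
      -curveKoszul k n (rangeProj (· ≤ (l : ℤ)) (curveKoszul k n z))
    else curveKoszul k n z
  map_add' z w := by
    split_ifs
    · rw [map_add, rangeProj_add, map_add, neg_add]
    · rw [map_add]
  map_smul' r z := by
    simp only [RingHom.id_apply]
    split_ifs
    · rw [map_smul, rangeProj_smul, map_smul, smul_neg]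
    · rw [map_smul]

theorem spliceMap_self (l : ℕ) (z : CurveChain k n) : spliceMap k n l l z =
    -curveKoszul k n (rangeProj (· ≤ (l : ℤ)) (curveKoszul k n z)) := if_pos rfl

theorem spliceMap_of_ne {l s : ℕ} (h : s ≠ l) (z : CurveChain k n) :
    spliceMap k n l s z = curveKoszul k n z := if_neg h

/-- The matrix of the differential of the complex spliced at `l`. -/
noncomputable def spliceMatrix (k : Type*) [Field k] {n : ℕ} (l s : ℕ)
    (B B' : Finset (Finset (Fin n) × ℕ)) : Matrix B B' (MvPolynomial (Fin (n + 1)) k) :=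
  Matrix.of fun y x => spliceMap k n l s (basicChain k x.1) y.1.1 (y.1.2 : ℤ)

/-- The chain with given coefficients. -/
noncomputable def toChain {B : Finset (Finset (Fin n) × ℕ)}
    (v : B → MvPolynomial (Fin (n + 1)) k) : CurveChain k n :=
  ∑ x, v x • basicChain k x.1

theorem toChain_apply {B : Finset (Finset (Fin n) × ℕ)}
    (v : B → MvPolynomial (Fin (n + 1)) k) (y : B) : toChain v y.1.1 (y.1.2 : ℤ) = v y := by
  rw [toChain, Finset.sum_apply, Finsupp.finsetSum_apply, Finset.sum_eq_single y]
  · simp [basicChain_apply]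
  · intro x _ hx
    simp only [Pi.smul_apply, Finsupp.smul_apply, basicChain_apply, Nat.cast_inj]
    rw [if_neg fun h => hx (Subtype.ext (Prod.ext h.1.symm h.2.symm)), smul_zero]
  · simp

theorem toChain_eq_zero {B : Finset (Finset (Fin n) × ℕ)}
    (v : B → MvPolynomial (Fin (n + 1)) k) {S : Finset (Fin n)} {κ : ℤ}
    (h : ∀ x ∈ B, x.1 = S → (x.2 : ℤ) ≠ κ) : toChain v S κ = 0 := by
  rw [toChain, Finset.sum_apply, Finsupp.finsetSum_apply]
  refine Finset.sum_eq_zero fun x _ => ?_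
  simp only [Pi.smul_apply, Finsupp.smul_apply, basicChain_apply]
  rw [if_neg fun h' => h x.1 x.2 h'.1.symm h'.2.symm, smul_zero]

theorem toChain_restrict {B : Finset (Finset (Fin n) × ℕ)} (z : CurveChain k n)
    (h : ∀ S κ, z S κ ≠ 0 → ∃ x ∈ B, x.1 = S ∧ (x.2 : ℤ) = κ) :
    toChain (fun x : B => z x.1.1 (x.1.2 : ℤ)) = z := by
  funext S
  ext1 κ
  by_cases hx : ∃ x ∈ B, x.1 = S ∧ (x.2 : ℤ) = κ
  · obtain ⟨x, hxB, rfl, rfl⟩ := hx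
    exact toChain_apply _ (⟨x, hxB⟩ : B)
  · rw [toChain_eq_zero _ (fun x hxB h1 h2 => hx ⟨x, hxB, h1, h2⟩)]
    by_contra hne
    exact hx (h S κ fun h' => hne h'.symm)

theorem spliceMatrix_mulVec (l s : ℕ) {B B' : Finset (Finset (Fin n) × ℕ)}
    (v : B' → MvPolynomial (Fin (n + 1)) k) (y : B) :
    (spliceMatrix k l s B B').mulVec v y = spliceMap k n l s (toChain v) y.1.1 (y.1.2 : ℤ) := by
  rw [toChain, map_sum, Finset.sum_apply, Finsupp.finsetSum_apply]
  refine Finset.sum_congr rfl fun x _ => ?_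
  rw [map_smul, Pi.smul_apply, Finsupp.smul_apply, smul_eq_mul, mul_comm]
  rfl

theorem hasCard_toChain {B : Finset (Finset (Fin n) × ℕ)} {j : ℕ} (hB : ∀ x ∈ B, x.1.card = j)
    (v : B → MvPolynomial (Fin (n + 1)) k) : HasCard j (toChain v) := by
  intro S hS
  ext1 κ
  refine toChain_eq_zero v fun x hx h _ => hS ?_
  rw [← h, hB x hx]

theorem suppOn_toChain {B : Finset (Finset (Fin n) × ℕ)} {P : ℤ → Prop}
    (hB : ∀ x ∈ B, P (x.2 : ℤ)) (v : B → MvPolynomial (Fin (n + 1)) k) :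
    SuppOn P (toChain v) :=
  fun _ _ hκ => toChain_eq_zero v fun x hx _ h => hκ (h ▸ hB x hx)

theorem exists_mem_spliceBasis_of_le {l s : ℕ} (h : s ≤ l) {z : CurveChain k n}
    (hc : HasCard s z) (hs : SuppOn (fun κ => (s : ℤ) ≤ κ ∧ κ ≤ l) z) (S : Finset (Fin n)) (κ : ℤ)
    (hz : z S κ ≠ 0) : ∃ x ∈ spliceBasis n l s, x.1 = S ∧ (x.2 : ℤ) = κ := by
  have h1 : S.card = s := by
    by_contra h'
    simp [hc S h'] at hz
  have h2 : (s : ℤ) ≤ κ ∧ κ ≤ l := by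
    by_contra h'
    exact hz (hs S κ h')
  refine ⟨(S, κ.toNat), (mem_spliceBasis_of_le h _).2 ⟨h1, ?_, ?_⟩, rfl, ?_⟩ <;> simp only <;> omega

theorem exists_mem_spliceBasis_of_lt {l s : ℕ} (h : l < s) {z : CurveChain k n}
    (hc : HasCard (s + 1) z) (hs : SuppOn (fun κ => (l : ℤ) < κ ∧ κ ≤ s) z) (S : Finset (Fin n))
    (κ : ℤ) (hz : z S κ ≠ 0) : ∃ x ∈ spliceBasis n l s, x.1 = S ∧ (x.2 : ℤ) = κ := by
  have h1 : S.card = s + 1 := by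
    by_contra h'
    simp [hc S h'] at hz
  have h2 : (l : ℤ) < κ ∧ κ ≤ s := by
    by_contra h'
    exact hz (hs S κ h')
  refine ⟨(S, κ.toNat), (mem_spliceBasis_of_lt h _).2 ⟨h1, ?_, ?_⟩, rfl, ?_⟩ <;> simp only <;> omega

theorem hasCard_toChain_of_le {l s : ℕ} (h : s ≤ l)
    (v : spliceBasis n l s → MvPolynomial (Fin (n + 1)) k) : HasCard s (toChain v) :=
  hasCard_toChain (fun x hx => ((mem_spliceBasis_of_le h x).1 hx).1) v

theorem suppOn_toChain_of_le {l s : ℕ} (h : s ≤ l)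
    (v : spliceBasis n l s → MvPolynomial (Fin (n + 1)) k) :
    SuppOn (fun κ => (s : ℤ) ≤ κ ∧ κ ≤ l) (toChain v) :=
  suppOn_toChain (fun x hx => by have := (mem_spliceBasis_of_le h x).1 hx; omega) v

theorem hasCard_toChain_of_lt {l s : ℕ} (h : l < s)
    (v : spliceBasis n l s → MvPolynomial (Fin (n + 1)) k) : HasCard (s + 1) (toChain v) :=
  hasCard_toChain (fun x hx => ((mem_spliceBasis_of_lt h x).1 hx).1) v

theorem suppOn_toChain_of_lt {l s : ℕ} (h : l < s)
    (v : spliceBasis n l s → MvPolynomial (Fin (n + 1)) k) :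
    SuppOn (fun κ => (l : ℤ) < κ ∧ κ ≤ s) (toChain v) :=
  suppOn_toChain (fun x hx => by have := (mem_spliceBasis_of_lt h x).1 hx; omega) v

/-- The boundaries of the low part and of the high part of a boundary are opposite; one lives in `κ
≤ l`, the other in `l ≤ κ`, so only `κ = l` remains. -/
theorem suppOn_splice {l : ℕ} (z : CurveChain k n) :
    SuppOn (fun κ => (l : ℤ) ≤ κ ∧ κ ≤ l)
      (curveKoszul k n (rangeProj (· ≤ (l : ℤ)) (curveKoszul k n z))) := by
  set α := rangeProj (· ≤ (l : ℤ)) (curveKoszul k n z) with hα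
  have h1 : SuppOn (· ≤ (l : ℤ)) (curveKoszul k n α) :=
    suppOn_curveKoszul_le (suppOn_rangeProj _ _)
  have h2 : SuppOn ((l : ℤ) ≤ ·) (curveKoszul k n (curveKoszul k n z - α)) :=
    suppOn_curveKoszul_ge ((suppOn_sub_rangeProj _ _).mono fun κ h => by omega)
  rw [map_sub, curveKoszul_curveKoszul, zero_sub] at h2
  have h3 := h2.neg
  rw [neg_neg] at h3
  intro S κ h
  by_cases h' : κ ≤ l
  · exact h3 S κ fun h'' => h ⟨h'', h'⟩
  · exact h1 S κ h'

/-- In positions up to the splice, the boundary of a chain is supported on the basis. -/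
theorem toChain_mulVec_of_le {l s : ℕ} (h : s ≤ l)
    (w : spliceBasis n l (s + 1) → MvPolynomial (Fin (n + 1)) k) :
    toChain ((spliceMatrix k l s (spliceBasis n l s) (spliceBasis n l (s + 1))).mulVec w) =
      spliceMap k n l s (toChain w) := by
  have h0 : (spliceMatrix k l s (spliceBasis n l s) (spliceBasis n l (s + 1))).mulVec w =
      fun y => spliceMap k n l s (toChain w) y.1.1 (y.1.2 : ℤ) :=
    funext fun y => spliceMatrix_mulVec l s w y
  rw [h0]
  refine toChain_restrict _ (exists_mem_spliceBasis_of_le h ?_ ?_)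
  · rcases h.eq_or_lt with rfl | hlt
    · rw [spliceMap_self]
      exact (hasCard_curveKoszul ((hasCard_curveKoszul
        (hasCard_toChain_of_lt (Nat.lt_succ_self _) w)).rangeProj _)).neg
    · rw [spliceMap_of_ne hlt.ne]
      exact hasCard_curveKoszul (hasCard_toChain_of_le hlt w)
  · rcases h.eq_or_lt with rfl | hlt
    · rw [spliceMap_self]
      exact (suppOn_splice _).neg
    · rw [spliceMap_of_ne hlt.ne]
      have hs := suppOn_toChain_of_le hlt w
      have h1 := suppOn_curveKoszul_le (hs.mono fun κ h => h.2)
      have h2 := suppOn_curveKoszul_ge (c := s) (hs.mono fun κ h => by push_cast at h; exact h.1)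
      intro S κ h
      by_cases h' : κ ≤ l
      · exact h2 S κ fun h'' => h ⟨h'', h'⟩
      · exact h1 S κ h'

theorem toChain_injective {B : Finset (Finset (Fin n) × ℕ)}
    {v w : B → MvPolynomial (Fin (n + 1)) k} (h : toChain v = toChain w) : v = w := by
  funext x
  rw [← toChain_apply v x, h, toChain_apply]

theorem toChain_zero {B : Finset (Finset (Fin n) × ℕ)} :
    toChain (0 : B → MvPolynomial (Fin (n + 1)) k) = 0 := by simp [toChain]

/-- Coefficients beyond the splice. -/
theorem curveKoszul_toChain_of_lt {l s : ℕ} (h : l < s)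
    (w : spliceBasis n l (s + 1) → MvPolynomial (Fin (n + 1)) k) (S : Finset (Fin n)) (κ : ℤ)
    (h1 : (l : ℤ) < κ) (h2 : κ ≤ s) :
    curveKoszul k n (toChain w) S κ =
      toChain ((spliceMatrix k l s (spliceBasis n l s) (spliceBasis n l (s + 1))).mulVec w) S κ := by
  by_cases hS : S.card = s + 1
  · have hx : (S, κ.toNat) ∈ spliceBasis n l s :=
      (mem_spliceBasis_of_lt h _).2 ⟨hS, by simp only; omega, by simp only; omega⟩
    have h3 := toChain_apply
      ((spliceMatrix k l s (spliceBasis n l s) (spliceBasis n l (s + 1))).mulVec w) ⟨_, hx⟩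
    rw [spliceMatrix_mulVec, spliceMap_of_ne h.ne'] at h3
    simp only at h3
    rw [Int.toNat_of_nonneg (by omega)] at h3
    exact h3.symm
  · rw [hasCard_curveKoszul (hasCard_toChain_of_lt (by omega) w) S hS,
      hasCard_toChain_of_lt h _ S hS]

/-- This is the `H⁰` strand. A cycle bounds on each chart, and the two preimages are glued,
ordinarily when `s + 1 < l` and through the connecting map when `s + 1 = l`. -/
theorem splice_exact_of_lt {l s : ℕ} (h : s < l)
    (v : spliceBasis n l (s + 1) → MvPolynomial (Fin (n + 1)) k) :
    (spliceMatrix k l s (spliceBasis n l s) (spliceBasis n l (s + 1))).mulVec v = 0 ↔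
    ∃ w, (spliceMatrix k l (s + 1) (spliceBasis n l (s + 1)) (spliceBasis n l (s + 1 + 1))).mulVec w
      = v := by
  have hc := hasCard_toChain_of_le h v
  have hs := suppOn_toChain_of_le h v
  constructor
  · intro hv
    have hz : curveKoszul k n (toChain v) = 0 := by
      rw [← spliceMap_of_ne h.ne, ← toChain_mulVec_of_le h.le, hv, toChain_zero]
    obtain ⟨ws, hws, hss, hds⟩ := exists_curveKoszul_eq_le_of_pos (Nat.succ_pos s)
      (hs.mono fun κ h => h.2) hc hz
    obtain ⟨wt, hwt, hst, hdt⟩ := exists_curveKoszul_eq_ge_of_pos (Nat.succ_pos s)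
      (hs.mono fun κ h => h.1) hc hz
    rcases (Nat.succ_le_of_lt h).eq_or_lt with heq | hlt
    · obtain rfl : s + 1 = l := heq
      obtain ⟨w, hwc, hws, hdw⟩ := exists_splice_eq hws hss hds hwt hst hdt
      -- The sign compensates for the minus in `spliceMap`, which is there to make the case `l = 0`
      -- give the `2 × 2` minors with their usual sign.
      have hw := toChain_restrict (-w) (exists_mem_spliceBasis_of_lt (Nat.lt_succ_self (s + 1))
        hwc.neg (hws.neg.mono fun κ h => by push_cast at h ⊢; omega))
      refine ⟨fun x => (-w) x.1.1 (x.1.2 : ℤ), toChain_injective ?_⟩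
      rw [toChain_mulVec_of_le le_rfl, hw, map_neg, spliceMap_self, hdw, neg_neg]
    · obtain ⟨w, hwc, hws, hdw⟩ := exists_curveKoszul_eq_between hlt hws hss hds hwt hst hdt
      have hw := toChain_restrict w (exists_mem_spliceBasis_of_le hlt hwc
        (hws.mono fun κ h => by push_cast at h ⊢; omega))
      refine ⟨fun x => w x.1.1 (x.1.2 : ℤ), toChain_injective ?_⟩
      rw [toChain_mulVec_of_le h, hw, spliceMap_of_ne hlt.ne, hdw]
  · rintro ⟨w, rfl⟩
    refine toChain_injective ?_
    rw [toChain_mulVec_of_le h.le, toChain_mulVec_of_le h, spliceMap_of_ne h.ne, toChain_zero]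
    rcases (Nat.succ_le_of_lt h).eq_or_lt with heq | hlt
    · obtain rfl : s + 1 = l := heq
      rw [spliceMap_self, map_neg, curveKoszul_curveKoszul, neg_zero]
    · rw [spliceMap_of_ne hlt.ne, curveKoszul_curveKoszul]

/-- This is the `H¹` strand, including its junction with `H⁰`. Its matrices see the Koszul
differential only through the window of basis indices, so cycles and boundaries are conditions on
that window, plus the connecting map when `s = l`. -/
theorem splice_exact_of_le {l s : ℕ} (h : l ≤ s)
    (v : spliceBasis n l (s + 1) → MvPolynomial (Fin (n + 1)) k) :
    (spliceMatrix k l s (spliceBasis n l s) (spliceBasis n l (s + 1))).mulVec v = 0 ↔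
    ∃ w, (spliceMatrix k l (s + 1) (spliceBasis n l (s + 1)) (spliceBasis n l (s + 1 + 1))).mulVec w
      = v := by
  have h1 : l < s + 1 := by omega
  have h2 : l < s + 1 + 1 := by omega
  have hc := hasCard_toChain_of_lt h1 v
  have hs := suppOn_toChain_of_lt h1 v
  have hs' : SuppOn (fun κ => (l : ℤ) < κ ∧ κ < (s + 1 + 1 : ℕ)) (toChain v) :=
    hs.mono fun κ h => by push_cast at h ⊢; omega
  have key : (spliceMatrix k l s (spliceBasis n l s) (spliceBasis n l (s + 1))).mulVec v = 0 ↔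
      (∀ S (κ : ℤ), l < κ → κ < (s + 1 + 1 : ℕ) - 1 → curveKoszul k n (toChain v) S κ = 0) ∧
      (s + 1 + 1 = l + 2 →
        curveKoszul k n (rangeProj (· ≤ (l : ℤ)) (curveKoszul k n (toChain v))) = 0) := by
    rcases h.eq_or_lt with rfl | hlt
    · have e1 := toChain_mulVec_of_le le_rfl v
      rw [spliceMap_self] at e1
      constructor
      · intro hv
        rw [hv, toChain_zero] at e1
        exact ⟨fun S κ a b => by push_cast at b; omega, fun _ => neg_eq_zero.1 e1.symm⟩
      · rintro ⟨-, h'⟩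
        refine toChain_injective ?_
        rw [e1, h' rfl, neg_zero, toChain_zero]
    · constructor
      · intro hv
        refine ⟨fun S κ a b => ?_, fun h' => by omega⟩
        rw [curveKoszul_toChain_of_lt hlt v S κ a (by push_cast at b; omega), hv, toChain_zero]
        rfl
      · rintro ⟨h', -⟩
        funext y
        have hy := (mem_spliceBasis_of_lt hlt y.1).1 y.2
        rw [spliceMatrix_mulVec, spliceMap_of_ne hlt.ne', h' _ _ (by omega) (by push_cast; omega)]
        rfl
  rw [key]
  constructor
  · rintro ⟨ha, hb⟩
    obtain ⟨w, hwc, hws, hw⟩ := exists_eqOn_curveKoszul (by omega) hc hs' ha hb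
    have hwr := toChain_restrict w (exists_mem_spliceBasis_of_lt h2 hwc hws)
    refine ⟨fun x => w x.1.1 (x.1.2 : ℤ), funext fun y => ?_⟩
    have hy := (mem_spliceBasis_of_lt h1 y.1).1 y.2
    rw [spliceMatrix_mulVec, hwr, spliceMap_of_ne h1.ne', hw _ _ (by omega) (by push_cast; omega),
      toChain_apply]
  · rintro ⟨w, rfl⟩
    have := curveKoszul_eq_zero_of_eqOn (j := s + 1 + 1) (by omega) hs'
      (fun S κ a b => curveKoszul_toChain_of_lt h1 w S κ a (by push_cast at b ⊢; omega))
    exact ⟨this.1, fun _ => this.2⟩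

theorem splice_exact (l s : ℕ) (v : spliceBasis n l (s + 1) → MvPolynomial (Fin (n + 1)) k) :
    (spliceMatrix k l s (spliceBasis n l s) (spliceBasis n l (s + 1))).mulVec v = 0 ↔
    ∃ w, (spliceMatrix k l (s + 1) (spliceBasis n l (s + 1)) (spliceBasis n l (s + 1 + 1))).mulVec w
      = v := by
  rcases lt_or_ge s l with h | h
  · exact splice_exact_of_lt h v
  · exact splice_exact_of_le h v

end SpliceComplex

/-! ### The cokernel of the first differential, on the two charts -/

section Augmentation

variable {k : Type*} [Field k] {n : ℕ}

theorem koszul_mulLeft_mem_span {R A : Type*} [CommRing R] [CommRing A] [Algebra R A]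
    (ℓ : Fin n → A) (q : Finset (Fin n) → A) (S : Finset (Fin n)) :
    koszul (fun j => LinearMap.mulLeft R (ℓ j)) q S ∈ Ideal.span (Set.range ℓ) := by
  rw [koszul_apply]
  refine Ideal.sum_mem _ fun j _ => ?_
  rw [LinearMap.mulLeft_apply, ← mul_smul_comm]
  exact Ideal.mul_mem_right _ _ (Ideal.subset_span ⟨j, rfl⟩)

theorem mem_span_leForm_of_curveKoszul_eq {c : ℤ} {z w : CurveChain k n}
    (hs : SuppOn (· ≤ c) w) (hw : curveKoszul k n w = z)
    {p : Polynomial (MvPolynomial (Fin (n + 1)) k)} (hp : ofPolyLE k n c p = z ∅) :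
    p ∈ Ideal.span (Set.range (leForm k (n := n))) := by
  choose q hq using fun S => exists_ofPolyLE_eq c (w S) fun κ h => hs S κ (not_le.2 h)
  have hw' : w = fun S => ofPolyLE k n c (q S) := funext fun S => (hq S).symm
  rw [hw', curveKoszul_ofPolyLE] at hw
  rw [← hw] at hp
  rw [ofPolyLE_injective c hp]
  exact koszul_mulLeft_mem_span _ _ _

theorem mem_span_geForm_of_curveKoszul_eq {c : ℤ} {z w : CurveChain k n}
    (hs : SuppOn (c + 1 ≤ ·) w) (hw : curveKoszul k n w = z)
    {p : Polynomial (MvPolynomial (Fin (n + 1)) k)} (hp : ofPolyGE k n c p = z ∅) :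
    p ∈ Ideal.span (Set.range (geForm k (n := n))) := by
  choose q hq using fun S => exists_ofPolyGE_eq (c + 1) (w S) fun κ h => hs S κ (not_le.2 h)
  have hw' : w = fun S => ofPolyGE k n (c + 1) (q S) := funext fun S => (hq S).symm
  rw [hw', curveKoszul_ofPolyGE] at hw
  rw [← hw] at hp
  rw [ofPolyGE_injective c hp]
  exact koszul_mulLeft_mem_span _ _ _

theorem ofPolyLE_C_mul_X_pow (c : ℤ) (q : ℕ) (a : MvPolynomial (Fin (n + 1)) k) :
    ofPolyLE k n c (Polynomial.C a * Polynomial.X ^ q) = Finsupp.single (c - q) a := by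
  ext1 κ
  rcases lt_or_ge c κ with h | h
  · rw [ofPolyLE_eq_zero c _ h, Finsupp.single_eq_of_ne (by omega)]
  · obtain ⟨t, rfl⟩ : ∃ t : ℕ, κ = c - t := ⟨(c - κ).toNat, by omega⟩
    rw [ofPolyLE_sub, Polynomial.coeff_C_mul_X_pow, Finsupp.single_apply]
    simp [eq_comm]

theorem ofPolyGE_C_mul_X_pow (c : ℤ) (q : ℕ) (a : MvPolynomial (Fin (n + 1)) k) :
    ofPolyGE k n c (Polynomial.C a * Polynomial.X ^ q) = Finsupp.single (c + q) a := by
  ext1 κ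
  rcases lt_or_ge κ c with h | h
  · rw [ofPolyGE_eq_zero c _ h, Finsupp.single_eq_of_ne (by omega)]
  · obtain ⟨t, rfl⟩ : ∃ t : ℕ, κ = c + t := ⟨(κ - c).toNat, by omega⟩
    rw [ofPolyGE_add, Polynomial.coeff_C_mul_X_pow, Finsupp.single_apply]
    simp [eq_comm]

/-- The value of a vector in position zero on the chart with coordinate `x`. -/
noncomputable def leAug (l : ℕ) {B : Finset (Finset (Fin n) × ℕ)}
    (v : B → MvPolynomial (Fin (n + 1)) k) : Polynomial (MvPolynomial (Fin (n + 1)) k) :=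
  ∑ x, leSubst k (Fin.last n) (v x) * Polynomial.X ^ (l - x.1.2)

/-- The value of a vector in position zero on the chart with coordinate `x⁻¹`. -/
noncomputable def geAug {B : Finset (Finset (Fin n) × ℕ)}
    (v : B → MvPolynomial (Fin (n + 1)) k) : Polynomial (MvPolynomial (Fin (n + 1)) k) :=
  ∑ x, geSubst k (Fin.last n) (v x) * Polynomial.X ^ x.1.2

theorem curveKoszul_eq_zero_of_hasCard_zero {z : CurveChain k n} (h : HasCard 0 z) :
    curveKoszul k n z = 0 := by
  funext S
  rw [koszul_apply]
  refine Finset.sum_eq_zero fun j _ => ?_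
  rw [h _ (by simp), map_zero, smul_zero]

theorem toChain_empty_eq_ofPolyLE {l : ℕ}
    (v : spliceBasis n l 0 → MvPolynomial (Fin (n + 1)) k) :
    ofPolyLE k n l (∑ x, Polynomial.C (v x) * Polynomial.X ^ (l - x.1.2)) = toChain v ∅ := by
  rw [map_sum, toChain, Finset.sum_apply]
  refine Finset.sum_congr rfl fun x _ => ?_
  have hx := (mem_spliceBasis_of_le (Nat.zero_le l) x.1).1 x.2
  rw [ofPolyLE_C_mul_X_pow, Nat.cast_sub hx.2.2, sub_sub_cancel, Pi.smul_apply, basicChain,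
    Finset.card_eq_zero.1 hx.1]
  simp

theorem toChain_empty_eq_ofPolyGE {l : ℕ}
    (v : spliceBasis n l 0 → MvPolynomial (Fin (n + 1)) k) :
    ofPolyGE k n 0 (∑ x, Polynomial.C (v x) * Polynomial.X ^ x.1.2) = toChain v ∅ := by
  rw [map_sum, toChain, Finset.sum_apply]
  refine Finset.sum_congr rfl fun x _ => ?_
  have hx := (mem_spliceBasis_of_le (Nat.zero_le l) x.1).1 x.2
  rw [ofPolyGE_C_mul_X_pow, zero_add, Pi.smul_apply, basicChain,
    Finset.card_eq_zero.1 hx.1]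
  simp

/-- Regard the vector as a polynomial in `x`. Its image under the substitution vanishes exactly when
it lies in the ideal of the forms, that is, when it is a boundary on this chart. -/
theorem leAug_eq_zero_iff {l : ℕ} (v : spliceBasis n l 0 → MvPolynomial (Fin (n + 1)) k) :
    leAug l v = 0 ↔ ∃ w, HasCard 1 w ∧ SuppOn (· ≤ (l : ℤ)) w ∧ curveKoszul k n w = toChain v := by
  have hs := suppOn_toChain_of_le (Nat.zero_le l) v
  have hc := hasCard_toChain_of_le (Nat.zero_le l) v
  have h1 : leAug l v = substPoly (leSubst k (Fin.last n))
      (∑ x, Polynomial.C (v x) * Polynomial.X ^ (l - x.1.2)) := by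
    simp [leAug]
  rw [h1, ← mem_span_leForm_iff]
  constructor
  · intro h
    refine exists_curveKoszul_eq_le (hs.mono fun κ h => h.2) hc
      (curveKoszul_eq_zero_of_hasCard_zero hc) fun p hp => ?_
    rw [← toChain_empty_eq_ofPolyLE] at hp
    rwa [ofPolyLE_injective _ hp]
  · rintro ⟨w, -, hws, hw⟩
    exact mem_span_leForm_of_curveKoszul_eq hws hw (toChain_empty_eq_ofPolyLE v)

theorem geAug_eq_zero_iff {l : ℕ} (v : spliceBasis n l 0 → MvPolynomial (Fin (n + 1)) k) :
    geAug v = 0 ↔ ∃ w, HasCard 1 w ∧ SuppOn ((0 : ℤ) + 1 ≤ ·) w ∧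
      curveKoszul k n w = toChain v := by
  have hs := suppOn_toChain_of_le (Nat.zero_le l) v
  have hc := hasCard_toChain_of_le (Nat.zero_le l) v
  have h1 : geAug v = substPoly (geSubst k (Fin.last n))
      (∑ x, Polynomial.C (v x) * Polynomial.X ^ x.1.2) := by
    simp [geAug]
  rw [h1, ← mem_span_geForm_iff]
  constructor
  · intro h
    refine exists_curveKoszul_eq_ge (hs.mono fun κ h => by simpa using h.1) hc
      (curveKoszul_eq_zero_of_hasCard_zero hc) fun p hp => ?_
    rw [← toChain_empty_eq_ofPolyGE] at hp
    rwa [ofPolyGE_injective _ hp]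
  · rintro ⟨w, -, hws, hw⟩
    exact mem_span_geForm_of_curveKoszul_eq hws hw (toChain_empty_eq_ofPolyGE v)

/-- The image of the first differential is cut out by the two charts. -/
theorem splice_exact_zero (l : ℕ) (v : spliceBasis n l 0 → MvPolynomial (Fin (n + 1)) k) :
    (∃ w, (spliceMatrix k l 0 (spliceBasis n l 0) (spliceBasis n l (0 + 1))).mulVec w = v) ↔
      leAug l v = 0 ∧ geAug v = 0 := by
  rw [leAug_eq_zero_iff, geAug_eq_zero_iff]
  constructor
  · rintro ⟨w, rfl⟩
    rw [toChain_mulVec_of_le (Nat.zero_le l)]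
    rcases (Nat.zero_le l).eq_or_lt with rfl | hlt
    · rw [spliceMap_self]
      have hc := hasCard_toChain_of_lt (Nat.lt_succ_self 0) w
      set u := curveKoszul k n (toChain w) with hu
      have huc : HasCard 1 u := hasCard_curveKoszul hc
      set α := rangeProj (· ≤ ((0 : ℕ) : ℤ)) u with hα
      refine ⟨⟨-α, (huc.rangeProj _).neg, (suppOn_rangeProj _ _).neg, map_neg _ _⟩,
        ⟨u - α, huc.sub (huc.rangeProj _),
          (suppOn_sub_rangeProj _ _).mono fun κ h => by push_cast at h; omega, ?_⟩⟩
      rw [map_sub, hu, curveKoszul_curveKoszul, zero_sub]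
    · rw [spliceMap_of_ne hlt.ne]
      have hc := hasCard_toChain_of_le hlt w
      have hs := suppOn_toChain_of_le hlt w
      exact ⟨⟨_, hc, hs.mono fun κ h => h.2, rfl⟩,
        ⟨_, hc, hs.mono fun κ h => by simpa using h.1, rfl⟩⟩
  · rintro ⟨⟨ws, hcs, hss, hds⟩, ⟨wt, hct, hst, hdt⟩⟩
    rcases (Nat.zero_le l).eq_or_lt with rfl | hlt
    · obtain ⟨w, hwc, hws, hdw⟩ := exists_splice_eq (l := 0) hcs hss hds hct hst hdt
      have hw := toChain_restrict (-w) (exists_mem_spliceBasis_of_lt (Nat.lt_succ_self 0)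
        hwc.neg (hws.neg.mono fun κ h => by push_cast at h ⊢; omega))
      refine ⟨fun x => (-w) x.1.1 (x.1.2 : ℤ), toChain_injective ?_⟩
      rw [toChain_mulVec_of_le le_rfl, hw, map_neg, spliceMap_self, hdw, neg_neg]
    · obtain ⟨w, hwc, hws, hdw⟩ := exists_curveKoszul_eq_between (j := 0) hlt hcs hss hds hct
        (by simpa using hst) hdt
      have hw := toChain_restrict w (exists_mem_spliceBasis_of_le hlt hwc
        (hws.mono fun κ h => by push_cast at h ⊢; omega))
      refine ⟨fun x => w x.1.1 (x.1.2 : ℤ), toChain_injective ?_⟩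
      rw [toChain_mulVec_of_le (Nat.zero_le l), hw, spliceMap_of_ne hlt.ne, hdw]

end Augmentation

/-! ### The bigrading of chains -/

section Grading

variable {k : Type*} [Field k] {n : ℕ}

/-- The bigrading `deg Xᵢ = (1, i)`. -/
def biWeight (n : ℕ) (i : Fin (n + 1)) : ℤ × ℤ := (1, (i : ℕ))

/-- The bidegree of the basis element `(S, κ)`. -/
def biDegree (S : Finset (Fin n)) (κ : ℤ) : ℤ × ℤ := (S.card, κ + ∑ r ∈ S, ((r : ℕ) : ℤ))

/-- A chain is homogeneous of bidegree `D`. -/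
def IsBihomogeneous (z : CurveChain k n) (D : ℤ × ℤ) : Prop :=
  ∀ S κ, IsWeightedHomogeneous (biWeight n) (z S κ) (D - biDegree S κ)

theorem isWeightedHomogeneous_posSign_mul {M : Type*} [AddCommMonoid M] {w : Fin (n + 1) → M}
    (j : Fin n) (S : Finset (Fin n)) {p : MvPolynomial (Fin (n + 1)) k} {e : M}
    (h : IsWeightedHomogeneous w p e) :
    IsWeightedHomogeneous w (posSign (MvPolynomial (Fin (n + 1)) k) j S * p) e := by
  rcases neg_one_pow_eq_or (MvPolynomial (Fin (n + 1)) k) (S.filter (· < j)).card with h' | h'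
  · rwa [posSign, h', one_mul]
  · rw [posSign, h', neg_one_mul]
    exact (weightedHomogeneousSubmodule k w e).neg_mem h

theorem IsBihomogeneous.curveKoszul {z : CurveChain k n} {D : ℤ × ℤ} (hz : IsBihomogeneous z D) :
    IsBihomogeneous (curveKoszul k n z) D := by
  intro S κ
  rw [curveKoszul_apply]
  refine IsWeightedHomogeneous.sum _ _ _ fun j hj => isWeightedHomogeneous_posSign_mul j S ?_
  have hj' : j ∉ S := by simpa using hj
  have h1 := (isWeightedHomogeneous_X k (biWeight n) j.castSucc).mul (hz (insert j S) κ)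
  have h2 := (isWeightedHomogeneous_X k (biWeight n) j.succ).mul (hz (insert j S) (κ + 1))
  have e1 : biWeight n j.castSucc + (D - biDegree (insert j S) κ) = D - biDegree S κ := by
    simp only [biWeight, biDegree, Finset.card_insert_of_notMem hj', Finset.sum_insert hj']
    ext <;> simp <;> ring
  have e2 : biWeight n j.succ + (D - biDegree (insert j S) (κ + 1)) = D - biDegree S κ := by
    simp only [biWeight, biDegree, Finset.card_insert_of_notMem hj', Finset.sum_insert hj']
    ext <;> simp <;> ring
  rw [e1] at h1
  rw [e2] at h2
  exact h1.add h2

theorem IsBihomogeneous.rangeProj {z : CurveChain k n} {D : ℤ × ℤ} (hz : IsBihomogeneous z D)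
    (P : ℤ → Prop) : IsBihomogeneous (rangeProj P z) D := by
  intro S κ
  by_cases h : P κ
  · rw [rangeProj_apply_pos z S h]
    exact hz S κ
  · rw [rangeProj_apply_neg z S h]
    exact isWeightedHomogeneous_zero _ _ _

theorem isBihomogeneous_basicChain (x : Finset (Fin n) × ℕ) :
    IsBihomogeneous (basicChain k x) (biDegree x.1 x.2) := by
  intro S κ
  rw [basicChain_apply]
  split_ifs with h
  · rw [h.1, h.2, sub_self]
    exact isWeightedHomogeneous_one _ _
  · exact isWeightedHomogeneous_zero _ _ _

theorem IsBihomogeneous.spliceMap {z : CurveChain k n} {D : ℤ × ℤ} (hz : IsBihomogeneous z D)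
    (l s : ℕ) : IsBihomogeneous (spliceMap k n l s z) D := by
  by_cases h : s = l
  · subst h
    rw [spliceMap_self]
    intro S κ
    exact (weightedHomogeneousSubmodule k (biWeight n) _).neg_mem
      ((hz.curveKoszul.rangeProj _).curveKoszul S κ)
  · rw [spliceMap_of_ne h]
    exact hz.curveKoszul

theorem isWeightedHomogeneous_spliceMatrix (l s : ℕ) {B B' : Finset (Finset (Fin n) × ℕ)}
    (y : B) (x : B') : IsWeightedHomogeneous (biWeight n) (spliceMatrix k l s B B' y x)
      (biDegree x.1.1 x.1.2 - biDegree y.1.1 y.1.2) :=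
  ((isBihomogeneous_basicChain x.1).spliceMap l s) y.1.1 y.1.2

end Grading

/-! ### The Eagon–Northcott complex as the case `l = 0` -/

section EagonNorthcottIsSplice

variable {k : Type*} [Field k] {n : ℕ}

theorem enBasis_eq_spliceBasis (n : ℕ) : enBasis n = spliceBasis n 0 := by
  funext s
  unfold enBasis spliceBasis
  rcases Nat.eq_zero_or_pos s with rfl | h
  · simp
  · rw [if_neg h.ne', if_neg (by omega)]

theorem fBasis_succ_eq_spliceBasis (n b : ℕ) :
    (fun s => fBasis n b (s + 1)) = spliceBasis n (n - b) := by
  funext s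
  unfold fBasis spliceBasis
  rw [if_neg (Nat.succ_ne_zero s)]
  simp only [Nat.add_sub_cancel, Nat.add_le_add_iff_right]

theorem enDifferential_eq_spliceMatrix_of_ne {s : ℕ} (hs : s ≠ 0) :
    enDifferential k n s = spliceMatrix k 0 s (enBasis n s) (enBasis n (s + 1)) := by
  ext1 y x
  simp only [enDifferential, spliceMatrix, Matrix.of_apply, if_neg hs, spliceMap_of_ne hs,
    curveKoszul_apply]
  rw [← Finset.sum_filter, ← Finset.sum_filter_of_ne
    (p := fun j => insert j y.1.1 = x.1.1) (s := (y.1.1)ᶜ)]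
  · have hset : (x.1.1.filter fun j => y.1.1 = x.1.1.erase j) =
        (y.1.1)ᶜ.filter fun j => insert j y.1.1 = x.1.1 := by
      ext j
      simp only [Finset.mem_filter, Finset.mem_compl]
      constructor
      · rintro ⟨h1, h2⟩
        rw [h2]
        exact ⟨Finset.notMem_erase _ _, Finset.insert_erase h1⟩
      · rintro ⟨h1, h2⟩
        rw [← h2]
        exact ⟨Finset.mem_insert_self _ _, (Finset.erase_insert h1).symm⟩
    rw [hset]
    refine Finset.sum_congr rfl fun j hj => ?_
    obtain ⟨hj1, hj2⟩ := Finset.mem_filter.1 hj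
    have hsgn : (-1 : MvPolynomial (Fin (n + 1)) k) ^ (x.1.1.filter (· < j)).card =
        posSign (MvPolynomial (Fin (n + 1)) k) j y.1.1 := by
      rw [← hj2, ← posSign, posSign_insert_of_le le_rfl]
    rw [hsgn, hj2]
    congr 1
    simp only [basicChain_apply, true_and]
    have e1 : ((y.1.2 : ℤ) = (x.1.2 : ℤ)) ↔ y.1.2 = x.1.2 := by omega
    have e2 : ((y.1.2 : ℤ) + 1 = (x.1.2 : ℤ)) ↔ y.1.2 + 1 = x.1.2 := by omega
    rw [if_congr e1 rfl rfl, if_congr e2 rfl rfl]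
    by_cases h1 : y.1.2 = x.1.2
    · rw [if_pos h1, if_pos h1, if_neg (by omega)]
      simp [curveMatrix]
    · by_cases h2 : y.1.2 + 1 = x.1.2
      · rw [if_neg h1, if_neg h1, if_pos h2, if_pos h2]
        simp [curveMatrix]
      · rw [if_neg h1, if_neg h1, if_neg h2, if_neg h2]
        simp
  · intro j _ hne
    by_contra h
    simp [basicChain_apply, h] at hne

theorem det_curveMatrix_submatrix (i j : Fin n) :
    ((curveMatrix k n).submatrix id ![i, j]).det =
      X i.castSucc * X j.succ - X j.castSucc * X i.succ := by
  rw [Matrix.det_fin_two]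
  simp [curveMatrix]

/-- The connecting map computed by hand: the low part of the boundary of `e_p ∧ e_r` has two terms,
and their boundary gives a minor. -/
theorem splice_zero_basicChain {p r : Fin n} (h : p < r) :
    spliceMap k n 0 0 (basicChain k ({p, r}, 1)) ∅ 0 =
      X p.castSucc * X r.succ - X r.castSucc * X p.succ := by
  have key : ∀ j : Fin n, curveKoszul k n (basicChain k ({p, r}, 1)) {j} 0 =
      if j = p then - X r.succ else if j = r then X p.succ else 0 := by
    intro j
    rw [curveKoszul_apply]
    simp only [basicChain_apply]
    simp only [Nat.cast_one, zero_ne_one, and_false, if_false, mul_zero, zero_add, and_true]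
    split_ifs with h1 h2
    · subst h1
      rw [Finset.sum_eq_single r]
      · rw [if_pos (Finset.pair_comm _ _)]
        simp [posSign, Finset.filter_singleton, h]
      · intro i hi hir
        rw [if_neg, mul_zero, mul_zero]
        intro he
        have : i ∈ ({j, r} : Finset (Fin n)) := he ▸ Finset.mem_insert_self _ _
        simp only [Finset.mem_insert, Finset.mem_singleton] at this
        rcases this with rfl | rfl
        · simp at hi
        · exact hir rfl
      · intro hr
        simp [h.ne'] at hr
    · subst h2
      rw [Finset.sum_eq_single p]
      · simp [posSign, Finset.filter_singleton, not_lt.2 h.le]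
      · intro i hi hir
        rw [if_neg, mul_zero, mul_zero]
        intro he
        have : i ∈ ({p, j} : Finset (Fin n)) := he ▸ Finset.mem_insert_self _ _
        simp only [Finset.mem_insert, Finset.mem_singleton] at this
        rcases this with rfl | rfl
        · exact hir rfl
        · simp at hi
      · intro hr
        simp [h.ne] at hr
    · refine Finset.sum_eq_zero fun i _ => ?_
      rw [if_neg, mul_zero, mul_zero]
      intro he
      have : j ∈ ({p, r} : Finset (Fin n)) := he ▸ by simp
      simp [h1, h2] at this
  rw [spliceMap_self, Pi.neg_apply, Finsupp.neg_apply, curveKoszul_apply]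
  have h2 : ∀ j : Fin n, rangeProj (· ≤ ((0 : ℕ) : ℤ))
      (curveKoszul k n (basicChain k ({p, r}, 1))) (insert j ∅) (0 + 1) = 0 :=
    fun j => rangeProj_apply_neg _ _ (by simp)
  have h3 : ∀ j : Fin n, rangeProj (· ≤ ((0 : ℕ) : ℤ))
      (curveKoszul k n (basicChain k ({p, r}, 1))) (insert j ∅) 0 =
      if j = p then - X r.succ else if j = r then X p.succ else 0 :=
    fun j => (rangeProj_apply_pos _ _ (P := (· ≤ ((0 : ℕ) : ℤ))) (by simp)).trans (key j)
  simp only [h2, h3, posSign_empty, one_mul, mul_zero, add_zero, Finset.compl_empty]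
  rw [Finset.sum_eq_add p r h.ne (fun i _ hi => by simp [hi.1, hi.2]) (by simp) (by simp)]
  simp only [if_true, h.ne', if_false]
  ring

theorem enDifferential_zero_eq_spliceMatrix :
    enDifferential k n 0 = spliceMatrix k 0 0 (enBasis n 0) (enBasis n (0 + 1)) := by
  ext1 y x
  obtain ⟨⟨yS, yκ⟩, hy⟩ := y
  obtain ⟨⟨xS, xκ⟩, hx⟩ := x
  simp only [enDifferential, spliceMatrix, Matrix.of_apply, if_true]
  have hy' : (yS, yκ) = (∅, 0) := by simpa [enBasis] using hy
  obtain ⟨rfl, rfl⟩ := Prod.mk.inj hy'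
  have hx' : xS.card = 2 ∧ xκ = 1 := by
    simpa [enBasis, Finset.mem_product, Finset.mem_powersetCard, eq_comm] using hx
  obtain ⟨hc, rfl⟩ := hx'
  obtain ⟨p, r, hlt, rfl⟩ : ∃ p r, p < r ∧ xS = {p, r} := by
    obtain ⟨p, r, hne, rfl⟩ := Finset.card_eq_two.1 hc
    rcases lt_or_gt_of_ne hne with h | h
    · exact ⟨p, r, h, rfl⟩
    · exact ⟨r, p, h, Finset.pair_comm _ _⟩
  simp only [det_curveMatrix_submatrix]
  rw [Nat.cast_zero, splice_zero_basicChain hlt, Finset.sum_pair hlt.ne, Finset.sum_pair hlt.ne,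
    Finset.sum_pair hlt.ne]
  simp [hlt, hlt.le]

theorem enDifferential_eq_spliceMatrix (s : ℕ) :
    enDifferential k n s = spliceMatrix k 0 s (enBasis n s) (enBasis n (s + 1)) := by
  rcases eq_or_ne s 0 with rfl | h
  · exact enDifferential_zero_eq_spliceMatrix
  · exact enDifferential_eq_spliceMatrix_of_ne h

theorem enDifferential_zero_apply_pair {p r : Fin n} (h : p < r)
    (hx : (({p, r} : Finset (Fin n)), 1) ∈ enBasis n (0 + 1)) (y : enBasis n 0) :
    enDifferential k n 0 y ⟨_, hx⟩ = ((curveMatrix k n).submatrix id ![p, r]).det := by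
  simp only [enDifferential, Matrix.of_apply, if_true]
  rw [Finset.sum_pair h.ne, Finset.sum_pair h.ne, Finset.sum_pair h.ne]
  simp [h, h.le]

/-- The basis element of the module in position zero. -/
def enUnit (n : ℕ) : enBasis n 0 := ⟨(∅, 0), by simp [enBasis]⟩

theorem eq_enUnit (y : enBasis n 0) : y = enUnit n :=
  Subtype.ext (show y.1 = (∅, 0) by simpa [enBasis] using y.2)

theorem exists_enDifferential_zero_eq_iff (f : MvPolynomial (Fin (n + 1)) k) :
    (∃ w, (enDifferential k n 0).mulVec w = fun _ => f) ↔ f ∈ rationalNormalCurveIdeal k n := by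
  constructor
  · rintro ⟨w, hw⟩
    have h := congrFun hw (enUnit n)
    rw [← h]
    refine Ideal.sum_mem _ fun x _ => Ideal.mul_mem_right _ _ ?_
    simp only [enDifferential, Matrix.of_apply, if_true]
    refine Ideal.sum_mem _ fun i _ => Ideal.sum_mem _ fun j _ => ?_
    split_ifs with hij
    · exact Ideal.subset_span ⟨i, j, hij, rfl⟩
    · exact zero_mem _
  · intro hf
    refine Submodule.span_induction ?_ ⟨0, by simp; rfl⟩ ?_ ?_ hf
    · rintro _ ⟨p, r, h, rfl⟩
      have hx : (({p, r} : Finset (Fin n)), 1) ∈ enBasis n (0 + 1) := by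
        simp [enBasis, Finset.mem_powersetCard, Finset.card_pair h.ne]
      refine ⟨Pi.single ⟨_, hx⟩ 1, funext fun y => ?_⟩
      rw [Matrix.mulVec_single_one]
      exact enDifferential_zero_apply_pair h hx y
    · rintro a b _ _ ⟨u, hu⟩ ⟨v, hv⟩
      exact ⟨u + v, by rw [Matrix.mulVec_add, hu, hv]; rfl⟩
    · rintro r a _ ⟨u, hu⟩
      exact ⟨r • u, by rw [Matrix.mulVec_smul, hu]; rfl⟩

/-- The rational normal curve is cut out by the two charts. -/
theorem mem_rationalNormalCurveIdeal_iff (f : MvPolynomial (Fin (n + 1)) k) :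
    f ∈ rationalNormalCurveIdeal k n ↔
      leSubst k (Fin.last n) f = 0 ∧ geSubst k (Fin.last n) f = 0 := by
  rw [← exists_enDifferential_zero_eq_iff, enDifferential_eq_spliceMatrix]
  -- The basis family is generalized so that `enBasis`, only propositionally equal to `spliceBasis n
  -- 0`, can be substituted without casts.
  have h : ∀ B : ℕ → Finset (Finset (Fin n) × ℕ), B = spliceBasis n 0 →
      ((∃ w, (spliceMatrix k 0 0 (B 0) (B (0 + 1))).mulVec w = fun _ => f) ↔
        leAug 0 (fun _ : B 0 => f) = 0 ∧ geAug (fun _ : B 0 => f) = 0) := by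
    rintro _ rfl
    exact splice_exact_zero 0 _
  rw [h _ (enBasis_eq_spliceBasis n), leAug, geAug, Fintype.sum_eq_single (enUnit n),
    Fintype.sum_eq_single (enUnit n)]
  · simp [enUnit]
  · exact fun x hx => absurd (eq_enUnit x) hx
  · exact fun x hx => absurd (eq_enUnit x) hx

end EagonNorthcottIsSplice

/-! ### Homogeneous lifting of chain maps -/

section HomogeneousLifting

variable {σ R M : Type*} [CommRing R] [AddCommGroup M] {w : σ → M}

theorem weightedHomogeneousComponent_mul_of_isWeightedHomogeneous {p : MvPolynomial σ R} {e : M}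
    (hp : IsWeightedHomogeneous w p e) (q : MvPolynomial σ R) (δ : M) :
    weightedHomogeneousComponent w (e + δ) (p * q) = p * weightedHomogeneousComponent w δ q := by
  classical
  let _ := weightedGradedAlgebra R w
  have h := DirectSum.coe_decompose_mul_add_of_left_mem (weightedHomogeneousSubmodule R w)
    (i := e) (j := δ) (b := q) (show p ∈ weightedHomogeneousSubmodule R w e from hp)
  rw [← MvPolynomial.decompose'_apply R w, ← MvPolynomial.decompose'_apply R w]
  exact h

/-- A homogeneous vector in the image of a homogeneous matrix has a homogeneous preimage. -/
theorem exists_homogeneous_mulVec_eq {ι κ : Type*} [Fintype κ] {D : Matrix ι κ (MvPolynomial σ R)}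
    {dι : ι → M} {dκ : κ → M} (hD : ∀ i j, IsWeightedHomogeneous w (D i j) (dκ j - dι i))
    {v : ι → MvPolynomial σ R} {e : M} (hv : ∀ i, IsWeightedHomogeneous w (v i) (e - dι i))
    {u : κ → MvPolynomial σ R} (hu : D.mulVec u = v) :
    ∃ u' : κ → MvPolynomial σ R, (∀ j, IsWeightedHomogeneous w (u' j) (e - dκ j)) ∧
      D.mulVec u' = v := by
  refine ⟨fun j => weightedHomogeneousComponent w (e - dκ j) (u j), fun j =>
    weightedHomogeneousComponent_isWeightedHomogeneous _ _, funext fun i => ?_⟩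
  have h1 : v i = weightedHomogeneousComponent w (e - dι i) (v i) :=
    ((hv i).weightedHomogeneousComponent_same).symm
  rw [h1, ← hu, Matrix.mulVec, Matrix.mulVec, dotProduct, dotProduct, map_sum]
  refine Finset.sum_congr rfl fun j _ => ?_
  rw [← weightedHomogeneousComponent_mul_of_isWeightedHomogeneous (hD i j)]
  congr 2
  abel

/-- A homogeneous map lifts to a homogeneous map of complexes into an exact complex. -/
theorem exists_homogeneous_chainMap {ι κ : ℕ → Type*} [∀ s, Fintype (ι s)] [∀ s, Fintype (κ s)]
    {DE : ∀ s, Matrix (ι s) (ι (s + 1)) (MvPolynomial σ R)}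
    {DF : ∀ s, Matrix (κ s) (κ (s + 1)) (MvPolynomial σ R)}
    {dE : ∀ s, ι s → M} {dF : ∀ s, κ s → M}
    (hDE : ∀ s i j, IsWeightedHomogeneous w (DE s i j) (dE (s + 1) j - dE s i))
    (hDF : ∀ s i j, IsWeightedHomogeneous w (DF s i j) (dF (s + 1) j - dF s i))
    (hE : ∀ s v, (DE s).mulVec v = 0 → ∃ u, (DE (s + 1)).mulVec u = v)
    (hF : ∀ s v, (DF s).mulVec ((DF (s + 1)).mulVec v) = 0)
    (ψ₀ : Matrix (ι 0) (κ 0) (MvPolynomial σ R))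
    (hψ₀ : ∀ i j, IsWeightedHomogeneous w (ψ₀ i j) (dF 0 j - dE 0 i))
    (hlift : ∀ v, ∃ u, (DE 0).mulVec u = ψ₀.mulVec ((DF 0).mulVec v)) :
    ∃ ψ : ∀ s, Matrix (ι s) (κ s) (MvPolynomial σ R), ψ 0 = ψ₀ ∧
      (∀ s i j, IsWeightedHomogeneous w (ψ s i j) (dF s j - dE s i)) ∧
      ∀ s, DE s * ψ (s + 1) = ψ s * DF s := by
  classical
  -- The recursion carries, with each matrix, its homogeneity and the solvability of the next
  -- lifting problem; exactness of the target provides the latter at each step.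
  let T : ℕ → Type _ := fun s => {ψ : Matrix (ι s) (κ s) (MvPolynomial σ R) //
    (∀ i j, IsWeightedHomogeneous w (ψ i j) (dF s j - dE s i)) ∧
    ∀ v, ∃ u, (DE s).mulVec u = ψ.mulVec ((DF s).mulVec v)}
  have step : ∀ s (t : T s), ∃ t' : T (s + 1), DE s * t'.1 = t.1 * DF s := by
    rintro s ⟨ψ, hψ, hl⟩
    have hcol : ∀ j, ∃ u' : ι (s + 1) → MvPolynomial σ R,
        (∀ i, IsWeightedHomogeneous w (u' i) (dF (s + 1) j - dE (s + 1) i)) ∧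
          (DE s).mulVec u' = fun i => (ψ * DF s) i j := by
      intro j
      obtain ⟨u, hu⟩ := hl (Pi.single j 1)
      refine exists_homogeneous_mulVec_eq (hDE s) (fun i => ?_) (u := u) ?_
      · rw [Matrix.mul_apply]
        refine IsWeightedHomogeneous.sum _ _ _ fun l _ => ?_
        have := (hψ i l).mul (hDF s l j)
        rwa [show dF s l - dE s i + (dF (s + 1) j - dF s l) = dF (s + 1) j - dE s i by abel]
          at this
      · rw [hu, Matrix.mulVec_mulVec, Matrix.mulVec_single_one]
        rfl
    choose ψ' hψ' hψ'e using hcol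
    have heq : DE s * Matrix.of (fun i j => ψ' j i) = ψ * DF s := by
      ext1 i j
      exact congrFun (hψ'e j) i
    refine ⟨⟨Matrix.of fun i j => ψ' j i, fun i j => hψ' j i, fun v => ?_⟩, heq⟩
    obtain ⟨u, hu⟩ := hE s ((Matrix.of fun i j => ψ' j i).mulVec ((DF (s + 1)).mulVec v)) (by
      rw [Matrix.mulVec_mulVec, heq, ← Matrix.mulVec_mulVec, hF, Matrix.mulVec_zero])
    exact ⟨u, hu⟩
  choose next hnext using step
  let seq : ∀ s, T s := fun s => Nat.rec ⟨ψ₀, hψ₀, hlift⟩ (fun s t => next s t) s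
  exact ⟨fun s => (seq s).1, rfl, fun s => (seq s).2.1, fun s => hnext s (seq s)⟩

end HomogeneousLifting

/-! ### Exactness of the mapping cone -/

section MappingCone

variable {A : Type*} [CommRing A]

/-- The mapping cone of an injection of modules, on the level of free resolutions. -/
theorem mulVec_fromBlocks_exact {ι κ : ℕ → Type*} [∀ s, Fintype (ι s)] [∀ s, Fintype (κ s)]
    [IsEmpty (κ 0)] {D : ∀ s, Matrix (ι s) (ι (s + 1)) A}
    {U : ∀ s, Matrix (ι s) (κ (s + 1)) A} {V : ∀ s, Matrix (κ s) (κ (s + 1)) A}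
    (hD : ∀ s v, (D s).mulVec v = 0 ↔ ∃ u, (D (s + 1)).mulVec u = v)
    (hV : ∀ s v, (V (s + 1)).mulVec v = 0 ↔ ∃ u, (V (s + 1 + 1)).mulVec u = v)
    (hU : ∀ v, (∃ u, (D 0).mulVec u = (U 0).mulVec v) ↔ ∃ u, (V (0 + 1)).mulVec u = v)
    (hDU : ∀ s, D s * U (s + 1) + U s * V (s + 1) = 0) (s : ℕ)
    (v : ι (s + 1) ⊕ κ (s + 1) → A) :
    (Matrix.fromBlocks (D s) (U s) 0 (V s)).mulVec v = 0 ↔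
      ∃ u, (Matrix.fromBlocks (D (s + 1)) (U (s + 1)) 0 (V (s + 1))).mulVec u = v := by
  have hDU' : ∀ y, (D s).mulVec ((U (s + 1)).mulVec y) + (U s).mulVec ((V (s + 1)).mulVec y) = 0 := by
    intro y
    rw [Matrix.mulVec_mulVec, Matrix.mulVec_mulVec, ← Matrix.add_mulVec, hDU, Matrix.zero_mulVec]
  constructor
  · intro h
    rw [Matrix.fromBlocks_mulVec] at h
    have h1 : (D s).mulVec (v ∘ Sum.inl) + (U s).mulVec (v ∘ Sum.inr) = 0 :=
      funext fun i => congrFun h (Sum.inl i)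
    have h2 : (V s).mulVec (v ∘ Sum.inr) = 0 := by
      funext i
      have := congrFun h (Sum.inr i)
      simpa using this
    -- In the lowest position `V 0` has no rows and gives no information. There `hU`, injectivity on
    -- the cokernels, replaces exactness of `V`.
    obtain ⟨y, hy⟩ : ∃ y, (V (s + 1)).mulVec y = v ∘ Sum.inr := by
      cases s with
      | zero =>
        refine (hU _).1 ⟨-(v ∘ Sum.inl), ?_⟩
        rw [Matrix.mulVec_neg]
        exact (eq_neg_of_add_eq_zero_right h1).symm
      | succ s => exact (hV s _).1 h2
    obtain ⟨x, hx⟩ := (hD s (v ∘ Sum.inl - (U (s + 1)).mulVec y)).1 (by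
      have h3 := hDU' y
      rw [hy] at h3
      rw [Matrix.mulVec_sub, eq_neg_of_add_eq_zero_left h1, eq_neg_of_add_eq_zero_left h3,
        sub_self])
    refine ⟨Sum.elim x y, ?_⟩
    rw [Matrix.fromBlocks_mulVec, Sum.elim_comp_inl, Sum.elim_comp_inr, hx, hy, Matrix.zero_mulVec]
    funext i
    cases i <;> simp
  · rintro ⟨u, rfl⟩
    rw [Matrix.fromBlocks_mulVec, Matrix.fromBlocks_mulVec, Sum.elim_comp_inl, Sum.elim_comp_inr]
    have hV' : (V s).mulVec ((V (s + 1)).mulVec (u ∘ Sum.inr)) = 0 := by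
      cases s with
      | zero => exact funext fun i => isEmptyElim i
      | succ s => exact (hV s _).2 ⟨_, rfl⟩
    have hD' : (D s).mulVec ((D (s + 1)).mulVec (u ∘ Sum.inl)) = 0 := (hD s _).2 ⟨_, rfl⟩
    rw [Matrix.mulVec_add, hD', zero_add, Matrix.zero_mulVec, zero_add, hDU', hV',
      Matrix.zero_mulVec, add_zero]
    funext i
    cases i <;> rfl

end MappingCone

/-! ### Monomials modulo the rational normal curve -/

section CurveMonomials

variable {k : Type*} [Field k] {n : ℕ}

/-- The total degree of an exponent vector. -/
def expDegree (α : Fin (n + 1) →₀ ℕ) : ℕ := ∑ i, α i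

/-- The degree of an exponent vector for the weights `0, 1, …, n`. -/
def expIndex (α : Fin (n + 1) →₀ ℕ) : ℕ := ∑ i, α i * i

theorem expDegree_add (α β : Fin (n + 1) →₀ ℕ) :
    expDegree (α + β) = expDegree α + expDegree β := by
  simp [expDegree, Finset.sum_add_distrib]

theorem expIndex_add (α β : Fin (n + 1) →₀ ℕ) :
    expIndex (α + β) = expIndex α + expIndex β := by
  simp [expIndex, Finset.sum_add_distrib, add_mul]

theorem expDegree_single (i : Fin (n + 1)) (c : ℕ) : expDegree (Finsupp.single i c) = c := by
  simp [expDegree, Finsupp.single_apply]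

theorem expIndex_single (i : Fin (n + 1)) (c : ℕ) :
    expIndex (Finsupp.single i c) = c * i := by
  rw [expIndex, Finset.sum_eq_single i]
  · simp
  · intro j _ hj
    simp [hj.symm]
  · simp

theorem expIndex_le (α : Fin (n + 1) →₀ ℕ) : expIndex α ≤ n * expDegree α := by
  rw [expIndex, expDegree, Finset.mul_sum]
  refine Finset.sum_le_sum fun i _ => ?_
  rw [mul_comm]
  exact Nat.mul_le_mul_right _ (Nat.lt_succ_iff.1 i.2)

theorem exists_exponent (j : ℕ) : ∀ c ≤ n * j,
    ∃ α : Fin (n + 1) →₀ ℕ, expDegree α = j ∧ expIndex α = c := by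
  induction j with
  | zero =>
    intro c hc
    exact ⟨0, by simp [expDegree], by simp [expIndex]; omega⟩
  | succ j ih =>
    intro c hc
    rw [Nat.mul_succ] at hc
    obtain ⟨α, h1, h2⟩ := ih (c - min c n) (by omega)
    refine ⟨α + Finsupp.single ⟨min c n, by omega⟩ 1, ?_, ?_⟩
    · rw [expDegree_add, expDegree_single, h1]
    · rw [expIndex_add, expIndex_single, h2]
      simp

theorem leSubst_last_X (i : Fin (n + 1)) : leSubst k (Fin.last n) (X i) =
    Polynomial.C (X (Fin.last n)) * (-Polynomial.X) ^ (n - (i : ℕ)) := by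
  rw [leSubst, aeval_X, if_pos (Fin.le_last i)]
  rfl

theorem geSubst_last_X (i : Fin (n + 1)) : geSubst k (Fin.last n) (X i) =
    Polynomial.C (X 0) * (-Polynomial.X) ^ (i : ℕ) := by
  rw [geSubst, aeval_X, if_pos (Fin.le_last i)]

theorem geSubst_monomial (α : Fin (n + 1) →₀ ℕ) :
    geSubst k (Fin.last n) (monomial α 1) =
      Polynomial.C (X 0) ^ expDegree α * (-Polynomial.X) ^ expIndex α := by
  rw [monomial_eq, C_1, one_mul, map_finsuppProd, Finsupp.prod_fintype _ _ (by simp)]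
  simp only [map_pow, geSubst_last_X, mul_pow, ← pow_mul]
  rw [Finset.prod_mul_distrib, Finset.prod_pow_eq_pow_sum, Finset.prod_pow_eq_pow_sum, expDegree,
    expIndex]
  simp only [mul_comm]

theorem leSubst_monomial (α : Fin (n + 1) →₀ ℕ) :
    leSubst k (Fin.last n) (monomial α 1) =
      Polynomial.C (X (Fin.last n)) ^ expDegree α *
        (-Polynomial.X) ^ (n * expDegree α - expIndex α) := by
  rw [monomial_eq, C_1, one_mul, map_finsuppProd, Finsupp.prod_fintype _ _ (by simp)]
  simp only [map_pow, leSubst_last_X, mul_pow, ← pow_mul]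
  rw [Finset.prod_mul_distrib, Finset.prod_pow_eq_pow_sum, Finset.prod_pow_eq_pow_sum, expDegree,
    expIndex]
  congr 2
  refine (Nat.sub_eq_of_eq_add ?_).symm
  rw [← Finset.sum_add_distrib, Finset.mul_sum]
  refine Finset.sum_congr rfl fun i _ => ?_
  rw [mul_comm (n - (i : ℕ)), ← mul_add, Nat.sub_add_cancel (Nat.lt_succ_iff.1 i.2), mul_comm]

/-- Both substitutions see a monomial only through its degree and index, and `J` is their common
kernel. -/
theorem monomial_sub_mem_rationalNormalCurveIdeal {α β : Fin (n + 1) →₀ ℕ}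
    (h1 : expDegree α = expDegree β) (h2 : expIndex α = expIndex β) :
    monomial α (1 : k) - monomial β 1 ∈ rationalNormalCurveIdeal k n := by
  rw [mem_rationalNormalCurveIdeal_iff, map_sub, map_sub, leSubst_monomial, leSubst_monomial,
    geSubst_monomial, geSubst_monomial, h1, h2, sub_self, sub_self]
  exact ⟨rfl, rfl⟩

end CurveMonomials

/-! ### Binomial generators of the ideal of the curve -/

section CurveIdealGenerators

variable {k : Type*} [Field k] {n : ℕ}

/-- The signed monomial `(-1) ^ κ Xₙ ^ a X_{b+κ}`. -/
noncomputable def topTerm (k : Type*) [Field k] (n a b κ : ℕ) : MvPolynomial (Fin (n + 1)) k :=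
  (-1) ^ κ * (X (Fin.last n) ^ a * X (Fin.ofNat (n + 1) (b + κ)))

/-- The signed monomial `(-1) ^ κ X₀ ^ (a + d) X_κ`. -/
noncomputable def botTerm (k : Type*) [Field k] (n a d κ : ℕ) : MvPolynomial (Fin (n + 1)) k :=
  (-1) ^ κ * (X 0 ^ (a + d) * X (Fin.ofNat (n + 1) κ))

theorem topTerm_eq (a b κ : ℕ) : topTerm k n a b κ = (-1) ^ κ *
    monomial (Finsupp.single (Fin.last n) a + Finsupp.single (Fin.ofNat (n + 1) (b + κ)) 1) 1 := by
  rw [topTerm, X_pow_eq_monomial, X, monomial_mul, one_mul]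

theorem botTerm_eq (a d κ : ℕ) : botTerm k n a d κ = (-1) ^ κ *
    monomial (Finsupp.single 0 (a + d) + Finsupp.single (Fin.ofNat (n + 1) κ) 1) 1 := by
  rw [botTerm, X_pow_eq_monomial, X, monomial_mul, one_mul]

/-- The ideal generated by the `2 × 2` minors and the differences of `topTerm` and `botTerm`. -/
noncomputable def binomialIdeal (k : Type*) [Field k] (n a b d : ℕ) :
    Ideal (MvPolynomial (Fin (n + 1)) k) :=
  rationalNormalCurveIdeal k n ⊔
    Ideal.span {f | ∃ κ ≤ n - b, f = topTerm k n a b κ - botTerm k n a d κ}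

theorem IsArithmeticSequence.coprime {m : Fin (n + 1) → ℕ} {d : ℕ}
    (hm : IsArithmeticSequence m d) : Nat.Coprime (m 0) d := by
  refine Nat.dvd_one.1 ((Finset.dvd_gcd fun i _ => ?_ : _ ∣ Finset.univ.gcd m).trans
    hm.gcd_eq_one.dvd)
  rw [hm.eq_add i]
  exact dvd_add (Nat.gcd_dvd_left _ _) (Dvd.dvd.mul_left (Nat.gcd_dvd_right _ _) _)

variable {m : Fin (n + 1) → ℕ} {a b d : ℕ}

theorem aeval_monomial_curve (hm : IsArithmeticSequence m d) (α : Fin (n + 1) →₀ ℕ) :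
    aeval (R := k) (fun i => (Polynomial.X : Polynomial k) ^ m i) (monomial α 1) =
      Polynomial.X ^ (expDegree α * m 0 + expIndex α * d) := by
  rw [monomial_eq, C_1, one_mul, map_finsuppProd, Finsupp.prod_fintype _ _ (by simp)]
  simp only [map_pow, aeval_X, ← pow_mul]
  rw [Finset.prod_pow_eq_pow_sum, expDegree, expIndex, Finset.sum_mul, Finset.sum_mul,
    ← Finset.sum_add_distrib]
  congr 1
  refine Finset.sum_congr rfl fun i _ => ?_
  rw [hm.eq_add i]
  ring

theorem monomial_sub_mem_monomialCurveIdeal (hm : IsArithmeticSequence m d)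
    {α β : Fin (n + 1) →₀ ℕ}
    (h : expDegree α * m 0 + expIndex α * d = expDegree β * m 0 + expIndex β * d) :
    monomial α (1 : k) - monomial β 1 ∈ monomialCurveIdeal k m := by
  rw [monomialCurveIdeal, RingHom.mem_ker]
  simp only [map_sub]
  rw [aeval_monomial_curve hm, aeval_monomial_curve hm, h, sub_self]

theorem val_ofNat_of_le {i : ℕ} (h : i ≤ n) : ((Fin.ofNat (n + 1) i : Fin (n + 1)) : ℕ) = i := by
  simp [Fin.ofNat, Nat.mod_eq_of_lt (Nat.lt_succ_of_le h)]

theorem binomialIdeal_le (hm : IsArithmeticSequence m d) (hbn : b ≤ n) (hab : m 0 = a * n + b) :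
    binomialIdeal k n a b d ≤ monomialCurveIdeal k m := by
  refine sup_le (Ideal.span_le.2 ?_) (Ideal.span_le.2 ?_)
  · rintro _ ⟨i, j, hij, rfl⟩
    rw [det_curveMatrix_submatrix, X, X, X, X, monomial_mul, monomial_mul, one_mul]
    refine monomial_sub_mem_monomialCurveIdeal hm ?_
    simp only [expDegree_add, expIndex_add, expDegree_single, expIndex_single, Fin.val_succ,
      Fin.val_castSucc]
    ring
  · rintro _ ⟨κ, hκ, rfl⟩
    rw [topTerm_eq, botTerm_eq, ← mul_sub]
    refine Ideal.mul_mem_left _ _ (monomial_sub_mem_monomialCurveIdeal hm ?_)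
    simp only [expDegree_add, expIndex_add, expDegree_single, expIndex_single, Fin.val_last,
      val_ofNat_of_le (show b + κ ≤ n by omega), val_ofNat_of_le (show κ ≤ n by omega),
      Fin.val_zero, hab]
    ring

theorem neg_one_pow_mul_mem_iff {A : Type*} [CommRing A] (I : Ideal A) (κ : ℕ) (x : A) :
    (-1) ^ κ * x ∈ I ↔ x ∈ I := by
  rcases neg_one_pow_eq_or A κ with h | h <;> simp [h]

/-- A monomial of large index is congruent to one of smaller index. -/
theorem exists_monomial_sub_mem_of_le (hb : 1 ≤ b) (hbn : b ≤ n)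
    (α : Fin (n + 1) →₀ ℕ) (hα : a * n + b ≤ expIndex α) :
    ∃ β : Fin (n + 1) →₀ ℕ, monomial α (1 : k) - monomial β 1 ∈ binomialIdeal k n a b d ∧
      expDegree β = expDegree α + d ∧ expIndex β + (a * n + b) = expIndex α := by
  have hle := expIndex_le α
  -- The largest admissible `κ`: it leaves an index small enough to be carried by a cofactor of
  -- degree `expDegree α - (a + 1)`. Modulo `J` the monomial is then this cofactor times a top
  -- monomial, which is exchanged for the bottom one.
  obtain ⟨κ, hκ⟩ : ∃ κ, κ = min (expIndex α - (a * n + b)) (n - b) := ⟨_, rfl⟩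
  have hja : a + 1 ≤ expDegree α := by
    by_contra h
    have h1 : expDegree α ≤ a := by omega
    have h2 := Nat.mul_le_mul_left n h1
    have h3 : n * a = a * n := mul_comm _ _
    omega
  have hc : expIndex α - (a * n + b) - κ ≤ n * (expDegree α - (a + 1)) := by
    rw [Nat.mul_sub, Nat.mul_succ]
    have h3 : n * a = a * n := mul_comm _ _
    omega
  obtain ⟨γ, hγ1, hγ2⟩ := exists_exponent _ _ hc
  have hκ1 : κ ≤ n - b := by omega
  have e1 : ((Fin.ofNat (n + 1) (b + κ) : Fin (n + 1)) : ℕ) = b + κ := val_ofNat_of_le (by omega)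
  have e2 : ((Fin.ofNat (n + 1) κ : Fin (n + 1)) : ℕ) = κ := val_ofNat_of_le (by omega)
  refine ⟨γ + (Finsupp.single 0 (a + d) + Finsupp.single (Fin.ofNat (n + 1) κ) 1), ?_, ?_, ?_⟩
  · set α' := γ + (Finsupp.single (Fin.last n) a + Finsupp.single (Fin.ofNat (n + 1) (b + κ)) 1)
      with hα'
    rw [← sub_add_sub_cancel _ (monomial α' (1 : k)) _]
    refine Ideal.add_mem _ (Ideal.mem_sup_left (monomial_sub_mem_rationalNormalCurveIdeal ?_ ?_))
      (Ideal.mem_sup_right ?_)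
    · simp only [hα', expDegree_add, expDegree_single, hγ1]
      omega
    · simp only [hα', expIndex_add, expIndex_single, hγ2, e1, Fin.val_last]
      omega
    · have h1 : topTerm k n a b κ - botTerm k n a d κ ∈ Ideal.span
          {f | ∃ κ ≤ n - b, f = topTerm k n a b κ - botTerm k n a d κ} :=
        Ideal.subset_span ⟨κ, hκ1, rfl⟩
      rw [topTerm_eq, botTerm_eq, ← mul_sub, neg_one_pow_mul_mem_iff] at h1
      have h2 := Ideal.mul_mem_left _ (monomial γ (1 : k)) h1
      rwa [mul_sub, monomial_mul, monomial_mul, one_mul] at h2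
  · simp only [expDegree_add, expDegree_single, hγ1]
    omega
  · simp only [expIndex_add, expIndex_single, hγ2, e2, Fin.val_zero]
    omega

/-- Every monomial is congruent to one of index less than `a * n + b`. -/
theorem exists_monomial_sub_mem (hb : 1 ≤ b) (hbn : b ≤ n) (c : ℕ) :
    ∀ α : Fin (n + 1) →₀ ℕ, expIndex α = c →
    ∃ β : Fin (n + 1) →₀ ℕ, monomial α (1 : k) - monomial β 1 ∈ binomialIdeal k n a b d ∧
      expDegree α * (a * n + b) + expIndex α * d = expDegree β * (a * n + b) + expIndex β * d ∧
      expIndex β < a * n + b := by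
  induction c using Nat.strong_induction_on with
  | _ c ih =>
    intro α hα
    rcases lt_or_ge (expIndex α) (a * n + b) with h | h
    · exact ⟨α, by simp, rfl, h⟩
    · obtain ⟨β, h1, h2, h3⟩ := exists_monomial_sub_mem_of_le (k := k) (d := d) hb hbn α h
      obtain ⟨γ, h4, h5, h6⟩ := ih (expIndex β) (by omega) β rfl
      refine ⟨γ, ?_, ?_, h6⟩
      · rw [← sub_add_sub_cancel _ (monomial β (1 : k)) _]
        exact Ideal.add_mem _ h1 h4
      · rw [← h5, h2, ← h3]
        ring

/-- Reduction modulo `M` determines `c`, since `d` is invertible there and `c < M`. Thus a reduced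
monomial is determined, modulo `J`, by its exponent of `t`. -/
theorem eq_of_mul_add_mul_eq {M d j j' c c' : ℕ} (hcop : Nat.Coprime M d)
    (hc : c < M) (hc' : c' < M) (h : j * M + c * d = j' * M + c' * d) : j = j' ∧ c = c' := by
  have h1 : c * d ≡ c' * d [MOD M] := by
    have : (j * M + c * d) % M = (j' * M + c' * d) % M := by rw [h]
    simpa [Nat.ModEq, Nat.add_mod] using this
  have h2 : c ≡ c' [MOD M] := Nat.ModEq.cancel_right_of_coprime hcop h1
  have h3 : c = c' := by
    rwa [Nat.ModEq, Nat.mod_eq_of_lt hc, Nat.mod_eq_of_lt hc'] at h2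
  subst h3
  exact ⟨Nat.eq_of_mul_eq_mul_right (by omega) (Nat.add_right_cancel h), rfl⟩

theorem monomial_sub_mem_binomialIdeal (hm : IsArithmeticSequence m d) (hb : 1 ≤ b) (hbn : b ≤ n)
    (hab : m 0 = a * n + b) {α β : Fin (n + 1) →₀ ℕ}
    (h : expDegree α * m 0 + expIndex α * d = expDegree β * m 0 + expIndex β * d) :
    monomial α (1 : k) - monomial β 1 ∈ binomialIdeal k n a b d := by
  obtain ⟨α', h1, h2, h3⟩ := exists_monomial_sub_mem (k := k) (a := a) (d := d) hb hbn _ α rfl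
  obtain ⟨β', h4, h5, h6⟩ := exists_monomial_sub_mem (k := k) (a := a) (d := d) hb hbn _ β rfl
  rw [hab, h2, h5] at h
  obtain ⟨e1, e2⟩ := eq_of_mul_add_mul_eq (hab ▸ hm.coprime) h3 h6 h
  have h7 := Ideal.mem_sup_left (T := Ideal.span
    {f | ∃ κ ≤ n - b, f = topTerm k n a b κ - botTerm k n a d κ})
    (monomial_sub_mem_rationalNormalCurveIdeal (k := k) e1 e2)
  have h8 := Ideal.sub_mem _ (Ideal.add_mem _ h1 h7) h4
  convert h8 using 1
  ring

/-- Monomials with equal exponents of `t` agree modulo the binomials, so the quotient map factors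
`k`-linearly through the parametrization and kills its kernel. -/
theorem monomialCurveIdeal_eq (hm : IsArithmeticSequence m d) (hb : 1 ≤ b) (hbn : b ≤ n)
    (hab : m 0 = a * n + b) : monomialCurveIdeal k m = binomialIdeal k n a b d := by
  refine le_antisymm (fun f hf => ?_) (binomialIdeal_le hm hbn hab)
  set Q := binomialIdeal k n a b d with hQ
  set W : (Fin (n + 1) →₀ ℕ) → ℕ := fun α => expDegree α * m 0 + expIndex α * d with hW
  have hfac : Function.FactorsThrough
      (fun α => Ideal.Quotient.mk Q (monomial α (1 : k))) W := fun α β h =>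
    Ideal.Quotient.eq.2 (monomial_sub_mem_binomialIdeal hm hb hbn hab h)
  -- Exponents outside the semigroup are never reached by a monomial, so the default value `0` is
  -- harmless.
  set g : ℕ → MvPolynomial (Fin (n + 1)) k ⧸ Q :=
    Function.extend W (fun α => Ideal.Quotient.mk Q (monomial α (1 : k))) 0 with hg
  have hgW : ∀ α, g (W α) = Ideal.Quotient.mk Q (monomial α (1 : k)) := fun α =>
    hfac.extend_apply 0 α
  set L := (Polynomial.basisMonomials k).constr k g with hL
  have hcomp : L ∘ₗ (aeval (R := k) fun i => (Polynomial.X : Polynomial k) ^ m i).toLinearMap =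
      (Ideal.Quotient.mkₐ k Q).toLinearMap := by
    refine (basisMonomials (Fin (n + 1)) k).ext fun α => ?_
    rw [coe_basisMonomials]
    simp only [LinearMap.comp_apply, AlgHom.toLinearMap_apply]
    rw [aeval_monomial_curve hm]
    have : (Polynomial.X : Polynomial k) ^ (W α) = Polynomial.basisMonomials k (W α) := by
      rw [Polynomial.coe_basisMonomials, Polynomial.X_pow_eq_monomial]
    change L (Polynomial.X ^ (W α)) = _
    rw [this, hL, Module.Basis.constr_basis, hgW]
    rfl
  have h1 := congrArg (fun F => F f) hcomp
  simp only [LinearMap.comp_apply, AlgHom.toLinearMap_apply] at h1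
  rw [monomialCurveIdeal, RingHom.mem_ker] at hf
  rw [← Ideal.Quotient.eq_zero_iff_mem]
  have h2 : (aeval (R := k) fun i => (Polynomial.X : Polynomial k) ^ m i) f = 0 := hf
  rw [h2, map_zero] at h1
  exact h1.symm

end CurveIdealGenerators

/-! ### Cohen–Macaulayness in dimension one -/

section DimensionOne

/-- A Noetherian domain in which nonzero primes are maximal is Cohen–Macaulay. -/
theorem isCohenMacaulay_of_dimensionLEOne (A : Type*) [CommRing A] [IsDomain A]
    [IsNoetherianRing A] [Ring.DimensionLEOne A] : IsCohenMacaulay A := by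
  refine ⟨inferInstance, fun p hp => ⟨IsLocalization.isNoetherianRing p.primeCompl _ inferInstance,
    ?_⟩⟩
  have hdim := IsLocalization.AtPrime.ringKrullDim_eq_height p (Localization.AtPrime p)
  rcases eq_or_ne p ⊥ with h | h
  · refine ⟨[], by simp, RingTheory.Sequence.IsRegular.nil _ _, ?_⟩
    rw [hdim, Ideal.height_eq_zero_iff_eq_bot.2 h]
    rfl
  · obtain ⟨x, hx, hx0⟩ := Submodule.exists_mem_ne_zero_of_ne_bot h
    have hle : p.height ≤ 1 := by
      have h1 := Ideal.height_le_ringKrullDim_of_ne_top hp.ne_top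
      have h2 : ringKrullDim A ≤ 1 := Order.KrullDimLE.krullDim_le (n := 1)
      exact_mod_cast h1.trans h2
    have hht : p.height = 1 := by
      refine le_antisymm hle (Order.one_le_iff_ne_zero.2 fun h0 => h ?_)
      exact Ideal.height_eq_zero_iff_eq_bot.1 h0
    have hxm : algebraMap A (Localization.AtPrime p) x ∈
        IsLocalRing.maximalIdeal (Localization.AtPrime p) :=
      (IsLocalization.AtPrime.to_map_mem_maximal_iff _ p x).2 hx
    have hx0' : algebraMap A (Localization.AtPrime p) x ≠ 0 := fun h0 =>
      hx0 (IsLocalization.injective (Localization.AtPrime p) p.primeCompl_le_nonZeroDivisors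
        (h0.trans (map_zero _).symm))
    have : IsDomain (Localization.AtPrime p) :=
      IsLocalization.isDomain_localization p.primeCompl_le_nonZeroDivisors
    have : IsNoetherianRing (Localization.AtPrime p) :=
      IsLocalization.isNoetherianRing p.primeCompl _ inferInstance
    refine ⟨[algebraMap A _ x], by simpa using hxm, ?_, ?_⟩
    · refine (IsLocalRing.isRegular_iff_isWeaklyRegular_of_subset_maximalIdeal
        (by simpa using hxm)).2 ?_
      rw [RingTheory.Sequence.isWeaklyRegular_singleton_iff]
      exact IsSMulRegular.of_ne_zero hx0'
    · rw [hdim, hht]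
      rfl

end DimensionOne

/-! ### Dimension of the curve ring and height of its ideal -/

section CurveDimension

variable {k : Type*} [Field k] {n : ℕ}

instance monomialCurveIdeal_isPrime (m : Fin (n + 1) → ℕ) : (monomialCurveIdeal k m).IsPrime :=
  RingHom.ker_isPrime _

theorem X_pow_sub_X_pow_mem (m : Fin (n + 1) → ℕ) (i j : Fin (n + 1)) :
    (X i ^ m j - X j ^ m i : MvPolynomial (Fin (n + 1)) k) ∈ monomialCurveIdeal k m := by
  rw [monomialCurveIdeal, RingHom.mem_ker]
  simp [← pow_mul, mul_comm]

/-- Each `Xᵢ` satisfies `Xᵢ ^ m₀ = X₀ ^ mᵢ`, so the curve ring is integral over `k[X₀]`. A nonzero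
prime contracts to a nonzero, hence maximal, ideal. -/
theorem dimensionLEOne_monomialCurve (m : Fin (n + 1) → ℕ) (h0 : 0 < m 0) :
    Ring.DimensionLEOne (MvPolynomial (Fin (n + 1)) k ⧸ monomialCurveIdeal k m) := by
  set I := monomialCurveIdeal k m with hI
  let φ : Polynomial k →ₐ[k] MvPolynomial (Fin (n + 1)) k ⧸ I :=
    Polynomial.aeval (Ideal.Quotient.mk I (X 0))
  algebraize [φ.toRingHom]
  have hφ : ∀ q, algebraMap (Polynomial k) (MvPolynomial (Fin (n + 1)) k ⧸ I) q = φ q :=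
    fun _ => rfl
  have hX : ∀ i, IsIntegral (Polynomial k) (Ideal.Quotient.mk I (X i)) := by
    intro i
    refine IsIntegral.of_pow h0 ?_
    have : Ideal.Quotient.mk I (X i) ^ m 0 =
        algebraMap (Polynomial k) (MvPolynomial (Fin (n + 1)) k ⧸ I) (Polynomial.X ^ m i) := by
      rw [hφ, map_pow, Polynomial.aeval_X, ← map_pow, ← map_pow, Ideal.Quotient.eq]
      exact X_pow_sub_X_pow_mem m i 0
    rw [this]
    exact isIntegral_algebraMap
  have hint : Algebra.IsIntegral (Polynomial k) (MvPolynomial (Fin (n + 1)) k ⧸ I) := by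
    refine ⟨fun x => ?_⟩
    obtain ⟨f, rfl⟩ := Ideal.Quotient.mk_surjective x
    induction f using MvPolynomial.induction_on with
    | C a =>
      have : Ideal.Quotient.mk I (C a) =
          algebraMap (Polynomial k) (MvPolynomial (Fin (n + 1)) k ⧸ I) (Polynomial.C a) := by
        rw [hφ, Polynomial.aeval_C]
        rfl
      rw [this]
      exact isIntegral_algebraMap
    | add p q hp hq => rw [map_add]; exact hp.add hq
    | mul_X p i hp => rw [map_mul]; exact hp.mul (hX i)
  refine ⟨fun {p} hp hpp => ?_⟩
  obtain ⟨x, hx, hx0⟩ := Submodule.exists_mem_ne_zero_of_ne_bot hp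
  have hne := Ideal.comap_ne_bot_of_integral_mem hx0 hx (hint.isIntegral x)
  have hmax : (p.comap (algebraMap (Polynomial k) _)).IsMaximal :=
    Ideal.IsPrime.isMaximal inferInstance hne
  exact Ideal.isMaximal_of_isIntegral_of_isMaximal_comap p hmax

/-- The map that parametrizes the first variables and fixes the others. -/
noncomputable def partialParam (k : Type*) [Field k] {n : ℕ} (m : Fin (n + 1) → ℕ) (j : ℕ) :
    MvPolynomial (Fin (n + 1)) k →ₐ[k] MvPolynomial (Fin (n + 1)) (Polynomial k) :=
  aeval fun i => if (i : ℕ) ≤ j then C (Polynomial.X ^ m i) else X i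

theorem ker_partialParam_last (m : Fin (n + 1) → ℕ) :
    RingHom.ker (partialParam k m n) = monomialCurveIdeal k m := by
  have h : (partialParam k m n : MvPolynomial (Fin (n + 1)) k →+*
      MvPolynomial (Fin (n + 1)) (Polynomial k)) = (C : Polynomial k →+* _).comp
      ((aeval (R := k) fun i => (Polynomial.X : Polynomial k) ^ m i : _ →ₐ[k] _) : _ →+* _) := by
    refine MvPolynomial.ringHom_ext (fun a => ?_) fun i => ?_
    · simp only [RingHom.comp_apply, RingHom.coe_coe]
      rw [← MvPolynomial.algebraMap_eq, AlgHom.commutes, AlgHom.commutes]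
      rfl
    · simp [partialParam, Nat.lt_succ_iff.1 i.2]
  ext f
  have h1 := congrArg (fun F => F f) h
  simp only [RingHom.comp_apply, RingHom.coe_coe] at h1
  rw [monomialCurveIdeal, RingHom.mem_ker, RingHom.mem_ker, h1, map_eq_zero_iff _ (C_injective _ _)]

/-- Parametrizing one more variable factors through the previous map. The new relation `X_{j+1} ^ m₀
= X₀ ^ m_{j+1}` fails while `X_{j+1}` is still free. -/
theorem ker_partialParam_lt (m : Fin (n + 1) → ℕ) (h0 : 0 < m 0) {j : ℕ} (hj : j < n) :
    RingHom.ker (partialParam k m j) < RingHom.ker (partialParam k m (j + 1)) := by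
  set e : Fin (n + 1) := ⟨j + 1, by omega⟩ with he
  have hne : e ≠ 0 := fun h => by simpa [he] using congrArg Fin.val h
  refine lt_of_le_of_ne (fun f hf => ?_) fun heq => ?_
  · have h : partialParam k m (j + 1) = ((aeval (R := Polynomial k) fun i : Fin (n + 1) =>
        if i = e then C (Polynomial.X ^ m i) else X i :
          MvPolynomial (Fin (n + 1)) (Polynomial k) →ₐ[Polynomial k] _).restrictScalars k).comp
        (partialParam k m j) := by
      refine MvPolynomial.algHom_ext fun i => ?_
      simp only [partialParam, aeval_X, AlgHom.comp_apply, AlgHom.restrictScalars_apply]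
      by_cases h1 : (i : ℕ) ≤ j
      · rw [if_pos (by omega), if_pos h1, ← MvPolynomial.algebraMap_eq, AlgHom.commutes]
      · rw [if_neg h1, aeval_X]
        refine if_congr ?_ rfl rfl
        rw [he, Fin.ext_iff]
        simp only
        omega
    rw [RingHom.mem_ker] at hf ⊢
    rw [h, AlgHom.comp_apply, hf, map_zero]
  · have h1 : (X e ^ m 0 - X 0 ^ m e : MvPolynomial (Fin (n + 1)) k) ∈
        RingHom.ker (partialParam k m (j + 1)) := by
      rw [RingHom.mem_ker]
      simp [partialParam, he, ← pow_mul, mul_comm]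
    rw [← heq, RingHom.mem_ker] at h1
    have h2 : (X e ^ m 0 - C (Polynomial.X ^ m 0) ^ m e :
        MvPolynomial (Fin (n + 1)) (Polynomial k)) = 0 := by
      simpa [partialParam, he] using h1
    have h3 := congrArg (coeff (Finsupp.single e (m 0))) h2
    rw [coeff_sub, ← map_pow, coeff_C, X_pow_eq_monomial, coeff_monomial, if_pos rfl, if_neg,
      sub_zero, coeff_zero] at h3
    · exact one_ne_zero h3
    · intro h4
      have := congrArg (fun g => g e) h4
      simp at this
      omega

theorem le_height_ker_partialParam (m : Fin (n + 1) → ℕ) (h0 : 0 < m 0) (j : ℕ) (hj : j ≤ n) :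
    (j : ℕ∞) ≤ (RingHom.ker (partialParam k m j)).height := by
  induction j with
  | zero => simp
  | succ j ih =>
    have h1 := ih (by omega)
    have : (RingHom.ker (partialParam k m j)).IsPrime := RingHom.ker_isPrime _
    have : (RingHom.ker (partialParam k m (j + 1))).IsPrime := RingHom.ker_isPrime _
    have h2 := Ideal.height_add_one_le_of_lt_of_isPrime (ker_partialParam_lt (k := k) m h0
      (show j < n by omega))
    push_cast
    exact (add_le_add_left h1 1).trans h2

theorem height_monomialCurveIdeal (m : Fin (n + 1) → ℕ) (hm : ∀ i, 0 < m i) :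
    (monomialCurveIdeal k m).height = n := by
  refine le_antisymm ?_ ?_
  -- For the upper bound: the ideal is strictly inside the ideal of the origin, whose height is at
  -- most `n + 1`.
  · have hM : (RingHom.ker (constantCoeff (σ := Fin (n + 1)) (R := k))).IsPrime :=
      RingHom.ker_isPrime _
    have hlt : monomialCurveIdeal k m < RingHom.ker (constantCoeff (σ := Fin (n + 1)) (R := k)) := by
      refine lt_of_le_of_ne (fun f hf => ?_) fun heq => ?_
      · have h : (Polynomial.evalRingHom (0 : k)).comp
            ((aeval fun i => (Polynomial.X : Polynomial k) ^ m i :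
              MvPolynomial (Fin (n + 1)) k →ₐ[k] Polynomial k) :
              MvPolynomial (Fin (n + 1)) k →+* Polynomial k) = constantCoeff := by
          refine MvPolynomial.ringHom_ext (fun a => ?_) fun i => ?_
          · simp
          · simp [(hm i).ne']
        have h1 : (aeval (R := k) fun i => (Polynomial.X : Polynomial k) ^ m i) f = 0 := hf
        rw [RingHom.mem_ker, ← h, RingHom.comp_apply, RingHom.coe_coe, h1, map_zero]
      · have h1 : (X 0 : MvPolynomial (Fin (n + 1)) k) ∈ monomialCurveIdeal k m := by
          rw [heq, RingHom.mem_ker]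
          simp
        rw [monomialCurveIdeal, RingHom.mem_ker] at h1
        simp at h1
    have h1 := Ideal.height_add_one_le_of_lt_of_isPrime hlt
    have h2 : ((RingHom.ker (constantCoeff (σ := Fin (n + 1)) (R := k))).height : WithBot ℕ∞) ≤
        ((n + 1 : ℕ) : ℕ∞) := by
      refine (Ideal.height_le_ringKrullDim_of_ne_top hM.ne_top).trans ?_
      rw [MvPolynomial.ringKrullDim_of_isNoetherianRing, ringKrullDim_eq_zero_of_field]
      simp
    have h3 := h1.trans (WithBot.coe_le_coe.1 h2)
    push_cast at h3
    exact (ENat.add_le_add_iff_right (by simp)).1 h3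
  · rw [← ker_partialParam_last]
    exact le_height_ker_partialParam m (hm 0) n le_rfl

end CurveDimension

/-! ### From bidegrees to the weights of the curve -/

section Weights

variable {k : Type*} [Field k] {n : ℕ}

/-- The weight `m₀ p + d q` of a bidegree `(p, q)`. -/
def biToWeight (m₀ d : ℕ) : ℤ × ℤ →+ ℤ where
  toFun D := m₀ * D.1 + d * D.2
  map_zero' := by simp
  map_add' x y := by simp; ring

theorem biToWeight_apply (m₀ d : ℕ) (D : ℤ × ℤ) : biToWeight m₀ d D = m₀ * D.1 + d * D.2 := rfl

theorem MvPolynomial.IsWeightedHomogeneous.map_weight {σ R M N : Type*} [CommSemiring R]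
    [AddCommMonoid M] [AddCommMonoid N] {w : σ → M} {p : MvPolynomial σ R} {e : M}
    (hp : IsWeightedHomogeneous w p e) (L : M →+ N) {w' : σ → N} (hw : ∀ i, w' i = L (w i)) :
    IsWeightedHomogeneous w' p (L e) := by
  intro c hc
  rw [← hp hc, Finsupp.weight_apply, Finsupp.weight_apply, map_finsuppSum]
  refine Finsupp.sum_congr fun i _ => ?_
  rw [hw, map_nsmul]

theorem IsArithmeticSequence.weight_eq {m : Fin (n + 1) → ℕ} {d : ℕ}
    (hm : IsArithmeticSequence m d) (i : Fin (n + 1)) :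
    (m i : ℤ) = biToWeight (m 0) d (biWeight n i) := by
  rw [hm.eq_add i, biToWeight_apply, biWeight]
  push_cast
  ring

/-- The first component of the bidegree is the standard degree, so a positive value excludes a
constant term. All minimality statements rest on this. -/
theorem mem_span_X_of_isWeightedHomogeneous {p : MvPolynomial (Fin (n + 1)) k} {D : ℤ × ℤ}
    (hp : IsWeightedHomogeneous (biWeight n) p D) (hD : 0 < D.1) :
    p ∈ Ideal.span (Set.range (X : Fin (n + 1) → MvPolynomial (Fin (n + 1)) k)) := by
  rw [← Set.image_univ, mem_ideal_span_X_image]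
  intro c hc
  by_contra! h
  have hc0 : c = 0 := Finsupp.ext fun i => h i (Set.mem_univ i)
  have := hp (mem_support_iff.1 hc)
  rw [hc0, map_zero] at this
  rw [← this] at hD
  exact lt_irrefl _ hD

theorem enDegree_eq (m₀ d s : ℕ) (x : enBasis n s) :
    enDegree n m₀ d s x = biToWeight m₀ d (biDegree x.1.1 x.1.2) := by
  unfold enDegree
  rw [biToWeight_apply, biDegree]
  split_ifs with h
  · subst h
    rw [eq_enUnit x]
    simp [enUnit]
  · have hx : x.1 ∈ spliceBasis n 0 s := by
      rw [← enBasis_eq_spliceBasis]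
      exact x.2
    rw [((mem_spliceBasis_of_lt (Nat.pos_of_ne_zero h) _).1 hx).1]
    push_cast
    ring

theorem mem_spliceBasis_of_fBasis {b s : ℕ} (x : fBasis n b (s + 1)) :
    x.1 ∈ spliceBasis n (n - b) s := by
  rw [← fBasis_succ_eq_spliceBasis]
  exact x.2

theorem fDegree_eq (m₀ a b d s : ℕ) (x : fBasis n b (s + 1)) :
    fDegree n m₀ a b d (s + 1) x =
      biToWeight m₀ d (biDegree x.1.1 x.1.2) + m₀ * (a + d + 1) := by
  have hx := mem_spliceBasis_of_fBasis x
  unfold fDegree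
  rw [biToWeight_apply, biDegree]
  split_ifs with h
  · rw [((mem_spliceBasis_of_le (by omega) _).1 hx).1]
    push_cast
    ring
  · rw [((mem_spliceBasis_of_lt (by omega) _).1 hx).1]
    push_cast
    ring

theorem card_of_mem_spliceBasis {l s : ℕ} {x : Finset (Fin n) × ℕ} (hx : x ∈ spliceBasis n l s) :
    x.1.card = if s ≤ l then s else s + 1 := by
  split_ifs with h
  · exact ((mem_spliceBasis_of_le h _).1 hx).1
  · exact ((mem_spliceBasis_of_lt (not_le.1 h) _).1 hx).1

theorem spliceMatrix_mem_span_X {l s : ℕ} {B B' : Finset (Finset (Fin n) × ℕ)}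
    (hB : B = spliceBasis n l s) (hB' : B' = spliceBasis n l (s + 1)) (y : B) (x : B') :
    spliceMatrix k l s B B' y x ∈
      Ideal.span (Set.range (X : Fin (n + 1) → MvPolynomial (Fin (n + 1)) k)) := by
  subst hB hB'
  refine mem_span_X_of_isWeightedHomogeneous (isWeightedHomogeneous_spliceMatrix l s y x) ?_
  have hy := card_of_mem_spliceBasis y.2
  have hx := card_of_mem_spliceBasis x.2
  simp only [biDegree, Prod.fst_sub, hy, hx]
  split_ifs <;> omega

end Weights

/-! ### The Eagon–Northcott complex resolves `R ⧸ J` -/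

section EagonNorthcottResolution

variable {k : Type*} [Field k] {n : ℕ}

theorem splice_exact_of_eq {l : ℕ} {B : ℕ → Finset (Finset (Fin n) × ℕ)}
    (hB : B = spliceBasis n l) (s : ℕ) (v : B (s + 1) → MvPolynomial (Fin (n + 1)) k) :
    (spliceMatrix k l s (B s) (B (s + 1))).mulVec v = 0 ↔
      ∃ w, (spliceMatrix k l (s + 1) (B (s + 1)) (B (s + 1 + 1))).mulVec w = v := by
  subst hB
  exact splice_exact l s v

theorem splice_exact_zero_of_eq {l : ℕ} {B : ℕ → Finset (Finset (Fin n) × ℕ)}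
    (hB : B = spliceBasis n l) (v : B 0 → MvPolynomial (Fin (n + 1)) k) :
    (∃ w, (spliceMatrix k l 0 (B 0) (B (0 + 1))).mulVec w = v) ↔ leAug l v = 0 ∧ geAug v = 0 := by
  subst hB
  exact splice_exact_zero l v

theorem enDifferential_exact (s : ℕ) (v : enBasis n (s + 1) → MvPolynomial (Fin (n + 1)) k) :
    (enDifferential k n s).mulVec v = 0 ↔ ∃ w, (enDifferential k n (s + 1)).mulVec w = v := by
  rw [enDifferential_eq_spliceMatrix, enDifferential_eq_spliceMatrix]
  exact splice_exact_of_eq (enBasis_eq_spliceBasis n) s v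

theorem isWeightedHomogeneous_enDifferential {m : Fin (n + 1) → ℕ} {d : ℕ}
    (hm : IsArithmeticSequence m d) (s : ℕ) (y : enBasis n s) (x : enBasis n (s + 1)) :
    IsWeightedHomogeneous (fun i => (m i : ℤ)) (enDifferential k n s y x)
      (enDegree n (m 0) d (s + 1) x - enDegree n (m 0) d s y) := by
  rw [enDegree_eq, enDegree_eq, ← map_sub, enDifferential_eq_spliceMatrix]
  exact (isWeightedHomogeneous_spliceMatrix 0 s y x).map_weight _ hm.weight_eq

theorem enDifferential_mem_span_X (s : ℕ) (y : enBasis n s) (x : enBasis n (s + 1)) :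
    enDifferential k n s y x ∈
      Ideal.span (Set.range (X : Fin (n + 1) → MvPolynomial (Fin (n + 1)) k)) := by
  rw [enDifferential_eq_spliceMatrix]
  exact spliceMatrix_mem_span_X (by rw [enBasis_eq_spliceBasis]) (by rw [enBasis_eq_spliceBasis])
    y x

theorem isMinimalGradedFreeResolution_enDifferential {m : Fin (n + 1) → ℕ} {d : ℕ}
    (hm : IsArithmeticSequence m d) :
    IsMinimalGradedFreeResolution (fun i => (m i : ℤ)) (rationalNormalCurveIdeal k n)
      (enDegree n (m 0) d) (enDifferential k n) (fun _ => 1) where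
  homogeneous_aug _ := by
    rw [enDegree, if_pos rfl]
    exact isWeightedHomogeneous_one _ _
  homogeneous := isWeightedHomogeneous_enDifferential hm
  surjective x := by
    obtain ⟨f, rfl⟩ := Ideal.Quotient.mk_surjective x
    refine ⟨Pi.single (enUnit n) f, ?_⟩
    rw [Fintype.linearCombination_apply_single]
    exact congrArg (Ideal.Quotient.mk _) (mul_one f)
  exact_aug v := by
    have hv : v = fun _ => v (enUnit n) := funext fun y => by rw [eq_enUnit y]
    have h1 : Fintype.linearCombination (MvPolynomial (Fin (n + 1)) k)
        (fun _ : enBasis n 0 => Ideal.Quotient.mk (rationalNormalCurveIdeal k n) 1) v =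
        Ideal.Quotient.mk _ (v (enUnit n)) := by
      rw [Fintype.linearCombination_apply, Fintype.sum_eq_single (enUnit n)]
      · exact congrArg (Ideal.Quotient.mk _) (mul_one _)
      · exact fun x hx => absurd (eq_enUnit x) hx
    rw [h1, Ideal.Quotient.eq_zero_iff_mem, ← exists_enDifferential_zero_eq_iff, ← hv]
    rfl
  exact s v := enDifferential_exact s v
  minimal := enDifferential_mem_span_X

end EagonNorthcottResolution

/-! ### The binomials on the two charts -/

section CurveAugmentation

variable {k : Type*} [Field k] {n a b d : ℕ}

/-- The sign in `topTerm` cancels the sign of `-x`, so that `κ` enters only through `x ^ (n - b -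
κ)`, as in `leAug`. The other three computations follow the same pattern. -/
theorem leSubst_topTerm {κ : ℕ} (hbn : b ≤ n) (hκ : κ ≤ n - b) :
    leSubst k (Fin.last n) (topTerm k n a b κ) =
      ((-1) ^ (n - b) * Polynomial.C (X (R := k) (Fin.last n)) ^ (a + 1)) *
        Polynomial.X ^ (n - b - κ) := by
  obtain ⟨t, ht⟩ : ∃ t, n - b = κ + t := ⟨n - b - κ, by omega⟩
  rw [topTerm, map_mul, map_mul, map_pow, map_pow, map_neg, map_one, leSubst_last_X,
    leSubst_last_X, val_ofNat_of_le (by omega), Fin.val_last, Nat.sub_self,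
    show n - (b + κ) = t by omega, show n - b - κ = t by omega, ht,
    neg_pow (Polynomial.X : Polynomial (MvPolynomial (Fin (n + 1)) k)), pow_add]
  ring

theorem leSubst_botTerm {κ : ℕ} (hbn : b ≤ n) (hκ : κ ≤ n - b) :
    leSubst k (Fin.last n) (botTerm k n a d κ) =
      ((-1) ^ (n - b) * (Polynomial.C (X (R := k) (Fin.last n)) * (-Polynomial.X) ^ n) ^ (a + d) *
        Polynomial.C (X (R := k) (Fin.last n)) * (-Polynomial.X) ^ b) * Polynomial.X ^ (n - b - κ) := by
  obtain ⟨t, ht⟩ : ∃ t, n - b = κ + t := ⟨n - b - κ, by omega⟩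
  rw [botTerm, map_mul, map_mul, map_pow, map_pow, map_neg, map_one, leSubst_last_X,
    leSubst_last_X, val_ofNat_of_le (by omega), Fin.val_zero, Nat.sub_zero,
    show n - κ = b + t by omega, show n - b - κ = t by omega, ht, pow_add _ b t, pow_add _ κ t,
    neg_pow (Polynomial.X : Polynomial (MvPolynomial (Fin (n + 1)) k)) t]
  ring

theorem geSubst_topTerm {κ : ℕ} (hbn : b ≤ n) (hκ : κ ≤ n - b) :
    geSubst k (Fin.last n) (topTerm k n a b κ) =
      ((Polynomial.C (X (R := k) 0) * (-Polynomial.X) ^ n) ^ a * Polynomial.C (X (R := k) 0) *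
        (-Polynomial.X) ^ b) * Polynomial.X ^ κ := by
  rw [topTerm, map_mul, map_mul, map_pow, map_pow, map_neg, map_one, geSubst_last_X,
    geSubst_last_X, val_ofNat_of_le (by omega), Fin.val_last, pow_add _ b κ,
    neg_pow (Polynomial.X : Polynomial (MvPolynomial (Fin (n + 1)) k)) κ]
  have : ((-1 : Polynomial (MvPolynomial (Fin (n + 1)) k)) ^ κ) * (-1) ^ κ = 1 :=
    pow_mul_pow_eq_one κ (by ring)
  linear_combination ((Polynomial.C (X (R := k) 0) * (-Polynomial.X) ^ n) ^ a *
    Polynomial.C (X (R := k) 0) * (-Polynomial.X) ^ b * Polynomial.X ^ κ) * this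

theorem geSubst_botTerm {κ : ℕ} (hκ : κ ≤ n - b) :
    geSubst k (Fin.last n) (botTerm k n a d κ) =
      Polynomial.C (X (R := k) 0) ^ (a + d + 1) * Polynomial.X ^ κ := by
  rw [botTerm, map_mul, map_mul, map_pow, map_pow, map_neg, map_one, geSubst_last_X,
    geSubst_last_X, val_ofNat_of_le (by omega), Fin.val_zero,
    neg_pow (Polynomial.X : Polynomial (MvPolynomial (Fin (n + 1)) k)) κ]
  have : ((-1 : Polynomial (MvPolynomial (Fin (n + 1)) k)) ^ κ) * (-1) ^ κ = 1 :=
    pow_mul_pow_eq_one κ (by ring)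
  linear_combination (Polynomial.C (X (R := k) 0) ^ (a + d + 1) * Polynomial.X ^ κ) * this

theorem le_of_mem_fBasis_one (x : fBasis n b (0 + 1)) : x.1.2 ≤ n - b :=
  ((mem_spliceBasis_of_le (Nat.zero_le _) _).1 (mem_spliceBasis_of_fBasis x)).2.2

/-- The matrix with entries `topTerm`. -/
noncomputable def topMatrix (k : Type*) [Field k] (n a b : ℕ) :
    Matrix (enBasis n 0) (fBasis n b (0 + 1)) (MvPolynomial (Fin (n + 1)) k) :=
  Matrix.of fun _ x => topTerm k n a b x.1.2

/-- The matrix with entries `botTerm`. -/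
noncomputable def botMatrix (k : Type*) [Field k] (n a b d : ℕ) :
    Matrix (enBasis n 0) (fBasis n b (0 + 1)) (MvPolynomial (Fin (n + 1)) k) :=
  Matrix.of fun _ x => botTerm k n a d x.1.2

theorem leSubst_topMatrix_mulVec (hbn : b ≤ n)
    (f : fBasis n b (0 + 1) → MvPolynomial (Fin (n + 1)) k) (y : enBasis n 0) :
    leSubst k (Fin.last n) ((topMatrix k n a b).mulVec f y) =
      ((-1) ^ (n - b) * Polynomial.C (X (R := k) (Fin.last n)) ^ (a + 1)) * leAug (n - b) f := by
  rw [leAug, Matrix.mulVec, dotProduct, map_sum, Finset.mul_sum]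
  refine Finset.sum_congr rfl fun x _ => ?_
  rw [map_mul, topMatrix, Matrix.of_apply, leSubst_topTerm hbn (le_of_mem_fBasis_one x)]
  ring

theorem leSubst_botMatrix_mulVec (hbn : b ≤ n)
    (f : fBasis n b (0 + 1) → MvPolynomial (Fin (n + 1)) k) (y : enBasis n 0) :
    leSubst k (Fin.last n) ((botMatrix k n a b d).mulVec f y) =
      ((-1) ^ (n - b) * (Polynomial.C (X (R := k) (Fin.last n)) * (-Polynomial.X) ^ n) ^ (a + d) *
        Polynomial.C (X (R := k) (Fin.last n)) * (-Polynomial.X) ^ b) * leAug (n - b) f := by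
  rw [leAug, Matrix.mulVec, dotProduct, map_sum, Finset.mul_sum]
  refine Finset.sum_congr rfl fun x _ => ?_
  rw [map_mul, botMatrix, Matrix.of_apply, leSubst_botTerm hbn (le_of_mem_fBasis_one x)]
  ring

theorem geSubst_topMatrix_mulVec (hbn : b ≤ n)
    (f : fBasis n b (0 + 1) → MvPolynomial (Fin (n + 1)) k) (y : enBasis n 0) :
    geSubst k (Fin.last n) ((topMatrix k n a b).mulVec f y) =
      ((Polynomial.C (X (R := k) 0) * (-Polynomial.X) ^ n) ^ a * Polynomial.C (X (R := k) 0) *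
        (-Polynomial.X) ^ b) * geAug f := by
  rw [geAug, Matrix.mulVec, dotProduct, map_sum, Finset.mul_sum]
  refine Finset.sum_congr rfl fun x _ => ?_
  rw [map_mul, topMatrix, Matrix.of_apply, geSubst_topTerm hbn (le_of_mem_fBasis_one x)]
  ring

theorem geSubst_botMatrix_mulVec
    (f : fBasis n b (0 + 1) → MvPolynomial (Fin (n + 1)) k) (y : enBasis n 0) :
    geSubst k (Fin.last n) ((botMatrix k n a b d).mulVec f y) =
      Polynomial.C (X (R := k) 0) ^ (a + d + 1) * geAug f := by
  rw [geAug, Matrix.mulVec, dotProduct, map_sum, Finset.mul_sum]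
  refine Finset.sum_congr rfl fun x _ => ?_
  rw [map_mul, botMatrix, Matrix.of_apply, geSubst_botTerm (le_of_mem_fBasis_one x)]
  ring

theorem exists_enDifferential_zero_eq_iff_apply (g : enBasis n 0 → MvPolynomial (Fin (n + 1)) k) :
    (∃ w, (enDifferential k n 0).mulVec w = g) ↔
      g (enUnit n) ∈ rationalNormalCurveIdeal k n := by
  rw [← exists_enDifferential_zero_eq_iff]
  have : g = fun _ => g (enUnit n) := funext fun y => by rw [eq_enUnit y]
  rw [← this]

theorem exists_enDifferential_eq_topMatrix (hbn : b ≤ n)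
    (f : fBasis n b (0 + 1) → MvPolynomial (Fin (n + 1)) k)
    (h1 : leAug (n - b) f = 0) (h2 : geAug f = 0) :
    ∃ u, (enDifferential k n 0).mulVec u = (topMatrix k n a b).mulVec f := by
  rw [exists_enDifferential_zero_eq_iff_apply, mem_rationalNormalCurveIdeal_iff,
    leSubst_topMatrix_mulVec hbn, geSubst_topMatrix_mulVec hbn, h1, h2, mul_zero, mul_zero]
  exact ⟨rfl, rfl⟩

theorem exists_enDifferential_eq_botMatrix (hbn : b ≤ n)
    (f : fBasis n b (0 + 1) → MvPolynomial (Fin (n + 1)) k)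
    (h1 : leAug (n - b) f = 0) (h2 : geAug f = 0) :
    ∃ u, (enDifferential k n 0).mulVec u = (botMatrix k n a b d).mulVec f := by
  rw [exists_enDifferential_zero_eq_iff_apply, mem_rationalNormalCurveIdeal_iff,
    leSubst_botMatrix_mulVec hbn, geSubst_botMatrix_mulVec, h1, h2, mul_zero, mul_zero]
  exact ⟨rfl, rfl⟩

/-- The kernel of the map to `R ⧸ J` given by the binomials. -/
theorem exists_enDifferential_eq_sub_iff (hb : 1 ≤ b) (hbn : b ≤ n)
    (f : fBasis n b (0 + 1) → MvPolynomial (Fin (n + 1)) k) :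
    (∃ u, (enDifferential k n 0).mulVec u = (topMatrix k n a b - botMatrix k n a b d).mulVec f) ↔
      leAug (n - b) f = 0 ∧ geAug f = 0 := by
  have hb0 : b ≠ 0 := by omega
  rw [exists_enDifferential_zero_eq_iff_apply, mem_rationalNormalCurveIdeal_iff,
    Matrix.sub_mulVec, Pi.sub_apply, map_sub, map_sub, leSubst_topMatrix_mulVec hbn,
    leSubst_botMatrix_mulVec hbn, geSubst_topMatrix_mulVec hbn, geSubst_botMatrix_mulVec,
    ← sub_mul, ← sub_mul]
  refine and_congr ?_ ?_
  -- At `x = 0` the bottom factor vanishes on this chart since `b ≥ 1`, and a power of `Xₙ`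
  -- survives. On the other chart the top factor vanishes and a power of `X₀` survives. The common
  -- factor is thus nonzero on both.
  · refine mul_eq_zero_iff_left fun h => ?_
    have := congrArg (Polynomial.eval 0) h
    simp [hb0] at this
  · refine mul_eq_zero_iff_left fun h => ?_
    have := congrArg (Polynomial.eval 0) h
    simp [hb0] at this

theorem mem_binomialIdeal_iff (f : MvPolynomial (Fin (n + 1)) k) :
    f ∈ binomialIdeal k n a b d ↔ ∃ x y, (enDifferential k n 0).mulVec x (enUnit n) +
      (topMatrix k n a b - botMatrix k n a b d).mulVec y (enUnit n) = f := by
  rw [binomialIdeal, Submodule.mem_sup]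
  constructor
  · rintro ⟨p, hp, q, hq, rfl⟩
    obtain ⟨x, hx⟩ := (exists_enDifferential_zero_eq_iff p).2 hp
    obtain ⟨y, hy⟩ : ∃ y, (topMatrix k n a b - botMatrix k n a b d).mulVec y (enUnit n) = q := by
      refine Submodule.span_induction ?_ ⟨0, by simp⟩ ?_ ?_ hq
      · rintro _ ⟨κ, hκ, rfl⟩
        have hx : ((∅ : Finset (Fin n)), κ) ∈ fBasis n b (0 + 1) := by
          simp [fBasis, hκ]
        refine ⟨Pi.single ⟨_, hx⟩ 1, ?_⟩
        rw [Matrix.mulVec_single_one]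
        rfl
      · rintro _ _ _ _ ⟨u, rfl⟩ ⟨v, rfl⟩
        exact ⟨u + v, by rw [Matrix.mulVec_add]; rfl⟩
      · rintro r _ _ ⟨u, rfl⟩
        exact ⟨r • u, by rw [Matrix.mulVec_smul]; rfl⟩
    exact ⟨x, y, by rw [hx, hy]⟩
  · rintro ⟨x, y, rfl⟩
    refine ⟨_, (exists_enDifferential_zero_eq_iff_apply _).1 ⟨x, rfl⟩, _, ?_, rfl⟩
    refine Ideal.sum_mem _ fun z _ => Ideal.mul_mem_right _ _ (Ideal.subset_span ?_)
    exact ⟨z.1.2, le_of_mem_fBasis_one z, rfl⟩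

theorem isWeightedHomogeneous_neg_one_pow_mul {σ R M : Type*} [CommRing R] [AddCommMonoid M]
    {w : σ → M} (j : ℕ) {p : MvPolynomial σ R} {e : M} (h : IsWeightedHomogeneous w p e) :
    IsWeightedHomogeneous w ((-1) ^ j * p) e := by
  rcases neg_one_pow_eq_or (MvPolynomial σ R) j with h' | h'
  · rwa [h', one_mul]
  · rw [h', neg_one_mul]
    exact (weightedHomogeneousSubmodule R w e).neg_mem h

theorem biDegree_of_fBasis_one (x : fBasis n b (0 + 1)) :
    biDegree x.1.1 x.1.2 = (0, (x.1.2 : ℤ)) := by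
  have hx := (mem_spliceBasis_of_le (Nat.zero_le _) _).1 (mem_spliceBasis_of_fBasis x)
  simp [biDegree, Finset.card_eq_zero.1 hx.1]

theorem biDegree_enUnit (y : enBasis n 0) : biDegree y.1.1 y.1.2 = 0 := by
  rw [eq_enUnit y]
  simp [biDegree, enUnit]

theorem isWeightedHomogeneous_topMatrix (hbn : b ≤ n) (y : enBasis n 0)
    (x : fBasis n b (0 + 1)) :
    IsWeightedHomogeneous (biWeight n) (topMatrix k n a b y x)
      (biDegree x.1.1 x.1.2 + (((a + 1 : ℕ) : ℤ), ((a * n + b : ℕ) : ℤ)) - biDegree y.1.1 y.1.2) := by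
  have hx := le_of_mem_fBasis_one x
  rw [biDegree_enUnit, biDegree_of_fBasis_one, sub_zero]
  refine isWeightedHomogeneous_neg_one_pow_mul _ ?_
  have h := ((isWeightedHomogeneous_X k (biWeight n) (Fin.last n)).pow a).mul
    (isWeightedHomogeneous_X k (biWeight n) (Fin.ofNat (n + 1) (b + x.1.2)))
  convert h using 1
  · rfl
  · simp only [biWeight, Fin.val_last, val_ofNat_of_le (show b + x.1.2 ≤ n by omega)]
    ext
    · simp
    · simp
      ring

theorem isWeightedHomogeneous_botMatrix (y : enBasis n 0) (x : fBasis n b (0 + 1)) :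
    IsWeightedHomogeneous (biWeight n) (botMatrix k n a b d y x)
      (biDegree x.1.1 x.1.2 + (((a + d + 1 : ℕ) : ℤ), (0 : ℤ)) - biDegree y.1.1 y.1.2) := by
  have hx := le_of_mem_fBasis_one x
  rw [biDegree_enUnit, biDegree_of_fBasis_one, sub_zero]
  refine isWeightedHomogeneous_neg_one_pow_mul _ ?_
  have h := ((isWeightedHomogeneous_X k (biWeight n) 0).pow (a + d)).mul
    (isWeightedHomogeneous_X k (biWeight n) (Fin.ofNat (n + 1) x.1.2))
  convert h using 1
  · rfl
  · simp only [biWeight, Fin.val_zero, val_ofNat_of_le (show x.1.2 ≤ n by omega)]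
    ext <;> simp

end CurveAugmentation

/-! ### The comparison map from `F` to `E` -/

section CurveResolution

variable {k : Type*} [Field k] {n a b d : ℕ}

/-- The differential of the complement `F` of the Eagon–Northcott complex. -/
noncomputable def fDifferential (k : Type*) [Field k] (n b : ℕ) :
    ∀ s, Matrix (fBasis n b s) (fBasis n b (s + 1)) (MvPolynomial (Fin (n + 1)) k)
  | 0 => 0
  | s + 1 => spliceMatrix k (n - b) s (fBasis n b (s + 1)) (fBasis n b (s + 1 + 1))

theorem fDifferential_exact (s : ℕ) (v : fBasis n b (s + 1 + 1) → MvPolynomial (Fin (n + 1)) k) :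
    (fDifferential k n b (s + 1)).mulVec v = 0 ↔
      ∃ w, (fDifferential k n b (s + 1 + 1)).mulVec w = v :=
  splice_exact_of_eq (fBasis_succ_eq_spliceBasis n b) s v

theorem exists_fDifferential_one_eq_iff
    (v : fBasis n b (0 + 1) → MvPolynomial (Fin (n + 1)) k) :
    (∃ w, (fDifferential k n b (0 + 1)).mulVec w = v) ↔ leAug (n - b) v = 0 ∧ geAug v = 0 :=
  splice_exact_zero_of_eq (fBasis_succ_eq_spliceBasis n b) v

instance isEmpty_fBasis_zero : IsEmpty (fBasis n b 0) :=
  ⟨fun x => absurd x.2 (by simp [fBasis])⟩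

theorem isWeightedHomogeneous_fDifferential {m : Fin (n + 1) → ℕ}
    (hm : IsArithmeticSequence m d) (s : ℕ) (y : fBasis n b s) (x : fBasis n b (s + 1)) :
    IsWeightedHomogeneous (fun i => (m i : ℤ)) (fDifferential k n b s y x)
      (fDegree n (m 0) a b d (s + 1) x - fDegree n (m 0) a b d s y) := by
  cases s with
  | zero => exact isEmptyElim y
  | succ s =>
    rw [fDegree_eq, fDegree_eq, add_sub_add_right_eq_sub, ← map_sub]
    exact (isWeightedHomogeneous_spliceMatrix (n - b) s y x).map_weight _ hm.weight_eq

theorem fDifferential_mem_span_X (s : ℕ) (y : fBasis n b s) (x : fBasis n b (s + 1)) :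
    fDifferential k n b s y x ∈
      Ideal.span (Set.range (X : Fin (n + 1) → MvPolynomial (Fin (n + 1)) k)) := by
  cases s with
  | zero => exact isEmptyElim y
  | succ s =>
    exact spliceMatrix_mem_span_X (congrFun (fBasis_succ_eq_spliceBasis n b) s)
      (congrFun (fBasis_succ_eq_spliceBasis n b) (s + 1)) y x

/-- A bihomogeneous map `F₁ → R` that sends the image of `F₂` into the ideal of the rational
normal curve extends to a bihomogeneous chain map into the Eagon–Northcott complex. -/
theorem exists_chainMap_enDifferential (e : ℤ × ℤ)
    (ψ₀ : Matrix (enBasis n 0) (fBasis n b (0 + 1)) (MvPolynomial (Fin (n + 1)) k))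
    (hψ₀ : ∀ y x, IsWeightedHomogeneous (biWeight n) (ψ₀ y x)
      (biDegree x.1.1 x.1.2 + e - biDegree y.1.1 y.1.2))
    (hlift : ∀ f, leAug (n - b) f = 0 → geAug f = 0 →
      ∃ u, (enDifferential k n 0).mulVec u = ψ₀.mulVec f) :
    ∃ ψ : ∀ s, Matrix (enBasis n s) (fBasis n b (s + 1)) (MvPolynomial (Fin (n + 1)) k),
      ψ 0 = ψ₀ ∧
      (∀ s y x, IsWeightedHomogeneous (biWeight n) (ψ s y x)
        (biDegree x.1.1 x.1.2 + e - biDegree y.1.1 y.1.2)) ∧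
      ∀ s, enDifferential k n s * ψ (s + 1) = ψ s * fDifferential k n b (s + 1) := by
  refine exists_homogeneous_chainMap (ι := fun s => enBasis n s)
    (κ := fun s => fBasis n b (s + 1)) (DE := enDifferential k n)
    (DF := fun s => fDifferential k n b (s + 1)) (dE := fun _ y => biDegree y.1.1 y.1.2)
    (dF := fun _ x => biDegree x.1.1 x.1.2 + e) ?_ ?_ (fun s v => (enDifferential_exact s v).1)
    (fun s v => (fDifferential_exact s _).2 ⟨v, rfl⟩) ψ₀ hψ₀ fun v => ?_
  · intro s y x
    rw [enDifferential_eq_spliceMatrix]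
    exact isWeightedHomogeneous_spliceMatrix 0 s y x
  · intro s y x
    rw [add_sub_add_right_eq_sub]
    exact isWeightedHomogeneous_spliceMatrix (n - b) s y x
  · obtain ⟨h1, h2⟩ := (exists_fDifferential_one_eq_iff _).1 ⟨v, rfl⟩
    exact hlift _ h1 h2

/-- The set indexing `E_s` has at most `s + 1` elements and the one indexing `F_{s+1}` at least `s`,
so a shift of standard degree `2` suffices; `a ≥ 1` provides it. -/
theorem fst_biDegree_pos {s : ℕ} {e : ℤ × ℤ} (he : 2 ≤ e.1) (y : enBasis n s)
    (x : fBasis n b (s + 1)) :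
    0 < (biDegree x.1.1 x.1.2 + e - biDegree y.1.1 y.1.2).1 := by
  have hy : y.1 ∈ spliceBasis n 0 s := by
    rw [← enBasis_eq_spliceBasis]
    exact y.2
  have hx := card_of_mem_spliceBasis (mem_spliceBasis_of_fBasis x)
  have hy := card_of_mem_spliceBasis hy
  simp only [biDegree, Prod.fst_sub, Prod.fst_add, hy, hx]
  split_ifs <;> push_cast <;> omega

/-- The comparison map from the complement to the Eagon–Northcott complex. -/
theorem exists_comparison {m : Fin (n + 1) → ℕ} (hm : IsArithmeticSequence m d) (ha : 1 ≤ a)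
    (hbn : b ≤ n) (hab : m 0 = a * n + b) :
    ∃ U : ∀ s, Matrix (enBasis n s) (fBasis n b (s + 1)) (MvPolynomial (Fin (n + 1)) k),
      U 0 = topMatrix k n a b - botMatrix k n a b d ∧
      (∀ s y x, IsWeightedHomogeneous (fun i => (m i : ℤ)) (U s y x)
        (fDegree n (m 0) a b d (s + 1) x - enDegree n (m 0) d s y)) ∧
      (∀ s y x, U s y x ∈
        Ideal.span (Set.range (X : Fin (n + 1) → MvPolynomial (Fin (n + 1)) k))) ∧
      ∀ s, enDifferential k n s * U (s + 1) + U s * fDifferential k n b (s + 1) = 0 := by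
  obtain ⟨ψ, hψ0, hψ, hψc⟩ := exists_chainMap_enDifferential _ (topMatrix k n a b)
    (isWeightedHomogeneous_topMatrix hbn)
    (exists_enDifferential_eq_topMatrix hbn)
  obtain ⟨φ, hφ0, hφ, hφc⟩ := exists_chainMap_enDifferential _ (botMatrix k n a b d)
    isWeightedHomogeneous_botMatrix
    (exists_enDifferential_eq_botMatrix hbn)
  -- The lifts commute with the differentials, whereas the off-diagonal block of the cone must
  -- anticommute; hence the alternating sign.
  refine ⟨fun s => (-1 : MvPolynomial (Fin (n + 1)) k) ^ s • (ψ s - φ s), ?_, fun s y x => ?_,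
    fun s y x => ?_, fun s => ?_⟩
  · change (-1 : MvPolynomial (Fin (n + 1)) k) ^ 0 • (ψ 0 - φ 0) = _
    rw [pow_zero, one_smul, hψ0, hφ0]
  · change IsWeightedHomogeneous _ ((-1) ^ s * (ψ s y x - φ s y x)) _
    refine isWeightedHomogeneous_neg_one_pow_mul _ ?_
    rw [fDegree_eq, enDegree_eq]
    have h1 := (hψ s y x).map_weight (biToWeight (m 0) d) hm.weight_eq
    have h2 := (hφ s y x).map_weight (biToWeight (m 0) d) hm.weight_eq
    rw [map_sub, map_add] at h1 h2
    -- The bidegrees of the two shifts differ, but `m₀ (a + 1) + d (a n + b) = m₀ (a + d + 1)`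
    -- because `m₀ = a n + b`.
    have e1 : biToWeight (m 0) d (((a + 1 : ℕ) : ℤ), ((a * n + b : ℕ) : ℤ)) =
        m 0 * (a + d + 1) := by
      rw [biToWeight_apply, ← hab]
      push_cast
      ring
    have e2 : biToWeight (m 0) d (((a + d + 1 : ℕ) : ℤ), (0 : ℤ)) = m 0 * (a + d + 1) := by
      rw [biToWeight_apply]
      push_cast
      ring
    rw [e1] at h1
    rw [e2] at h2
    exact (weightedHomogeneousSubmodule k _ _).sub_mem h1 h2
  · change (-1) ^ s * (ψ s y x - φ s y x) ∈ _
    refine Ideal.mul_mem_left _ _ (Ideal.sub_mem _ ?_ ?_)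
    · refine mem_span_X_of_isWeightedHomogeneous (hψ s y x) (fst_biDegree_pos ?_ y x)
      push_cast
      omega
    · refine mem_span_X_of_isWeightedHomogeneous (hφ s y x) (fst_biDegree_pos ?_ y x)
      push_cast
      omega
  · rw [Matrix.mul_smul, Matrix.smul_mul, Matrix.mul_sub, Matrix.sub_mul, hψc, hφc, pow_succ,
      mul_neg_one, neg_smul, neg_add_cancel]

end CurveResolution

/-! ### The main theorem -/

theorem theorem3p4 {k : Type*} [Field k] {n : ℕ} (m : Fin (n + 1) → ℕ) (a b d : ℕ)
    (hm : IsArithmeticSequence m d) (ha : 1 ≤ a) (hb : 1 ≤ b) (hbn : b ≤ n)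
    (hab : m 0 = a * n + b) :
    IsCohenMacaulay (MvPolynomial (Fin (n + 1)) k ⧸ monomialCurveIdeal k m) ∧
    (monomialCurveIdeal k m).height = n ∧
    IsMinimalGradedFreeResolution (fun i => (m i : ℤ)) (rationalNormalCurveIdeal k n)
      (enDegree n (m 0) d) (enDifferential k n) (fun _ => 1) ∧
    ∃ (U : ∀ s, Matrix (enBasis n s) (fBasis n b (s + 1)) (MvPolynomial (Fin (n + 1)) k))
      (V : ∀ s, Matrix (fBasis n b s) (fBasis n b (s + 1)) (MvPolynomial (Fin (n + 1)) k)),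
      IsMinimalGradedFreeResolution (ι := fun s => enBasis n s ⊕ fBasis n b s)
        (fun i => (m i : ℤ)) (monomialCurveIdeal k m)
        (fun s => Sum.elim (enDegree n (m 0) d s) (fDegree n (m 0) a b d s))
        (fun s => Matrix.fromBlocks (enDifferential k n s) (U s) 0 (V s))
        (fun _ => 1) := by
  have hm0 : 0 < m 0 := by omega
  have hpos : ∀ i, 0 < m i := fun i => by
    rw [hm.eq_add i]
    omega
  have := dimensionLEOne_monomialCurve (k := k) m hm0
  refine ⟨isCohenMacaulay_of_dimensionLEOne _, height_monomialCurveIdeal m hpos,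
    isMinimalGradedFreeResolution_enDifferential hm, ?_⟩
  obtain ⟨U, hU0, hUw, hUX, hUc⟩ := exists_comparison (k := k) hm ha hbn hab
  refine ⟨U, fDifferential k n b, ?_, ?_, ?_, ?_, ?_, ?_⟩
  · rintro (y | y)
    · change IsWeightedHomogeneous _ _ (enDegree n (m 0) d 0 y)
      rw [enDegree, if_pos rfl]
      exact isWeightedHomogeneous_one _ _
    · exact isEmptyElim y
  · rintro s (y | y) (x | x)
    · exact isWeightedHomogeneous_enDifferential hm s y x
    · exact hUw s y x
    · exact isWeightedHomogeneous_zero _ _ _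
    · exact isWeightedHomogeneous_fDifferential hm s y x
  · intro x
    obtain ⟨f, rfl⟩ := Ideal.Quotient.mk_surjective x
    refine ⟨Pi.single (Sum.inl (enUnit n)) f, ?_⟩
    rw [Fintype.linearCombination_apply_single]
    exact congrArg (Ideal.Quotient.mk _) (mul_one f)
  · intro v
    have h1 : Fintype.linearCombination (MvPolynomial (Fin (n + 1)) k)
        (fun _ : enBasis n 0 ⊕ fBasis n b 0 => Ideal.Quotient.mk (monomialCurveIdeal k m) 1) v =
        Ideal.Quotient.mk _ (v (Sum.inl (enUnit n))) := by
      rw [Fintype.linearCombination_apply, Fintype.sum_eq_single (Sum.inl (enUnit n))]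
      · exact congrArg (Ideal.Quotient.mk _) (mul_one _)
      · rintro (x | x) hx
        · exact absurd (congrArg Sum.inl (eq_enUnit x)) hx
        · exact isEmptyElim x
    -- The first differential of the cone consists of the minors and the binomials, so exactness at
    -- `R` is the description of the ideal by these generators.
    rw [h1, Ideal.Quotient.eq_zero_iff_mem, monomialCurveIdeal_eq hm hb hbn hab,
      mem_binomialIdeal_iff]
    constructor
    · rintro ⟨x, y, h⟩
      refine ⟨Sum.elim x y, ?_⟩
      rw [Matrix.mulVecLin_apply, Matrix.fromBlocks_mulVec, Sum.elim_comp_inl, Sum.elim_comp_inr]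
      funext z
      rcases z with z | z
      · rw [eq_enUnit z, ← h, ← hU0]
        rfl
      · exact isEmptyElim z
    · rintro ⟨u, rfl⟩
      refine ⟨u ∘ Sum.inl, u ∘ Sum.inr, ?_⟩
      rw [Matrix.mulVecLin_apply, Matrix.fromBlocks_mulVec, ← hU0]
      rfl
  · refine mulVec_fromBlocks_exact (ι := fun s => enBasis n s) (κ := fun s => fBasis n b s)
      (U := U) enDifferential_exact fDifferential_exact (fun v => ?_) hUc
    rw [hU0, exists_enDifferential_eq_sub_iff hb hbn, exists_fDifferential_one_eq_iff]
  · rintro s (y | y) (x | x)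
    · exact enDifferential_mem_span_X s y x
    · exact hUX s y x
    · exact Ideal.zero_mem _
    · exact fDifferential_mem_span_X s y x
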